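/- **Setting.** Items $1,\dots,n$ arrive in this order, item $i$ has color $c(i)$, and a buffer holds $k\ge 2$ items. Put $k'=\lfloor k-\frac{2k}{\ln k}\rfloor$ and assume $k'\ge 1$. For a buffer size $\kappa$, a *schedule* is a perfect matching of the items to the output slots $\kappa+1,\dots,\kappa+n$ that observes the input order on each color and matches each item $i$ to a slot later than $i$. A *batch* is a pair $(I,j)$, where $I$ is a nonempty set of items of one color $c(I)$ containing all items of that color between its first and last item, such that some schedule with $\kappa=k'$ outputs $I$, in order, in the slots $j,\dots,j+|I|-1$. **The algorithm.** It maintains an output slot $t$ (initially $k+1$), weights $x_{J,s}\ge 0$ with which sets $J$ of items of one color are scheduled in consecutive slots from slot $s$ on, and numbers $\hat y_i,\bar y_i$ ($1\le i\le n$), $\hat z_j$ ($k'<j\le k'+n$) and $\hat\sigma_{I,j}$ (for the batches), all initially $0$. An item is *satisfied* if it is scheduled with total weight at least $1$. $B_c$ is the set of the unsatisfied items $i<t$ of color $c$, and $B=\bigcup_c B_c$. Each item of $B$ is fractional, integral or frozen; the frozen items of $B_c$ form $B_c^{frz}$, the others form $B_c^{act}$, which is fractional or integral. Initially the items $i\le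 k$ are frozen. A new item is appended to a scheduled set of its color whose schedule has not passed its end when its state is the same as that of the items in that set. *Regular execution* (as long as none of the cases below applies). During time $d\mu$ all $\hat y_i$ of unsatisfied items (including future ones) and all $\hat z_j$ with $j\ge t$ rise by $d\mu$; $\hat\sigma_{I,j}$ rises by $d\mu$ times the number of items of $B^{act}_{c(I)}\cap I$ that $(I,j)$ matches before slot $t$; and for each color $c$ with nonempty fractional $B_c^{act}=J$, $x_{J,t}$ rises at the rate $\max\{\frac{d\hat x_{I,j}}{d\mu}: c(I)=c\}$, where $\hat x=\frac{\hat\sigma}{\ln k}$ if $\hat\sigma<1$ and $\hat x=\frac{e^{\hat\sigma-1}}{\ln k}$ if $\hat\sigma\ge1$. What is scheduled so is *relevant* to each batch of color $c$ that matches an item of $B_c$ before slot $t$ at that time. *Regular reset:* let $f\in I$ be the first item that interrupts a scheduled set relevant to $(I,j)$, i.e. $f$ is the first item of $B_c^{frz}$ when that set ends. Once fewer than $\frac12|B_c|$ items of $B_c$ precede $f$, $\hat\sigma_{I,j}$ is reset to $0$ (at most once for each batch). *Case 1.* An item that becomes satisfied leaves $B$. *Case 2.* When the weight scheduled in slot $t$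 reaches $1$, $t$ is incremented, and the next item enters the buffer: as integral if the buffer has integral items of its color, otherwise as frozen. *Case 3.* If $|B_c^{frz}|>\frac{k}{100\ln k}$, all the remaining weight of $B_c^{act}$ is scheduled (each time in the current slot $t$, with as much weight as the slot and the first item of $B_c^{act}$ allow); then the items of $B_c^{frz}$ become integral, and $\hat\sigma_{I,j}$ is reset to $0$ for all batches of color $c$. *Case 4.* If Case 3 does not apply to $c$, $B_c^{act}$ is not integral and $|B_c^{act}|<\frac{k}{10\ln k}$, then the items of $B_c^{frz}$ become fractional. *Case 5.* If $B_c^{act}$ is integral and $\hat\sigma_{I,j}\ge1$ for a batch of color $c$, then all fractionally scheduled sets that have not ended are suspended, $\bar y_i$ is set to $\frac1{2|B_c^{act}|}$ for $i\in B_c^{act}$, and $B_c^{act}$, followed by the items of color $c$ that arrive while it is being evicted, is scheduled with weight $1$ from slot $t$ on. The unfinished portions of the suspended sets are rescheduled after it, and $\hat\sigma_{I,j}$ is reset to $0$ for all batches of color $c$. *Case 6.* If sets of color $c$ scheduled by regular execution, of total weight at least $\frac1{10}$, have ended (suspension is not an end) since the last application of this case to $c$, then the procedure of Case 5 is applied to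 $B_c^{frz}$, without changing $\bar y$ (if $B_c^{frz}=\emptyset$, nothing is scheduled). State changes of items (Case 4, and the last part of Case 3) are executed first; then sets that have reached their end are closed; then come Case 2, the scheduling of Case 3, and finally Cases 5, 6 and the regular resets. The order is otherwise arbitrary. The process ends when $t$ exceeds $k'+n$. **Claim.** There is an absolute constant $C>0$ such that for all $k\ge2$ with $k'\ge1$, all $n$, all colorings and every execution of the algorithm, at the end of the process $$\sum_{(J,s)}x_{J,s}\ \le\ C\cdot\Big(\sum_{i=1}^n\hat y_i+\sum_{i=1}^n\bar y_i-\sum_{j=k'+1}^{k'+n}\hat z_j\Big).$$ The sum on the left includes everything that has been scheduled when $t$ passes $k'+n$ (also in later slots), but not the final eviction of the buffer contents that remain after that. -/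

import Mathlib

/-! The fractional (primal-dual) online algorithm for reordering buffer management, as a
transition system.  The input consists of the items `1, …, n`; item `i` has color `c i`; it is in
the buffer, or has been in it, at output slot `t` iff `i < t`. -/

namespace RBM

noncomputable section

open scoped Classical

/-- A pair `(I, j)`: the items of `I` are output in their input order in the slots
`j, j + 1, …, j + |I| - 1`. -/
abbrev Batch := Finset ℕ × ℕ

/-- The number of items of `I` that precede `i`. -/
def rank (I : Finset ℕ) (i : ℕ) : ℕ := (I.filter (fun i' => i' < i)).card

/-- The output slot to which `(I, j)` matches the item `i ∈ I`. -/
def slotOf (b : Batch) (i : ℕ) : ℕ := b.2 + rank b.1 i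

/-- A solution with a buffer of size `κ`: a perfect matching of the items to the output slots
`κ + 1, …, κ + n` which observes the input order on each color and the arrival times. -/
def IsSchedule (κ n : ℕ) (c : ℕ → ℕ) (π : ℕ → ℕ) : Prop :=
  Set.BijOn π (Set.Icc 1 n) (Set.Icc (κ + 1) (κ + n)) ∧
  (∀ i ∈ Set.Icc 1 n, ∀ i' ∈ Set.Icc 1 n, c i = c i' → i < i' → π i < π i') ∧
  (∀ i ∈ Set.Icc 1 n, i < π i)

/-- `(I, j)` is a batch of color `col` for the buffer size `κ`: `I` is a nonempty set of items of
color `col` that contains all the items of this color between its first and its last item, and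
some solution outputs `I` starting at slot `j`. -/
def IsBatch (κ n : ℕ) (c : ℕ → ℕ) (col : ℕ) (b : Batch) : Prop :=
  b.1.Nonempty ∧ b.1 ⊆ Finset.Icc 1 n ∧ (∀ i ∈ b.1, c i = col) ∧
  (∀ i ∈ b.1, ∀ i' ∈ b.1, ∀ m, i < m → m < i' → c m = col → m ∈ b.1) ∧
  ∃ π, IsSchedule κ n c π ∧ ∀ i ∈ b.1, π i = slotOf b i

/-- The smaller buffer size `k' = k - 2k / ln k` (rounded down) of the dual solution. -/
def smallBuffer (k : ℕ) : ℕ := ⌊(k : ℝ) - 2 * k / Real.log k⌋₊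

/-- The bound `k / (100 ln k)` on the size of a frozen block. -/
def frozenBound (k : ℕ) : ℝ := k / (100 * Real.log k)

/-- The bound `k / (10 ln k)` below which a fractional block is replenished. -/
def activeBound (k : ℕ) : ℝ := k / (10 * Real.log k)

/-- The pseudo-primal variable as a function of the pseudo-dual cost. -/
def xhat (k : ℕ) (σ : ℝ) : ℝ :=
  if σ < 1 then σ / Real.log k else Real.exp (σ - 1) / Real.log k

inductive ItemState where
  | fractional
  | integral
  | frozen

/-- A scheduled batch (or part of one): `items`, all of color `color`, are output with weight
`weight` in consecutive slots from `start` on.  `regular` says that it stems from regular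
execution, `rel` is the set of the batches to whose dual cost it is relevant. -/
structure Piece where
  color : ℕ
  items : Finset ℕ
  start : ℕ
  weight : ℝ
  regular : Prop
  rel : Set Batch

/-- The first slot after the current end of the schedule of a piece. -/
def Piece.nextSlot (p : Piece) : ℕ := p.start + p.items.card

/-- The state of the algorithm. -/
structure State where
  /-- the current output slot -/
  t : ℕ
  /-- the states of the items -/
  status : ℕ → ItemState
  yhat : ℕ → ℝ
  ybar : ℕ → ℝ
  zhat : ℕ → ℝ
  /-- the pseudo-dual costs of the batches -/
  sigma : Batch → ℝ
  /-- pieces whose slots have all passed -/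
  past : Multiset Piece
  /-- scheduled fractional batches that have not ended -/
  live : Multiset Piece
  /-- the unfinished portions of the suspended batches -/
  susp : Multiset Piece
  /-- the weight-1 batch that is being evicted, if there is one -/
  block : Option Piece
  /-- whether that batch is an integral block (otherwise it is a weight-1 fractional batch) -/
  blockIntegral : Prop
  /-- for each color, the weight of the regular batches that ended since the last Case 6 -/
  ended : ℕ → ℝ
  /-- the first item of the batch that interrupted a scheduled batch relevant to it -/
  firstInt : Batch → Option ℕ
  /-- the batches that have experienced their regular reset -/
  wasReset : Set Batch

namespace State

variable (k n : ℕ) (c : ℕ → ℕ) (S : State)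

/-- The start: the first `k` items are in the buffer, and nothing is scheduled. -/
def init : State where
  t := k + 1
  status := fun _ => ItemState.frozen
  yhat := fun _ => 0
  ybar := fun _ => 0
  zhat := fun _ => 0
  sigma := fun _ => 0
  past := 0
  live := 0
  susp := 0
  block := none
  blockIntegral := False
  ended := fun _ => 0
  firstInt := fun _ => none
  wasReset := ∅

/-- The weight-1 batch that is being evicted, as a multiset with at most one element. -/
def blockPieces : Multiset Piece := S.block.elim 0 (fun p => {p})

/-- Everything that is scheduled; suspended batches continue right after the weight-1 batch. -/
def placed : Multiset Piece :=
  S.past + S.live + S.blockPieces +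
    S.susp.map (fun p => { p with start := S.block.elim S.t Piece.nextSlot })

/-- The primal solution `x_{I,j}`. -/
def x (b : Batch) : ℝ :=
  ((S.placed.filter (fun p => (p.items, p.start) = b)).map Piece.weight).sum

/-- The primal cost `∑ x_{I,j}` (only finitely many terms are not zero). -/
def primalCost : ℝ := ∑ᶠ b : Batch, S.x b

/-- `∑ ŷ_i + ∑ ȳ_i - ∑ ẑ_j`. -/
def dualCost : ℝ :=
  ∑ i ∈ Finset.Icc 1 n, S.yhat i + ∑ i ∈ Finset.Icc 1 n, S.ybar i
    - ∑ j ∈ Finset.Icc (smallBuffer k + 1) (smallBuffer k + n), S.zhat j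

/-- The total weight with which item `i` is scheduled: the left side of its primal constraint. -/
def load (i : ℕ) : ℝ := ((S.placed.filter (fun p => i ∈ p.items)).map Piece.weight).sum

/-- The total weight scheduled in slot `j`: the left side of its primal constraint. -/
def slotLoad (j : ℕ) : ℝ :=
  ((S.placed.filter (fun p => p.start ≤ j ∧ j < p.nextSlot)).map Piece.weight).sum

/-- The set `B`: the items encountered so far whose primal constraint is violated.  (Case 1, where
such a constraint becomes satisfied, is the item's leaving this set.) -/
def B : Finset ℕ := (Finset.Icc 1 n).filter (fun i => i < S.t ∧ S.load i < 1)

def Bcol (col : ℕ) : Finset ℕ := (S.B n).filter (fun i => c i = col)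

/-- The frozen block of a color. -/
def frz (col : ℕ) : Finset ℕ := (S.Bcol n c col).filter (fun i => S.status i = .frozen)

/-- The active block of a color. -/
def act (col : ℕ) : Finset ℕ := (S.Bcol n c col).filter (fun i => S.status i ≠ .frozen)

/-- The active block of the color is nonempty and integral. -/
def IsIntegral (col : ℕ) : Prop := ∃ i ∈ S.Bcol n c col, S.status i = .integral

/-- The active block of the color is nonempty and fractional. -/
def IsFractional (col : ℕ) : Prop := ∃ i ∈ S.Bcol n c col, S.status i = .fractional

/-- The number of active items that the batch matches before slot `t`:
the rate of increase of its pseudo-dual cost. -/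
def rate (b : Batch) : ℕ :=
  (b.1.filter (fun i => i ∈ S.B n ∧ S.status i ≠ .frozen ∧ slotOf b i < S.t)).card

/-- The batches of color `col` that match some item of `B` before slot `t`; batches of this color
that are being scheduled by regular execution are relevant to these. -/
def relevantTo (col : ℕ) : Set Batch :=
  {b | IsBatch (smallBuffer k) n c col b ∧ ∃ i ∈ b.1, i ∈ S.B n ∧ slotOf b i < S.t}

/-- Resetting the pseudo-dual costs of all the batches of a color. -/
def resetColor (col : ℕ) : Batch → ℝ :=
  fun b => if IsBatch (smallBuffer k) n c col b then 0 else S.sigma b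

/-! ### Regular execution -/

/-- The rate at which a color is scheduled after the time `μ` has passed in state `S`:
the maximum of the derivatives of the pseudo-primal variables of its batches. -/
def colorRate (col : ℕ) (μ : ℝ) : ℝ :=
  sSup ((fun b => deriv (fun u : ℝ => xhat k (S.sigma b + S.rate n b * u)) μ) ''
    {b | IsBatch (smallBuffer k) n c col b})

/-- The weight that regular execution during time `δ` schedules for a color. -/
def colorWeight (col : ℕ) (δ : ℝ) : ℝ := ∫ μ in (0 : ℝ)..δ, S.colorRate k n c col μ

/-- Regular execution for time `δ`. -/
def regular (δ : ℝ) : State :=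
  { S with
    yhat := fun i => if S.load i < 1 then S.yhat i + δ else S.yhat i
    zhat := fun j => if S.t ≤ j then S.zhat j + δ else S.zhat j
    sigma := fun b => S.sigma b + S.rate n b * δ
    live := S.live +
      (((Finset.Icc 1 n).image c).filter
        (fun col => S.IsFractional n c col ∧ 0 < S.colorWeight k n c col δ)).val.map
      (fun col =>
        { color := col
          items := S.act n c col
          start := S.t
          weight := S.colorWeight k n c col δ
          regular := True
          rel := S.relevantTo k n c col }) }

/-- The regular reset of a batch is due: it had none so far, and of the items of its color in `B`
less than half arrived before its first interrupting item. -/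
def ResetDue (b : Batch) : Prop :=
  b ∉ S.wasReset ∧ ∃ col, IsBatch (smallBuffer k) n c col b ∧ ∃ f, S.firstInt b = some f ∧
    (((S.Bcol n c col).filter (fun i => i < f)).card : ℝ) < (S.Bcol n c col).card / 2

def regularReset (b : Batch) : State :=
  { S with
    sigma := Function.update S.sigma b 0
    wasReset := insert b S.wasReset }

/-! ### Case 2 -/

def Tight : Prop := 1 ≤ S.slotLoad S.t

/-- Slot `t` is left and item `t` enters the buffer.  It is appended to the weight-1 batch that is
being evicted, if that has the same color. -/
def advance : State :=
  { S with
    t := S.t + 1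
    status := Function.update S.status S.t
      (if S.IsIntegral n c (c S.t) ∨
          (S.blockIntegral ∧ ∃ p, S.block = some p ∧ p.color = c S.t)
        then .integral else .frozen)
    block := S.block.map (fun p =>
      if S.t ≤ n ∧ p.color = c S.t then { p with items := insert S.t p.items } else p) }

/-- Some scheduled batch has no item left for slot `t`. -/
def SomeEnded : Prop := ∃ p ∈ S.live + S.blockPieces, p.nextSlot ≤ S.t

/-- The interruptions by the end of scheduled batches: an ending batch of a color that has frozen
items is interrupted by the first of them. -/
def newFirstInt (b : Batch) : Option ℕ :=
  if h : S.firstInt b = none ∧ ∃ f, ∃ p ∈ S.live, p.nextSlot ≤ S.t ∧ b ∈ p.rel ∧ f ∈ b.1 ∧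
      f ∈ S.frz n c p.color ∧ ∀ i ∈ S.frz n c p.color, f ≤ i
    then some h.2.choose else S.firstInt b

/-- Scheduled batches that have reached their end are closed.  After the end of a weight-1 batch
the suspended batches continue. -/
def closeEnded : State :=
  { S with
    past := S.past + (S.live + S.blockPieces).filter (fun p => p.nextSlot ≤ S.t)
    live := S.live.filter (fun p => S.t < p.nextSlot) +
      (if ∃ p ∈ S.blockPieces, p.nextSlot ≤ S.t
        then S.susp.map (fun p => { p with start := S.t }) else 0)
    susp := if ∃ p ∈ S.blockPieces, p.nextSlot ≤ S.t then 0 else S.susp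
    block := if ∃ p ∈ S.blockPieces, p.nextSlot ≤ S.t then none else S.block
    ended := fun col => S.ended col +
      ((S.live.filter (fun p => p.nextSlot ≤ S.t ∧ p.regular ∧ p.color = col)).map
        Piece.weight).sum
    firstInt := S.newFirstInt n c }

/-! ### Case 3 -/

def FrozenFull (col : ℕ) : Prop := frozenBound k < (S.frz n c col).card

/-- The active block is scheduled in slot `t` with as much weight as both the slot and the first
item of the block allow. -/
def flush (col : ℕ) (h : (S.act n c col).Nonempty) : State :=
  { S with
    live := S.live +
      {{ color := col
         items := S.act n c col
         start := S.t
         weight := min (1 - S.slotLoad S.t) (1 - S.load ((S.act n c col).min' h))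
         regular := False
         rel := ∅ }} }

/-- When the active block is scheduled completely, the frozen block becomes integral. -/
def makeIntegral (col : ℕ) : State :=
  { S with
    status := fun i => if i ∈ S.frz n c col then .integral else S.status i
    sigma := S.resetColor k n c col }

/-! ### Case 4 -/

def Replenishable (col : ℕ) : Prop :=
  ¬ S.IsIntegral n c col ∧ ((S.act n c col).card : ℝ) < activeBound k ∧
    (S.frz n c col).Nonempty ∧ ¬ S.FrozenFull k n c col

/-- The frozen items become fractional, and are appended to all the scheduled fractional batches
of their color that have not ended. -/
def replenish (col : ℕ) : State :=
  { S with
    status := fun i => if i ∈ S.frz n c col then .fractional else S.status i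
    live := S.live.map (fun p =>
      if p.color = col then { p with items := p.items ∪ S.frz n c col } else p)
    susp := S.susp.map (fun p =>
      if p.color = col then { p with items := p.items ∪ S.frz n c col } else p) }

/-! ### Cases 5 and 6 -/

/-- All scheduled fractional batches are suspended (and cut at slot `t`), and a weight-1 batch
that starts with the items of `A`, of color `col`, is scheduled from slot `t` on. -/
def evict (col : ℕ) (A : Finset ℕ) (isInt : Prop) : State :=
  { S with
    past := S.past + (S.live.map (fun p =>
      { p with items := p.items.filter (fun i => slotOf (p.items, p.start) i < S.t) })).filter
        (fun p => p.items.Nonempty)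
    live := 0
    susp := S.live.map (fun p =>
      { p with items := p.items.filter (fun i => S.t ≤ slotOf (p.items, p.start) i) })
    block := some
      { color := col, items := A, start := S.t, weight := 1, regular := False, rel := ∅ }
    blockIntegral := isInt
    sigma := S.resetColor k n c col }

def Case5 (col : ℕ) : Prop :=
  S.IsIntegral n c col ∧ ∃ b, IsBatch (smallBuffer k) n c col b ∧ 1 ≤ S.sigma b

def evictIntegral (col : ℕ) : State :=
  { S.evict k n c col (S.act n c col) True with
    ybar := fun i =>
      if i ∈ S.act n c col then 1 / (2 * ((S.act n c col).card : ℝ)) else S.ybar i }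

def Case6 (col : ℕ) : Prop := 1 / 10 ≤ S.ended col

/-- If there are no frozen items, there is nothing to schedule. -/
def evictFrozen (col : ℕ) : State :=
  if (S.frz n c col).Nonempty then
    { S.evict k n c col (S.frz n c col) False with ended := Function.update S.ended col 0 }
  else
    { S with
      sigma := S.resetColor k n c col
      ended := Function.update S.ended col 0 }

/-! ### The order of the steps -/

/-- No item has to change its state immediately. -/
def Settled : Prop :=
  ∀ col, ¬ (S.FrozenFull k n c col ∧ S.act n c col = ∅) ∧ ¬ S.Replenishable k n c col

/-- Moreover, slot `t` is not tight, and no batch that reached its end is left to be closed. -/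
def AtSlot : Prop := S.Settled k n c ∧ ¬ S.SomeEnded ∧ ¬ S.Tight

/-- Moreover, no application of Case 3 is in progress. -/
def Ready : Prop := S.AtSlot k n c ∧ ∀ col, ¬ S.FrozenFull k n c col

/-- None of the cases holds. -/
def Calm : Prop :=
  S.Ready k n c ∧ (∀ col, ¬ S.Case5 k n c col) ∧ (∀ col, ¬ S.Case6 col) ∧
    ∀ b, ¬ S.ResetDue k n c b

end State

open State

/-- One step of the algorithm. -/
inductive Step (k n : ℕ) (c : ℕ → ℕ) : State → State → Prop
  | makeIntegral (S : State) (col : ℕ) (hfull : S.FrozenFull k n c col)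
      (hact : S.act n c col = ∅) : Step k n c S (S.makeIntegral k n c col)
  | replenish (S : State) (col : ℕ) (h : S.Replenishable k n c col) :
      Step k n c S (S.replenish n c col)
  | closeEnded (S : State) (hset : S.Settled k n c) (h : S.SomeEnded) :
      Step k n c S (S.closeEnded n c)
  | advance (S : State) (hset : S.Settled k n c) (hend : ¬ S.SomeEnded) (h : S.Tight) :
      Step k n c S (S.advance n c)
  | flush (S : State) (col : ℕ) (hat : S.AtSlot k n c) (hfull : S.FrozenFull k n c col)
      (hact : (S.act n c col).Nonempty) : Step k n c S (S.flush n c col hact)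
  | evictIntegral (S : State) (col : ℕ) (hready : S.Ready k n c) (h : S.Case5 k n c col) :
      Step k n c S (S.evictIntegral k n c col)
  | evictFrozen (S : State) (col : ℕ) (hready : S.Ready k n c) (h : S.Case6 col) :
      Step k n c S (S.evictFrozen k n c col)
  | regularReset (S : State) (b : Batch) (hready : S.Ready k n c) (h : S.ResetDue k n c b) :
      Step k n c S (S.regularReset b)
  | regular (S : State) (δ : ℝ) (hδ : 0 < δ)
      (hcalm : ∀ ε, 0 ≤ ε → ε < δ →
        (S.regular k n c ε).Calm k n c ∧ (S.regular k n c ε).B n = S.B n) :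
      Step k n c S (S.regular k n c δ)

/-- `S` is reached by an execution of the algorithm whose steps all start while the current output
slot is at most `k' + n`. -/
def Reaches (k n : ℕ) (c : ℕ → ℕ) (S : State) : Prop :=
  Relation.ReflTransGen (fun S₁ S₂ => S₁.t ≤ smallBuffer k + n ∧ Step k n c S₁ S₂) (State.init k) S

/-- `S` is a final state of the process: the output slot has passed `k' + n`. -/
def Final (k n : ℕ) (c : ℕ → ℕ) (S : State) : Prop :=
  Reaches k n c S ∧ smallBuffer k + n < S.t

end

end RBM

/-! ### One color: views of the state and their structural invariants -/

namespace RBM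

noncomputable section

open scoped Classical

/-! ### Ranks -/

/-! Write K = k / ln k. The scheduled weight is split by origin. For each color let R be the weight
from regular execution, fl the weight from Case 3, and n5, n6 the numbers of evictions in Cases 5
and 6. An eviction adds at most 2: weight 1 for the block, and at most 1 because suspension cuts the
open sets, of total weight at most 1, in two. So the cost is at most the sum of R + fl + 2 n5 + 2 n6
over the colors (`Ledger.cost`). All of it is charged to n5 and to a credit earned during regular
execution.

Dual side. All slots before t are exactly full, so the total load is t - 1 - k plus the mass that is
scheduled from slot t on, and during regular execution this excess is at most 22/100 K because open
sets are short (`Inv.next_le`). Hence the dual cost rises at the rate k - k' - excess + Λ, where Λ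
is the load of B (`Shape.dual_rate`); this is at least 1.78 K + Λ, while |B| / ln k ≤ K + Λ/2.
Crediting each active item of a scheduled color with 1 / ln k plus its load per unit of time
therefore spends at most twice the dual increase. Each application of Case 5 adds 1/2 through the ȳ.
This is the invariant `Good.dual`.

Cases 3 and 6. Case 6 consumes regular weight 1/10 that has ended, so n6 ≤ 10 R. One run of Case 3
schedules at most 1 for its color, which then stays integral until Case 5 applies; so fl ≤ n5 + 1,
and the extra 1 occurs at the end only for colors that are integral or have a full frozen block.
Each of these has more than K/100 items of load 0, so there are at most 300 of them
(`Good.card_heavyColors`). This additive constant is absorbed because filling the first slot already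
keeps the credit or n5 away from 0 (`Good.start`).

Regular weight (`GInv.regular`) is the heart of the proof. A batch matching the active items of J
before slot t raises its x̂ at a rate of at most |J| (1 / ln k + x̂). If x̂ is at most the load of
each active item of the batch (phase `clean`), the weight is at most the credit. This domination can
be lost when a set ends while frozen items wait, since these are never appended to it. From then on
x̂ is at most the load plus ξ, where ξ starts as the open weight, which all items of the active
block F carry. Since |F| ≥ K/10, the loads of F pay for ξ up to a factor 11 as long as K/100 items
of F are unsatisfied (phase `live`). When F is nearly used up, its satisfied items hold a potential
`phi` that was financed by credit; it is cashed as one unit of m, which pays for what is scheduled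
until the rest of F is satisfied (`counted`), and then for a small weight until the next reset
(`dirty`). Once the open weight reaches 1/10 every phase is easy: x̂ is at most the regular weight
that is open or has ended since Case 6, the ended part is below 1/10, and every active item carries
the open weight. The outcome is R ≤ 12 Cr + 2 m with m ≤ 80 Cr, where Cr is the credit plus fl.

The regular resets enter only through the fact that lowering σ̂ lowers x̂. -/

theorem rank_union_of_le {I F : Finset ℕ} {i : ℕ} (h : ∀ f ∈ F, i ≤ f) :
    rank (I ∪ F) i = rank I i := by
  unfold rank
  congr 1
  ext x
  simp only [Finset.mem_filter, Finset.mem_union]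
  constructor
  · rintro ⟨h1 | h1, h2⟩
    · exact ⟨h1, h2⟩
    · exact absurd (h x h1) (by omega)
  · rintro ⟨h1, h2⟩
    exact ⟨Or.inl h1, h2⟩

/-- Ranks run through 0, 1, ..., |I| - 1: a new maximum gets rank |I| and leaves the other ranks
alone. So the number of items of a piece that lie before a slot can be read off from the slot. -/
theorem card_filter_rank_lt (I : Finset ℕ) (m : ℕ) :
    (I.filter (fun i => rank I i < m)).card = min m I.card := by
  induction I using Finset.induction_on_max with
  | empty => simp
  | insert a s ha ih =>
    have hna : a ∉ s := fun h => lt_irrefl _ (ha a h)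
    have hr : ∀ x ∈ s, rank (insert a s) x = rank s x := by
      intro x hx
      rw [show insert a s = s ∪ {a} by ext; simp]
      exact rank_union_of_le (by simpa using (ha x hx).le)
    have hra : rank (insert a s) a = s.card := by
      unfold rank
      congr 1
      ext x
      simp only [Finset.mem_filter, Finset.mem_insert]
      constructor
      · rintro ⟨rfl | h, h2⟩
        · omega
        · exact h
      · intro h
        exact ⟨Or.inr h, ha x h⟩
    rw [Finset.filter_insert, hra, Finset.card_insert_of_notMem hna]
    have he : s.filter (fun i => rank (insert a s) i < m) = s.filter (fun i => rank s i < m) :=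
      Finset.filter_congr (fun x hx => by rw [hr x hx])
    rw [he]
    split_ifs with h
    · rw [Finset.card_insert_of_notMem (by simp [hna]), ih]
      omega
    · rw [ih]
      omega

/-- The items of a piece for the slots from `t` on. -/
def Piece.rest (p : Piece) (t : ℕ) : Finset ℕ :=
  p.items.filter (fun i => t ≤ slotOf (p.items, p.start) i)

theorem Piece.rest_subset (p : Piece) (t : ℕ) : p.rest t ⊆ p.items := Finset.filter_subset _ _

theorem Piece.card_passed (p : Piece) {t : ℕ} (h1 : p.start ≤ t) (h2 : t ≤ p.nextSlot) :
    (p.items.filter (fun i => slotOf (p.items, p.start) i < t)).card = t - p.start := by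
  have h := card_filter_rank_lt p.items (t - p.start)
  unfold nextSlot at h2
  rw [min_eq_left (by omega)] at h
  rw [← h]
  congr 1
  ext i
  simp only [Finset.mem_filter]
  unfold slotOf
  constructor <;> rintro ⟨h, h'⟩ <;> refine ⟨h, ?_⟩ <;> simp only at * <;> omega

theorem Piece.card_rest (p : Piece) {t : ℕ} (h1 : p.start ≤ t) (h2 : t ≤ p.nextSlot) :
    t + (p.rest t).card = p.nextSlot := by
  have h := p.card_passed h1 h2
  have h3 := Finset.card_filter_add_card_filter_not (s := p.items)
    (fun i => slotOf (p.items, p.start) i < t)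
  simp only [not_lt] at h3
  change _ + (p.rest t).card = _ at h3
  unfold nextSlot at *
  omega

/-! ### The algorithm as seen by one color -/

/-- What the items of one color see of a state: `ld` are the loads, `op` the scheduled fractional
pieces that have not ended (suspended ones start at `t`), `sus` says that a weight-1 batch is being
evicted, `blk` that it has this color, `blkInt` that moreover it is integral. -/
structure ColorView where
  t : ℕ
  st : ℕ → ItemState
  ld : ℕ → ℝ
  op : Multiset Piece
  en : ℝ
  sg : Batch → ℝ
  sus : Prop
  blk : Prop
  blkInt : Prop

namespace ColorView

variable (X : Finset ℕ) (V : ColorView)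

def B : Finset ℕ := X.filter (fun i => i < V.t ∧ V.ld i < 1)

def frz : Finset ℕ := (V.B X).filter (fun i => V.st i = .frozen)

def act : Finset ℕ := (V.B X).filter (fun i => V.st i ≠ .frozen)

def Int : Prop := ∃ i ∈ V.B X, V.st i = .integral

def Frac : Prop := ∃ i ∈ V.B X, V.st i = .fractional

/-- The total weight of the open pieces. -/
def W : ℝ := (V.op.map Piece.weight).sum

/-- The total weight of the open pieces from regular execution. -/
def Wr : ℝ := ((V.op.filter (fun p => p.regular)).map Piece.weight).sum

def mkInt : ColorView :=
  { V with st := fun i => if i ∈ V.frz X then .integral else V.st i, sg := fun _ => 0 }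

/-- Case 4. An appended item receives the weight of every open piece at once, hence `W` in total. -/
def repl : ColorView :=
  { V with
    st := fun i => if i ∈ V.frz X then .fractional else V.st i
    op := V.op.map (fun p => { p with items := p.items ∪ V.frz X })
    ld := fun i => if i ∈ V.frz X then V.ld i + V.W else V.ld i }

/-- The end of fractional pieces. The end of a weight-1 block is `unblock`; the two never coincide,
because nothing is live while a block is being evicted. -/
def close : ColorView :=
  { V with
    op := V.op.filter (fun p => V.t < p.nextSlot)
    en := V.en +
      ((V.op.filter (fun p => p.nextSlot ≤ V.t ∧ p.regular)).map Piece.weight).sum }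

def unblock : ColorView := { V with sus := False, blk := False, blkInt := False }

/-- Case 2. Suspended pieces move along with the slot, so that they always start at the current one;
an arriving item of the color of the block is satisfied immediately. -/
def adv : ColorView :=
  { V with
    t := V.t + 1
    st := fun i => if i = V.t ∧ i ∈ X then (if V.Int X ∨ V.blkInt then .integral else .frozen)
      else V.st i
    ld := fun i => if i = V.t ∧ i ∈ X ∧ V.blk then V.ld i + 1 else V.ld i
    op := if V.sus then V.op.map (fun p => { p with start := V.t + 1 }) else V.op }

def addPiece (p : Piece) : ColorView :=
  { V with
    op := V.op + {p}
    ld := fun i => if i ∈ p.items then V.ld i + p.weight else V.ld i }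

/-- Suspension, which every color undergoes in an eviction; the evicted color undergoes `sat` in
addition. -/
def cut : ColorView :=
  { V with
    op := V.op.map (fun p => { p with items := p.rest V.t, start := V.t })
    sus := True }

def sat (A : Finset ℕ) (b : Prop) : ColorView :=
  { V with ld := fun i => if i ∈ A then V.ld i + 1 else V.ld i, blk := True, blkInt := b }

variable {X V} in
theorem mem_B {i : ℕ} : i ∈ V.B X ↔ i ∈ X ∧ i < V.t ∧ V.ld i < 1 := by simp [B]

variable {X V} in
theorem mem_frz {i : ℕ} : i ∈ V.frz X ↔ i ∈ X ∧ i < V.t ∧ V.ld i < 1 ∧ V.st i = .frozen := by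
  simp [frz, B, and_assoc]

variable {X V} in
theorem mem_act {i : ℕ} : i ∈ V.act X ↔ i ∈ X ∧ i < V.t ∧ V.ld i < 1 ∧ V.st i ≠ .frozen := by
  simp [act, B, and_assoc]

variable {X V} in
theorem act_subset_B : V.act X ⊆ V.B X := Finset.filter_subset _ _

/-- The structural invariants of one color; `K` stands for `k / ln k`. -/
structure Inv (k : ℕ) (K : ℝ) : Prop where
  t_ge : k + 1 ≤ V.t
  items_sub : ∀ p ∈ V.op, p.items ⊆ X
  items_lt : ∀ p ∈ V.op, ∀ i ∈ p.items, i < V.t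
  items_st : ∀ p ∈ V.op, ∀ i ∈ p.items, V.st i = .fractional
  weight_nonneg : ∀ p ∈ V.op, 0 ≤ p.weight
  start_le : ∀ p ∈ V.op, p.start ≤ V.t
  le_next : ∀ p ∈ V.op, V.t ≤ p.nextSlot
  ld_nonneg : ∀ i, 0 ≤ V.ld i
  ld_le : ∀ i, V.ld i ≤ 1
  ld_future : ∀ i, V.t ≤ i → V.ld i = 0
  ld_zero : ∀ i, V.st i ≠ .fractional → V.ld i < 1 → V.ld i = 0
  suffix : ∀ f ∈ V.frz X, ∀ i ∈ X, i < V.t → i ∉ V.frz X → i < f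
  int_frz : V.Int X → V.frz X = ∅
  int_frac : V.Int X → ¬ V.Frac X
  blk_frz : V.blk → V.frz X = ∅
  blk_sus : V.blk → V.sus
  blkInt_blk : V.blkInt → V.blk
  anti : ∀ i ∈ V.act X, ∀ i' ∈ V.act X, i < i' → V.ld i' ≤ V.ld i
  -- An unsatisfied fractional item was active when an open piece was scheduled, or has been
  -- appended to it since; so each open piece contributes to its load.
  W_le : ∀ i ∈ V.B X, V.st i = .fractional → V.W ≤ V.ld i
  -- 11/100 = 1/10 + 1/100: fewer than K/10 active items are joined by at most K/100 frozen ones.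
  act_le : V.Frac X → ((V.act X).card : ℝ) ≤ 11 / 100 * K
  int_size : V.Int X → K / 100 < (V.act X).card
  -- Needed to restore the next field when a piece ends: all other open pieces then end soon.
  lag : ∀ p ∈ V.op, ∀ q ∈ V.op, (p.nextSlot : ℝ) ≤ q.nextSlot + 11 / 100 * K
  -- The rest of a piece may contain satisfied items, so the size of the active block does not bound
  -- it. If `W` is less than 1, the other items of the rest are unsatisfied.
  past : ∀ p ∈ V.op, (((p.rest V.t).filter (fun i => V.W < V.ld i)).card : ℝ) ≤ 11 / 100 * K
  -- So that Case 3 schedules nothing in the very first slot.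
  first : V.t = k + 1 → V.frz X = ∅ ∨ V.act X = ∅
  sg_nonneg : ∀ b, 0 ≤ V.sg b
  en_nonneg : 0 ≤ V.en

variable {X V}

theorem W_nonneg (h : ∀ p ∈ V.op, 0 ≤ p.weight) : 0 ≤ V.W := by
  apply Multiset.sum_nonneg
  simp only [Multiset.mem_map]
  rintro _ ⟨p, hp, rfl⟩
  exact h p hp

theorem Wr_nonneg (h : ∀ p ∈ V.op, 0 ≤ p.weight) : 0 ≤ V.Wr := by
  apply Multiset.sum_nonneg
  simp only [Multiset.mem_map, Multiset.mem_filter]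
  rintro _ ⟨p, hp, rfl⟩
  exact h p hp.1

theorem sum_filter_le {s : Multiset Piece} (h : ∀ p ∈ s, 0 ≤ p.weight) (P : Piece → Prop)
    [DecidablePred P] :
    ((s.filter P).map Piece.weight).sum ≤ (s.map Piece.weight).sum := by
  conv_rhs => rw [← Multiset.filter_add_not P s]
  rw [Multiset.map_add, Multiset.sum_add]
  have : 0 ≤ ((s.filter (fun p => ¬ P p)).map Piece.weight).sum := by
    apply Multiset.sum_nonneg
    simp only [Multiset.mem_map, Multiset.mem_filter]
    rintro _ ⟨p, hp, rfl⟩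
    exact h p hp.1
  linarith

theorem Wr_le_W (h : ∀ p ∈ V.op, 0 ≤ p.weight) : V.Wr ≤ V.W := sum_filter_le h _

theorem Inv.ld_frz {k : ℕ} {K : ℝ} (h : V.Inv X k K) {i : ℕ} (hi : i ∈ V.frz X) : V.ld i = 0 := by
  rw [mem_frz] at hi
  exact h.ld_zero i (by simp [hi]) hi.2.2.1

theorem frac_of_act (hi : ¬ V.Int X) {i : ℕ} (h : i ∈ V.act X) : V.st i = .fractional := by
  cases hs : V.st i with
  | fractional => rfl
  | integral => exact absurd ⟨i, act_subset_B h, hs⟩ hi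
  | frozen => exact absurd hs (mem_act.1 h).2.2.2

/-! ### Preservation of the structural invariants -/

variable {k : ℕ} {K : ℝ}

theorem Inv.mkInt (h : V.Inv X k K) (hfull : K / 100 < (V.frz X).card) (hact : V.act X = ∅) :
    (V.mkInt X).Inv X k K := by
  have hB : (V.mkInt X).B X = V.B X := rfl
  have hfrz : (V.mkInt X).frz X = ∅ := by
    ext i
    simp only [Finset.notMem_empty, iff_false]
    intro hm
    obtain ⟨h1, h2, h3, h4⟩ := mem_frz.1 hm
    change (if i ∈ V.frz X then ItemState.integral else V.st i) = _ at h4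
    by_cases hi : i ∈ V.frz X
    · simp [hi] at h4
    · rw [if_neg hi] at h4
      exact hi (mem_frz.2 ⟨h1, h2, h3, h4⟩)
  have hall : ∀ i ∈ V.B X, i ∈ V.frz X := by
    intro i hi
    by_contra hn
    have : i ∈ V.act X := by
      rw [mem_B] at hi
      rw [mem_frz] at hn
      rw [mem_act]
      tauto
    simp [hact] at this
  have hact' : (V.mkInt X).act X = V.frz X := by
    ext i
    constructor
    · intro hi
      exact hall i (act_subset_B (V := V.mkInt X) hi)
    · intro hi
      rw [mem_act]
      have := mem_frz.1 hi
      refine ⟨this.1, this.2.1, this.2.2.1, ?_⟩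
      simp [ColorView.mkInt, hi]
  have hstB : ∀ i ∈ V.B X, (V.mkInt X).st i = .integral := fun i hi => by
    simp [ColorView.mkInt, hall i hi]
  exact {
    t_ge := h.t_ge
    items_sub := h.items_sub
    items_lt := h.items_lt
    items_st := by
      intro p hp i hi
      have := h.items_st p hp i hi
      change (if i ∈ V.frz X then ItemState.integral else V.st i) = _
      rw [if_neg, this]
      intro hf
      rw [mem_frz] at hf
      simp [this] at hf
    weight_nonneg := h.weight_nonneg
    start_le := h.start_le
    le_next := h.le_next
    ld_nonneg := h.ld_nonneg
    ld_le := h.ld_le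
    ld_future := h.ld_future
    ld_zero := by
      intro i hs hl
      by_cases hi : i ∈ V.frz X
      · exact h.ld_frz hi
      · refine h.ld_zero i ?_ hl
        change (if i ∈ V.frz X then ItemState.integral else V.st i) ≠ _ at hs
        rwa [if_neg hi] at hs
    suffix := by simp [hfrz]
    int_frz := fun _ => hfrz
    int_frac := by
      rintro - ⟨i, hi, hs⟩
      rw [hstB i hi] at hs
      cases hs
    blk_frz := fun _ => hfrz
    blk_sus := h.blk_sus
    blkInt_blk := h.blkInt_blk
    anti := by
      rw [hact']
      intro i hi i' hi' _
      change V.ld i' ≤ V.ld i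
      rw [h.ld_frz hi, h.ld_frz hi']
    W_le := by
      intro i hi hs
      rw [hstB i hi] at hs
      cases hs
    act_le := by
      rintro ⟨i, hi, hs⟩
      rw [hstB i hi] at hs
      cases hs
    int_size := by
      intro _
      rw [hact']
      exact hfull
    lag := h.lag
    past := h.past
    first := fun _ => Or.inl hfrz
    sg_nonneg := fun _ => le_rfl
    en_nonneg := h.en_nonneg }

/-- Items appended behind all others do not change the earlier ranks. -/
theorem rest_union {p : Piece} {F : Finset ℕ} {t : ℕ} (h : ∀ i ∈ p.items, ∀ f ∈ F, i < f) :
    ({ p with items := p.items ∪ F } : Piece).rest t ⊆ p.rest t ∪ F := by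
  intro i hi
  simp only [Piece.rest, Finset.mem_filter, Finset.mem_union] at hi ⊢
  by_cases hp : i ∈ p.items
  · left
    refine ⟨hp, ?_⟩
    unfold slotOf at hi ⊢
    rw [rank_union_of_le (fun f hf => (h i hp f hf).le)] at hi
    exact hi.2
  · tauto

theorem Inv.lt_frz (h : V.Inv X k K) {p : Piece} (hp : p ∈ V.op) {i f : ℕ} (hi : i ∈ p.items)
    (hf : f ∈ V.frz X) : i < f := by
  refine h.suffix f hf i (h.items_sub p hp hi) (h.items_lt p hp i hi) ?_
  intro hn
  rw [mem_frz, h.items_st p hp i hi] at hn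
  simp at hn

theorem Inv.card_append (h : V.Inv X k K) {p : Piece} (hp : p ∈ V.op) :
    (p.items ∪ V.frz X).card = p.items.card + (V.frz X).card :=
  Finset.card_union_of_disjoint (Finset.disjoint_left.2 fun _ hi hf =>
    lt_irrefl _ (h.lt_frz hp hi hf))

/-- All open pieces grow by the same number of items, so their ends keep their distances; the
appended items have load exactly `W`, so they do not count for `past`. -/
theorem Inv.repl (h : V.Inv X k K) (hint : ¬ V.Int X) (hlt : ((V.act X).card : ℝ) < K / 10)
    (hnf : ((V.frz X).card : ℝ) ≤ K / 100) (hW : V.W ≤ 1) :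
    (V.repl X).Inv X k K := by
  have hst : ∀ i, (V.repl X).st i = if i ∈ V.frz X then .fractional else V.st i := fun _ => rfl
  have hld : ∀ i, (V.repl X).ld i = if i ∈ V.frz X then V.W else V.ld i := by
    intro i
    change (if _ then _ else _) = _
    split_ifs with hi
    · rw [h.ld_frz hi, zero_add]
    · rfl
  have hW0 := W_nonneg h.weight_nonneg
  have hWW : (V.repl X).W = V.W := by
    simp [W, ColorView.repl, Multiset.map_map]
  have hop : ∀ p ∈ (V.repl X).op, ∃ q ∈ V.op, p = { q with items := q.items ∪ V.frz X } := by
    intro p hp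
    obtain ⟨q, hq, rfl⟩ := Multiset.mem_map.1 hp
    exact ⟨q, hq, rfl⟩
  have hle : ∀ i, V.ld i ≤ (V.repl X).ld i := by
    intro i
    rw [hld]
    split_ifs with hi
    · rw [h.ld_frz hi]; exact hW0
    · exact le_rfl
  have hfrz : (V.repl X).frz X = ∅ := by
    ext i
    simp only [mem_frz, Finset.notMem_empty, iff_false]
    rintro ⟨h1, h2, h3, h4⟩
    rw [hst] at h4
    by_cases hi : i ∈ V.frz X
    · simp [hi] at h4
    · rw [if_neg hi] at h4
      rw [hld, if_neg hi] at h3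
      exact hi (mem_frz.2 ⟨h1, h2, h3, h4⟩)
  have hBst : ∀ i ∈ (V.repl X).B X, (V.repl X).st i = .fractional := by
    intro i hi
    rw [hst]
    split_ifs with hf
    · rfl
    · rw [mem_B] at hi
      have hb : i ∈ V.B X := mem_B.2 ⟨hi.1, hi.2.1, (hle i).trans_lt hi.2.2⟩
      refine frac_of_act hint (Finset.mem_filter.2 ⟨hb, fun hs => hf ?_⟩)
      exact Finset.mem_filter.2 ⟨hb, hs⟩
  have hact : (V.repl X).act X ⊆ V.act X ∪ V.frz X := by
    intro i hi
    rw [mem_act] at hi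
    have hb : i ∈ V.B X := mem_B.2 ⟨hi.1, hi.2.1, (hle i).trans_lt hi.2.2.1⟩
    by_cases hf : V.st i = .frozen
    · exact Finset.mem_union_right _ (Finset.mem_filter.2 ⟨hb, hf⟩)
    · exact Finset.mem_union_left _ (Finset.mem_filter.2 ⟨hb, hf⟩)
  have hWle : ∀ i ∈ (V.repl X).act X, V.W ≤ (V.repl X).ld i := by
    intro i hi
    rw [hld]
    split_ifs with hf
    · exact le_rfl
    · rcases Finset.mem_union.1 (hact hi) with ha | ha
      · exact h.W_le i (act_subset_B ha) (frac_of_act hint ha)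
      · exact absurd ha hf
  have hnint : ¬ (V.repl X).Int X := by
    rintro ⟨i, hi, hs⟩
    rw [hBst i hi] at hs
    cases hs
  exact {
    t_ge := h.t_ge
    items_sub := by
      intro p hp
      obtain ⟨q, hq, rfl⟩ := hop p hp
      exact Finset.union_subset (h.items_sub q hq) (fun i hi => (mem_frz.1 hi).1)
    items_lt := by
      intro p hp i hi
      obtain ⟨q, hq, rfl⟩ := hop p hp
      rcases Finset.mem_union.1 hi with hi | hi
      · exact h.items_lt q hq i hi
      · exact (mem_frz.1 hi).2.1
    items_st := by
      intro p hp i hi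
      obtain ⟨q, hq, rfl⟩ := hop p hp
      rw [hst]
      split_ifs with hf
      · rfl
      · rcases Finset.mem_union.1 hi with hi | hi
        · exact h.items_st q hq i hi
        · exact absurd hi hf
    weight_nonneg := by
      intro p hp
      obtain ⟨q, hq, rfl⟩ := hop p hp
      exact h.weight_nonneg q hq
    start_le := by
      intro p hp
      obtain ⟨q, hq, rfl⟩ := hop p hp
      exact h.start_le q hq
    le_next := by
      intro p hp
      obtain ⟨q, hq, rfl⟩ := hop p hp
      refine (h.le_next q hq).trans ?_
      exact Nat.add_le_add_left (Finset.card_le_card Finset.subset_union_left) _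
    ld_nonneg := fun i => (h.ld_nonneg i).trans (hle i)
    ld_le := by
      intro i
      rw [hld]
      split_ifs
      · exact hW
      · exact h.ld_le i
    ld_future := by
      intro i hi
      rw [hld, if_neg]
      · exact h.ld_future i hi
      · intro hf
        exact absurd (mem_frz.1 hf).2.1 (not_lt.2 hi)
    ld_zero := by
      intro i hs hl
      rw [hst] at hs
      rw [hld] at hl ⊢
      split_ifs with hf
      · simp [hf] at hs
      · rw [if_neg hf] at hs hl
        exact h.ld_zero i hs hl
    suffix := by simp [hfrz]
    int_frz := fun _ => hfrz
    int_frac := fun hi => absurd hi hnint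
    blk_frz := fun _ => hfrz
    blk_sus := h.blk_sus
    blkInt_blk := h.blkInt_blk
    anti := by
      intro i hi i' hi' hii
      by_cases hf' : i' ∈ V.frz X
      · rw [hld i', if_pos hf']
        exact hWle i hi
      · have ha' : i' ∈ V.act X := (Finset.mem_union.1 (hact hi')).resolve_right hf'
        have hf : i ∉ V.frz X := by
          intro hf
          have := h.suffix i hf i' (mem_act.1 ha').1 (mem_act.1 ha').2.1 hf'
          omega
        have ha : i ∈ V.act X := (Finset.mem_union.1 (hact hi)).resolve_right hf
        rw [hld, hld, if_neg hf, if_neg hf']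
        exact h.anti i ha i' ha' hii
    W_le := by
      intro i hi hs
      rw [hWW]
      exact hWle i (Finset.mem_filter.2 ⟨hi, by simp [hs]⟩)
    act_le := by
      intro _
      have h1 := (Finset.card_le_card hact).trans (Finset.card_union_le _ _)
      have h2 : (((V.repl X).act X).card : ℝ) ≤ (V.act X).card + (V.frz X).card := by
        exact_mod_cast h1
      linarith
    int_size := fun hi => absurd hi hnint
    lag := by
      intro p hp q hq
      obtain ⟨p', hp', rfl⟩ := hop p hp
      obtain ⟨q', hq', rfl⟩ := hop q hq
      have := h.lag p' hp' q' hq'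
      simp only [Piece.nextSlot] at this ⊢
      rw [h.card_append hp', h.card_append hq']
      push_cast at this ⊢
      linarith
    past := by
      intro p hp
      obtain ⟨q, hq, rfl⟩ := hop p hp
      refine le_trans ?_ (h.past q hq)
      rw [hWW]
      norm_cast
      apply Finset.card_le_card
      intro i hi
      rw [Finset.mem_filter] at hi ⊢
      obtain ⟨hi, hl⟩ := hi
      rw [hld] at hl
      have := rest_union (fun i hi f hf => h.lt_frz hq hi hf) hi
      split_ifs at hl with hf
      · exact absurd hl (lt_irrefl _)
      · exact ⟨(Finset.mem_union.1 this).resolve_right hf, hl⟩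
    first := fun _ => Or.inl hfrz
    sg_nonneg := h.sg_nonneg
    en_nonneg := h.en_nonneg }

theorem W_close_le (h : ∀ p ∈ V.op, 0 ≤ p.weight) : V.close.W ≤ V.W := sum_filter_le h _

theorem Inv.close (h : V.Inv X k K) : V.close.Inv X k K := by
  have hop : ∀ p ∈ V.close.op, p ∈ V.op := fun p hp => (Multiset.mem_filter.1 hp).1
  have hW := W_close_le h.weight_nonneg
  exact {
    t_ge := h.t_ge
    items_sub := fun p hp => h.items_sub p (hop p hp)
    items_lt := fun p hp => h.items_lt p (hop p hp)
    items_st := fun p hp => h.items_st p (hop p hp)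
    weight_nonneg := fun p hp => h.weight_nonneg p (hop p hp)
    start_le := fun p hp => h.start_le p (hop p hp)
    le_next := fun p hp => h.le_next p (hop p hp)
    ld_nonneg := h.ld_nonneg
    ld_le := h.ld_le
    ld_future := h.ld_future
    ld_zero := h.ld_zero
    suffix := h.suffix
    int_frz := h.int_frz
    int_frac := h.int_frac
    blk_frz := h.blk_frz
    blk_sus := h.blk_sus
    blkInt_blk := h.blkInt_blk
    anti := h.anti
    W_le := fun i hi hs => hW.trans (h.W_le i hi hs)
    act_le := h.act_le
    int_size := h.int_size
    lag := fun p hp q hq => h.lag p (hop p hp) q (hop q hq)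
    past := by
      intro p hp
      -- If some piece ends, `W` may drop, but then `lag` bounds the whole rest of every other
      -- piece. If none ends, `W` does not change.
      by_cases hall : ∃ q ∈ V.op, q.nextSlot ≤ V.t
      · obtain ⟨q, hq, hqt⟩ := hall
        have h1 := h.lag p (hop p hp) q hq
        have h2 := p.card_rest (h.start_le p (hop p hp)) (h.le_next p (hop p hp))
        have h3 : (((p.rest V.t).filter (fun i => V.close.W < V.close.ld i)).card : ℝ)
            ≤ (p.rest V.t).card := by
          exact_mod_cast Finset.card_filter_le _ _
        have h4 : (q.nextSlot : ℝ) ≤ V.t := by exact_mod_cast hqt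
        have h5 : (V.t : ℝ) + (p.rest V.t).card = p.nextSlot := by exact_mod_cast h2
        refine h3.trans ?_
        linarith
      · push Not at hall
        have he : V.close.W = V.W := by
          unfold W
          congr 2
          exact Multiset.filter_eq_self.2 hall
        rw [he]
        exact h.past p (hop p hp)
    first := h.first
    sg_nonneg := h.sg_nonneg
    en_nonneg := by
      refine add_nonneg h.en_nonneg (Multiset.sum_nonneg ?_)
      simp only [Multiset.mem_map, Multiset.mem_filter]
      rintro _ ⟨p, hp, rfl⟩
      exact h.weight_nonneg p hp.1 }

theorem Inv.unblock (h : V.Inv X k K) : V.unblock.Inv X k K where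
  t_ge := h.t_ge
  items_sub := h.items_sub
  items_lt := h.items_lt
  items_st := h.items_st
  weight_nonneg := h.weight_nonneg
  start_le := h.start_le
  le_next := h.le_next
  ld_nonneg := h.ld_nonneg
  ld_le := h.ld_le
  ld_future := h.ld_future
  ld_zero := h.ld_zero
  suffix := h.suffix
  int_frz := h.int_frz
  int_frac := h.int_frac
  blk_frz := fun h => h.elim
  blk_sus := fun h => h.elim
  blkInt_blk := fun h => h.elim
  anti := h.anti
  W_le := h.W_le
  act_le := h.act_le
  int_size := h.int_size
  lag := h.lag
  past := h.past
  first := h.first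
  sg_nonneg := h.sg_nonneg
  en_nonneg := h.en_nonneg

end ColorView

end

end RBM

/-! ### One color: structural invariants under advancing, scheduling and evicting -/

namespace RBM

noncomputable section

open scoped Classical

namespace ColorView

variable {X : Finset ℕ} {V : ColorView} {k : ℕ} {K : ℝ}

theorem adv_ld_of_ne {i : ℕ} (h : i ≠ V.t) : (V.adv X).ld i = V.ld i :=
  if_neg (fun hh => h hh.1)

theorem adv_st_of_ne {i : ℕ} (h : i ≠ V.t) : (V.adv X).st i = V.st i :=
  if_neg (fun hh => h hh.1)

/-- The arriving item becomes unsatisfied unless a block of its color absorbs it; its load was 0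
before. -/
theorem Inv.mem_B_adv (h : V.Inv X k K) {i : ℕ} :
    i ∈ (V.adv X).B X ↔ i ∈ V.B X ∨ (i = V.t ∧ i ∈ X ∧ ¬ V.blk) := by
  rw [mem_B, mem_B]
  change i ∈ X ∧ i < V.t + 1 ∧ _ ↔ _
  by_cases hi : i = V.t
  · have h0 := h.ld_future i hi.ge
    have : (V.adv X).ld i = if i = V.t ∧ i ∈ X ∧ V.blk then V.ld i + 1 else V.ld i := rfl
    rw [this, h0]
    by_cases hb : V.blk <;> by_cases hX : i ∈ X <;> simp [hi, hb] <;> subst hi <;> simp [hX]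
  · rw [adv_ld_of_ne hi]
    constructor
    · rintro ⟨h1, h2, h3⟩
      exact Or.inl ⟨h1, by omega, h3⟩
    · rintro (⟨h1, h2, h3⟩ | h2)
      · exact ⟨h1, by omega, h3⟩
      · exact absurd h2.1 hi

theorem Inv.int_adv (h : V.Inv X k K) : (V.adv X).Int X ↔ V.Int X := by
  constructor
  · rintro ⟨i, hi, hs⟩
    rcases h.mem_B_adv.1 hi with hb | ⟨rfl, hX, hb⟩
    · rw [adv_st_of_ne (mem_B.1 hb).2.1.ne] at hs
      exact ⟨i, hb, hs⟩
    · change (if _ then (if _ then _ else _) else _) = _ at hs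
      rw [if_pos ⟨rfl, hX⟩] at hs
      split_ifs at hs with hh
      exact hh.resolve_right (fun hbi => hb (h.blkInt_blk hbi))
  · rintro ⟨i, hi, hs⟩
    refine ⟨i, h.mem_B_adv.2 (Or.inl hi), ?_⟩
    rwa [adv_st_of_ne (mem_B.1 hi).2.1.ne]

theorem Inv.frz_adv (h : V.Inv X k K) {i : ℕ} : i ∈ (V.adv X).frz X ↔
    i ∈ V.frz X ∨ (i = V.t ∧ i ∈ X ∧ ¬ V.blk ∧ ¬ V.Int X) := by
  unfold frz
  rw [Finset.mem_filter, Finset.mem_filter, h.mem_B_adv]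
  by_cases hi : i = V.t
  · subst hi
    have h1 : V.t ∉ V.B X := fun hb => lt_irrefl _ (mem_B.1 hb).2.1
    simp only [h1, false_or, true_and, false_and]
    constructor
    · rintro ⟨⟨hX, hb⟩, hs⟩
      refine ⟨hX, hb, ?_⟩
      change (if _ then (if _ then _ else _) else _) = _ at hs
      rw [if_pos ⟨rfl, hX⟩] at hs
      split_ifs at hs with hh
      tauto
    · rintro ⟨hX, hb, hint⟩
      refine ⟨⟨hX, hb⟩, ?_⟩
      change (if _ then (if _ then _ else _) else _) = _
      rw [if_pos ⟨rfl, hX⟩, if_neg]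
      have := h.blkInt_blk
      tauto
  · rw [adv_st_of_ne hi]
    simp [hi]

theorem Inv.act_adv (h : V.Inv X k K) {i : ℕ} : i ∈ (V.adv X).act X ↔
    i ∈ V.act X ∨ (i = V.t ∧ i ∈ X ∧ ¬ V.blk ∧ V.Int X) := by
  have h1 : i ∈ (V.adv X).act X ↔ i ∈ (V.adv X).B X ∧ i ∉ (V.adv X).frz X := by
    unfold act frz
    simp only [Finset.mem_filter]
    tauto
  have h2 : i ∈ V.act X ↔ i ∈ V.B X ∧ i ∉ V.frz X := by
    unfold act frz
    simp only [Finset.mem_filter]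
    tauto
  have h3 : i = V.t → i ∉ V.B X ∧ i ∉ V.frz X := by
    rintro rfl
    exact ⟨fun hb => lt_irrefl _ (mem_B.1 hb).2.1, fun hb => lt_irrefl _ (mem_frz.1 hb).2.1⟩
  rw [h1, h.mem_B_adv, h.frz_adv, h2]
  tauto

theorem Inv.frac_adv (h : V.Inv X k K) : (V.adv X).Frac X → V.Frac X := by
  rintro ⟨i, hi, hs⟩
  rcases h.mem_B_adv.1 hi with hb | ⟨rfl, hX, hb⟩
  · rw [adv_st_of_ne (mem_B.1 hb).2.1.ne] at hs
    exact ⟨i, hb, hs⟩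
  · change (if _ then (if _ then _ else _) else _) = _ at hs
    rw [if_pos ⟨rfl, hX⟩] at hs
    split_ifs at hs

theorem W_adv : (V.adv X).W = V.W := by
  unfold W ColorView.adv
  dsimp only
  split_ifs
  · simp [Multiset.map_map]
  · rfl

theorem Wr_adv : (V.adv X).Wr = V.Wr := by
  unfold Wr ColorView.adv
  dsimp only
  split_ifs
  · rw [Multiset.filter_map, Multiset.map_map]
    rfl
  · rfl

theorem mem_op_adv {p : Piece} (hp : p ∈ (V.adv X).op) :
    (¬ V.sus ∧ p ∈ V.op) ∨ (V.sus ∧ ∃ q ∈ V.op, p = { q with start := V.t + 1 }) := by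
  change p ∈ (if V.sus then _ else _) at hp
  split_ifs at hp with hs
  · obtain ⟨q, hq, rfl⟩ := Multiset.mem_map.1 hp
    exact Or.inr ⟨hs, q, hq, rfl⟩
  · exact Or.inl ⟨hs, hp⟩

theorem rest_start {p : Piece} {t : ℕ} : ({ p with start := t } : Piece).rest t = p.items := by
  unfold Piece.rest
  refine Finset.filter_true_of_mem ?_
  intro i _
  unfold slotOf
  dsimp only
  omega

/-- Outside suspension the rests shrink and the ends stay; under suspension the rests stay and all
ends shift by one. Both respect `lag` and `past`. -/
theorem Inv.adv (h : V.Inv X k K) (hend : ¬ V.sus → ∀ p ∈ V.op, V.t < p.nextSlot)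
    (hstart : V.sus → ∀ p ∈ V.op, p.start = V.t) :
    (V.adv X).Inv X k K := by
  have hq : ∀ p ∈ (V.adv X).op, ∃ q ∈ V.op, p.items = q.items ∧ p.weight = q.weight ∧
      p.rest (V.t + 1) ⊆ q.rest V.t ∧ p.start ≤ V.t + 1 ∧ V.t + 1 ≤ p.nextSlot ∧
      p.nextSlot = q.nextSlot + (if V.sus then 1 else 0) := by
    intro p hp
    rcases mem_op_adv hp with ⟨hs, hp⟩ | ⟨hs, q, hq, rfl⟩
    · refine ⟨p, hp, rfl, rfl, ?_, (h.start_le p hp).trans (Nat.le_succ _), hend hs p hp, ?_⟩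
      · exact Finset.monotone_filter_right _ (fun i _ hi => (Nat.le_succ _).trans hi)
      · rw [if_neg hs]; rfl
    · have hst := hstart hs q hq
      refine ⟨q, hq, rfl, rfl, ?_, le_rfl, Nat.le_add_right _ _, ?_⟩
      · rw [rest_start]
        have : q.rest V.t = q.items := by
          have := rest_start (p := q) (t := V.t)
          rwa [← hst] at this ⊢
        rw [this]
      · rw [if_pos hs]
        unfold Piece.nextSlot
        rw [hst]
        dsimp only
        omega
  have hldi : ∀ i < V.t, (V.adv X).ld i = V.ld i := fun i hi => adv_ld_of_ne hi.ne
  exact {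
    t_ge := h.t_ge.trans (Nat.le_succ _)
    items_sub := by
      intro p hp
      obtain ⟨q, hq, h1, -⟩ := hq p hp
      rw [h1]
      exact h.items_sub q hq
    items_lt := by
      intro p hp
      obtain ⟨q, hq, h1, -⟩ := hq p hp
      rw [h1]
      exact fun i hi => (h.items_lt q hq i hi).trans (Nat.lt_succ_self _)
    items_st := by
      intro p hp
      obtain ⟨q, hq, h1, -⟩ := hq p hp
      rw [h1]
      intro i hi
      rw [adv_st_of_ne (h.items_lt q hq i hi).ne]
      exact h.items_st q hq i hi
    weight_nonneg := by
      intro p hp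
      obtain ⟨q, hq, -, h1, -⟩ := hq p hp
      rw [h1]
      exact h.weight_nonneg q hq
    start_le := by
      intro p hp
      obtain ⟨q, hq, -, -, -, h1, -⟩ := hq p hp
      exact h1
    le_next := by
      intro p hp
      obtain ⟨q, hq, -, -, -, -, h1, -⟩ := hq p hp
      exact h1
    ld_nonneg := by
      intro i
      change 0 ≤ (if i = V.t ∧ i ∈ X ∧ V.blk then V.ld i + 1 else V.ld i)
      have := h.ld_nonneg i
      split_ifs <;> linarith
    ld_le := by
      intro i
      change (if _ then _ else _) ≤ _
      split_ifs with hi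
      · rw [h.ld_future i hi.1.ge]; norm_num
      · exact h.ld_le i
    ld_future := by
      intro i hi
      have hi' : V.t + 1 ≤ i := hi
      rw [adv_ld_of_ne (by omega)]
      exact h.ld_future i (by omega)
    ld_zero := by
      intro i hs hl
      by_cases hi : i = V.t
      · have h0 := h.ld_future i hi.ge
        change (if _ then _ else _) < _ at hl
        change (if _ then _ else _) = _
        rw [h0] at hl ⊢
        split_ifs at hl ⊢
        · norm_num at hl
        · rfl
      · rw [adv_st_of_ne hi] at hs
        rw [adv_ld_of_ne hi] at hl ⊢
        exact h.ld_zero i hs hl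
    suffix := by
      intro f hf i hX hi hn
      have hi' : i < V.t + 1 := hi
      rw [h.frz_adv] at hf hn
      push Not at hn
      rcases hf with hf | ⟨rfl, hfX, hb, hint⟩
      · by_cases hit : i = V.t
        -- If the arriving item is not frozen, the color is being evicted or is integral, and then
        -- it has no frozen items at all.
        · exfalso
          have h1 := hn.2 hit hX
          have h2 : V.frz X = ∅ := by
            by_cases hb : V.blk
            · exact h.blk_frz hb
            · exact h.int_frz (h1 hb)
          simp [h2] at hf
        · exact h.suffix f hf i hX (by omega) hn.1
      · by_cases hit : i = V.t
        · exact absurd (hn.2 hit hX hb) hint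
        · omega
    int_frz := by
      intro hi
      rw [h.int_adv] at hi
      ext i
      rw [h.frz_adv, h.int_frz hi]
      simp [hi]
    int_frac := fun hi hf => h.int_frac (h.int_adv.1 hi) (h.frac_adv hf)
    blk_frz := by
      intro hb
      have hb : V.blk := hb
      ext i
      rw [h.frz_adv, h.blk_frz hb]
      simp [hb]
    blk_sus := h.blk_sus
    blkInt_blk := h.blkInt_blk
    anti := by
      intro i hi i' hi' hii
      have hb := (mem_act.1 hi').2.1
      have hb : i' < V.t + 1 := hb
      rw [hldi i (by omega)]
      rcases h.act_adv.1 hi' with ha' | ⟨rfl, hX, hbl, hint⟩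
      · rw [hldi i' (mem_act.1 ha').2.1]
        rcases h.act_adv.1 hi with ha | ⟨rfl, -⟩
        · exact h.anti i ha i' ha' hii
        · have := (mem_act.1 ha').2.1
          omega
      · have h0 : (V.adv X).ld V.t = V.ld V.t := if_neg (fun hh => hbl hh.2.2)
        rw [h0, h.ld_future _ le_rfl]
        exact h.ld_nonneg i
    W_le := by
      intro i hi hs
      rw [W_adv]
      rcases h.mem_B_adv.1 hi with hb | ⟨rfl, hX, hb⟩
      · rw [adv_st_of_ne (mem_B.1 hb).2.1.ne] at hs
        rw [hldi i (mem_B.1 hb).2.1]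
        exact h.W_le i hb hs
      · change (if _ then (if _ then _ else _) else _) = _ at hs
        rw [if_pos ⟨rfl, hX⟩] at hs
        split_ifs at hs
    act_le := by
      intro hf
      have hf := h.frac_adv hf
      refine le_trans ?_ (h.act_le hf)
      norm_cast
      refine Finset.card_le_card ?_
      intro i hi
      rcases h.act_adv.1 hi with ha | ⟨-, -, -, hint⟩
      · exact ha
      · exact absurd hf (h.int_frac hint)
    int_size := by
      intro hi
      refine (h.int_size (h.int_adv.1 hi)).trans_le ?_
      norm_cast
      refine Finset.card_le_card ?_
      intro i hi
      exact h.act_adv.2 (Or.inl hi)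
    lag := by
      intro p hp p' hp'
      obtain ⟨q, hq', -, -, -, -, -, h1⟩ := hq p hp
      obtain ⟨q', hq'', -, -, -, -, -, h2⟩ := hq p' hp'
      have := h.lag q hq' q' hq''
      rw [h1, h2]
      push_cast
      linarith
    past := by
      intro p hp
      obtain ⟨q, hq, -, -, h1, -⟩ := hq p hp
      refine le_trans ?_ (h.past q hq)
      norm_cast
      refine Finset.card_le_card ?_
      intro i hi
      rw [Finset.mem_filter] at hi ⊢
      have hr := h1 hi.1
      have hlt := h.items_lt q hq i (Piece.rest_subset _ _ hr)
      rw [W_adv, hldi i hlt] at hi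
      exact ⟨hr, hi.2⟩
    first := by
      intro ht
      have : V.t + 1 = k + 1 := ht
      have := h.t_ge
      omega
    sg_nonneg := h.sg_nonneg
    en_nonneg := h.en_nonneg }

theorem W_addPiece (p : Piece) : (V.addPiece p).W = V.W + p.weight := by
  simp [W, addPiece]

theorem frac_of_nonempty (hint : ¬ V.Int X) (hne : (V.act X).Nonempty) :
    V.Frac X := by
  obtain ⟨i, hi⟩ := hne
  exact ⟨i, act_subset_B hi, frac_of_act hint hi⟩

/-- The rest of a piece splits into items of load above `W`, bounded by `past`, and items of load at
most `W`, which are unsatisfied since `W` is less than 1 and hence active. -/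
theorem Inv.rest_le (h : V.Inv X k K) (hW : V.W < 1) {p : Piece}
    (hp : p ∈ V.op) : (p.nextSlot : ℝ) ≤ V.t + 11 / 100 * K + (V.act X).card := by
  have h1 := p.card_rest (h.start_le p hp) (h.le_next p hp)
  have h2 := Finset.card_filter_add_card_filter_not (s := p.rest V.t) (fun i => V.W < V.ld i)
  have h3 := h.past p hp
  have h4 : ((p.rest V.t).filter (fun i => ¬ V.W < V.ld i)).card ≤ (V.act X).card := by
    refine Finset.card_le_card ?_
    intro i hi
    rw [Finset.mem_filter] at hi
    have hI := Piece.rest_subset _ _ hi.1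
    rw [mem_act]
    refine ⟨h.items_sub p hp hI, h.items_lt p hp i hI, by linarith [hi.2], ?_⟩
    rw [h.items_st p hp i hI]
    simp
  have h5 : (p.nextSlot : ℝ) = V.t + (p.rest V.t).card := by exact_mod_cast h1.symm
  have h6 : ((p.rest V.t).card : ℝ) = ((p.rest V.t).filter (fun i => V.W < V.ld i)).card +
    ((p.rest V.t).filter (fun i => ¬ V.W < V.ld i)).card := by exact_mod_cast h2.symm
  have h7 : (((p.rest V.t).filter (fun i => ¬ V.W < V.ld i)).card : ℝ) ≤ (V.act X).card := by
    exact_mod_cast h4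
  linarith

section addPiece

variable {p : Piece}

theorem addPiece_ld (hp : p.items = V.act X) (i : ℕ) : (V.addPiece p).ld i =
    if i ∈ V.act X then V.ld i + p.weight else V.ld i := by
  simp [addPiece, hp]

theorem le_addPiece_ld (h0 : 0 ≤ p.weight) (i : ℕ) : V.ld i ≤ (V.addPiece p).ld i := by
  change _ ≤ if _ then _ else _
  split_ifs <;> linarith

theorem B_addPiece (h0 : 0 ≤ p.weight) : (V.addPiece p).B X ⊆ V.B X := by
  intro i hi
  rw [mem_B] at hi ⊢
  exact ⟨hi.1, hi.2.1, (le_addPiece_ld h0 i).trans_lt hi.2.2⟩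

theorem act_addPiece (h0 : 0 ≤ p.weight) : (V.addPiece p).act X ⊆ V.act X :=
  Finset.filter_subset_filter _ (B_addPiece h0)

theorem frz_addPiece (hp : p.items = V.act X) : (V.addPiece p).frz X = V.frz X := by
  ext i
  rw [mem_frz, mem_frz, addPiece_ld hp]
  split_ifs with ha
  · rw [mem_act] at ha
    change _ ∧ _ ∧ _ ∧ V.st i = _ ↔ _
    tauto
  · rfl

theorem int_addPiece (h0 : 0 ≤ p.weight) (hint : ¬ V.Int X) : ¬ (V.addPiece p).Int X := by
  rintro ⟨i, hi, hs⟩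
  exact hint ⟨i, B_addPiece h0 hi, hs⟩

theorem Inv.addPiece (h : V.Inv X k K) (hp : p.items = V.act X) (hps : p.start = V.t)
    (h0 : 0 ≤ p.weight) (hint : ¬ V.Int X) (hne : (V.act X).Nonempty) (hW : V.W < 1)
    (hl : ∀ i ∈ V.act X, V.ld i + p.weight ≤ 1) : (V.addPiece p).Inv X k K := by
  have hld := addPiece_ld hp
  have hfr := frac_of_nonempty hint hne
  have hactle := h.act_le hfr
  have hfrz := frz_addPiece hp
  have hact := act_addPiece (X := X) (V := V) h0
  have hop : ∀ q ∈ (V.addPiece p).op, q ∈ V.op ∨ q = p := by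
    intro q hq
    rcases Multiset.mem_add.1 hq with hq | hq
    · exact Or.inl hq
    · exact Or.inr (Multiset.mem_singleton.1 hq)
  have hstp : ∀ i ∈ V.act X, V.st i = .fractional := fun i hi => frac_of_act hint hi
  have hnext : p.nextSlot = V.t + (V.act X).card := by
    unfold Piece.nextSlot
    rw [hps, hp]
  have hnextR : (p.nextSlot : ℝ) = V.t + (V.act X).card := by exact_mod_cast hnext
  exact {
    t_ge := h.t_ge
    items_sub := by
      intro q hq
      rcases hop q hq with hq | rfl
      · exact h.items_sub q hq
      · rw [hp]
        exact fun i hi => (mem_act.1 hi).1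
    items_lt := by
      intro q hq
      rcases hop q hq with hq | rfl
      · exact h.items_lt q hq
      · rw [hp]
        exact fun i hi => (mem_act.1 hi).2.1
    items_st := by
      intro q hq
      rcases hop q hq with hq | rfl
      · exact h.items_st q hq
      · rw [hp]
        exact hstp
    weight_nonneg := by
      intro q hq
      rcases hop q hq with hq | rfl
      · exact h.weight_nonneg q hq
      · exact h0
    start_le := by
      intro q hq
      rcases hop q hq with hq | rfl
      · exact h.start_le q hq
      · exact hps.le
    le_next := by
      intro q hq
      rcases hop q hq with hq | rfl
      · exact h.le_next q hq
      · rw [hnext]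
        exact Nat.le_add_right _ _
    ld_nonneg := fun i => (h.ld_nonneg i).trans (le_addPiece_ld h0 i)
    ld_le := by
      intro i
      rw [hld]
      split_ifs with hi
      · exact hl i hi
      · exact h.ld_le i
    ld_future := by
      intro i hi
      rw [hld, if_neg]
      · exact h.ld_future i hi
      · intro ha
        exact absurd (mem_act.1 ha).2.1 (not_lt.2 hi)
    ld_zero := by
      intro i hs hl
      rw [hld] at hl ⊢
      split_ifs at hl ⊢ with ha
      · exact absurd (hstp i ha) hs
      · exact h.ld_zero i hs hl
    suffix := by
      rw [hfrz]
      exact h.suffix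
    int_frz := fun hi => absurd hi (int_addPiece h0 hint)
    int_frac := fun hi => absurd hi (int_addPiece h0 hint)
    blk_frz := by
      rw [hfrz]
      exact h.blk_frz
    blk_sus := h.blk_sus
    blkInt_blk := h.blkInt_blk
    anti := by
      intro i hi i' hi' hii
      rw [hld, hld, if_pos (hact hi), if_pos (hact hi')]
      linarith [h.anti i (hact hi) i' (hact hi') hii]
    W_le := by
      intro i hi hs
      have ha : i ∈ V.act X := hact (Finset.mem_filter.2 ⟨hi, by simp [hs]⟩)
      rw [W_addPiece, hld, if_pos ha]
      linarith [h.W_le i (act_subset_B ha) hs]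
    act_le := by
      intro _
      refine le_trans ?_ hactle
      exact_mod_cast Finset.card_le_card hact
    int_size := fun hi => absurd hi (int_addPiece h0 hint)
    -- The new piece ends at t + |act|; the older ones end between t and t + |act| + 11/100 K.
    lag := by
      intro q hq q' hq'
      have hK : 0 ≤ 11 / 100 * K := (Nat.cast_nonneg _).trans hactle
      rcases hop q hq with hq1 | rfl <;> rcases hop q' hq' with hq2 | rfl
      · exact h.lag q hq1 q' hq2
      · rw [hnextR]
        linarith [h.rest_le hW hq1]
      · rw [hnextR]
        have : (V.t : ℝ) ≤ q'.nextSlot := by exact_mod_cast h.le_next q' hq2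
        linarith
      · linarith
    -- `W` and the loads of the active items grow by the same amount, and no other load grows; so no
    -- item newly exceeds `W`.
    past := by
      intro q hq
      rw [W_addPiece]
      rcases hop q hq with hq | rfl
      · refine le_trans ?_ (h.past q hq)
        norm_cast
        refine Finset.card_le_card (Finset.monotone_filter_right _ ?_)
        intro i _ hi
        simp only [hld] at hi
        split_ifs at hi
        · linarith
        · linarith
      · refine le_trans ?_ hactle
        norm_cast
        refine Finset.card_le_card ?_
        intro i hi
        rw [← hp]
        exact Piece.rest_subset _ _ (Finset.mem_filter.1 hi).1
    first := by
      intro ht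
      rw [hfrz]
      rcases h.first ht with h1 | h1
      · exact Or.inl h1
      · simp [h1] at hne
    sg_nonneg := h.sg_nonneg
    en_nonneg := h.en_nonneg }

end addPiece

theorem W_cut : V.cut.W = V.W := by simp [W, ColorView.cut, Multiset.map_map]

theorem Wr_cut : V.cut.Wr = V.Wr := by
  unfold Wr ColorView.cut
  rw [Multiset.filter_map, Multiset.map_map]
  rfl

/-- The rest of a piece, restarted at the current slot, ends where the whole piece would have ended.
-/
theorem Inv.cut (h : V.Inv X k K) : V.cut.Inv X k K := by
  have hq : ∀ p ∈ V.cut.op, ∃ q ∈ V.op, p = { q with items := q.rest V.t, start := V.t } := by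
    intro p hp
    obtain ⟨q, hq, rfl⟩ := Multiset.mem_map.1 hp
    exact ⟨q, hq, rfl⟩
  have hnext : ∀ q ∈ V.op,
      ({ q with items := q.rest V.t, start := V.t } : Piece).nextSlot = q.nextSlot := by
    intro q hq
    exact q.card_rest (h.start_le q hq) (h.le_next q hq)
  exact {
    t_ge := h.t_ge
    items_sub := by
      intro p hp
      obtain ⟨q, hq, rfl⟩ := hq p hp
      exact (q.rest_subset _).trans (h.items_sub q hq)
    items_lt := by
      intro p hp i hi
      obtain ⟨q, hq, rfl⟩ := hq p hp
      exact h.items_lt q hq i (q.rest_subset _ hi)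
    items_st := by
      intro p hp i hi
      obtain ⟨q, hq, rfl⟩ := hq p hp
      exact h.items_st q hq i (q.rest_subset _ hi)
    weight_nonneg := by
      intro p hp
      obtain ⟨q, hq, rfl⟩ := hq p hp
      exact h.weight_nonneg q hq
    start_le := by
      intro p hp
      obtain ⟨q, hq, rfl⟩ := hq p hp
      exact le_rfl
    le_next := by
      intro p hp
      obtain ⟨q, hq, rfl⟩ := hq p hp
      exact Nat.le_add_right _ _
    ld_nonneg := h.ld_nonneg
    ld_le := h.ld_le
    ld_future := h.ld_future
    ld_zero := h.ld_zero
    suffix := h.suffix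
    int_frz := h.int_frz
    int_frac := h.int_frac
    blk_frz := h.blk_frz
    blk_sus := fun _ => trivial
    blkInt_blk := h.blkInt_blk
    anti := h.anti
    W_le := by
      rw [W_cut]
      exact h.W_le
    act_le := h.act_le
    int_size := h.int_size
    lag := by
      intro p hp p' hp'
      obtain ⟨q, hq', rfl⟩ := hq p hp
      obtain ⟨q', hq'', rfl⟩ := hq p' hp'
      rw [hnext q hq', hnext q' hq'']
      exact h.lag q hq' q' hq''
    past := by
      intro p hp
      obtain ⟨q, hq, rfl⟩ := hq p hp
      rw [W_cut]
      refine le_trans ?_ (h.past q hq)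
      norm_cast
      exact Finset.card_le_card (Finset.filter_subset_filter _ (Piece.rest_subset _ _))
    first := h.first
    sg_nonneg := h.sg_nonneg
    en_nonneg := h.en_nonneg }

theorem mem_B_sat (h : V.Inv X k K) {A : Finset ℕ} {b : Prop} {i : ℕ} :
    i ∈ (V.sat A b).B X ↔ i ∈ V.B X ∧ i ∉ A := by
  rw [mem_B, mem_B]
  change _ ∧ _ ∧ (if _ then _ else _) < _ ↔ _
  split_ifs with hi
  · have := h.ld_nonneg i
    simp only [hi, not_true, and_false, iff_false]
    rintro ⟨-, -, h3⟩
    linarith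
  · change _ ∧ i < V.t ∧ _ ↔ _
    tauto

/-- The items of `A` are not fractional, so they had load 0, belong to no open piece, and now have
load exactly 1. -/
theorem Inv.sat (h : V.Inv X k K) {A : Finset ℕ} {b : Prop} (hA : A ⊆ V.B X)
    (hst : ∀ i ∈ A, V.st i ≠ .fractional) (hf : V.frz X ⊆ A) (hint : V.Int X → V.act X ⊆ A)
    (hsus : V.sus) : (V.sat A b).Inv X k K := by
  have hB := fun i => mem_B_sat (b := b) h (A := A) (i := i)
  have hfrz : (V.sat A b).frz X = ∅ := by
    ext i
    simp only [Finset.notMem_empty, iff_false]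
    intro hi
    have h1 := Finset.mem_filter.1 hi
    have h2 := (hB i).1 h1.1
    exact h2.2 (hf (Finset.mem_filter.2 ⟨h2.1, h1.2⟩))
  have hnint : ¬ (V.sat A b).Int X := by
    rintro ⟨i, hi, hs⟩
    have h2 := (hB i).1 hi
    have hs : V.st i = .integral := hs
    exact h2.2 (hint ⟨i, h2.1, hs⟩ (Finset.mem_filter.2 ⟨h2.1, by simp [hs]⟩))
  have hact : (V.sat A b).act X ⊆ V.act X := by
    intro i hi
    have h1 := Finset.mem_filter.1 hi
    exact Finset.mem_filter.2 ⟨((hB i).1 h1.1).1, h1.2⟩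
  have hld : ∀ i ∉ A, (V.sat A b).ld i = V.ld i := fun i hi => if_neg hi
  have hldA : ∀ i ∈ A, (V.sat A b).ld i = 1 := by
    intro i hi
    have : (V.sat A b).ld i = V.ld i + 1 := if_pos hi
    rw [this, h.ld_zero i (hst i hi) (mem_B.1 (hA hi)).2.2, zero_add]
  exact {
    t_ge := h.t_ge
    items_sub := h.items_sub
    items_lt := h.items_lt
    items_st := h.items_st
    weight_nonneg := h.weight_nonneg
    start_le := h.start_le
    le_next := h.le_next
    ld_nonneg := by
      intro i
      by_cases hi : i ∈ A
      · rw [hldA i hi]; exact zero_le_one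
      · rw [hld i hi]; exact h.ld_nonneg i
    ld_le := by
      intro i
      by_cases hi : i ∈ A
      · rw [hldA i hi]
      · rw [hld i hi]; exact h.ld_le i
    ld_future := by
      intro i hi
      have : i ∉ A := fun ha => absurd (mem_B.1 (hA ha)).2.1 (not_lt.2 hi)
      rw [hld i this]
      exact h.ld_future i hi
    ld_zero := by
      intro i hs hl
      by_cases hi : i ∈ A
      · rw [hldA i hi] at hl
        exact absurd hl (lt_irrefl _)
      · rw [hld i hi] at hl ⊢
        exact h.ld_zero i hs hl
    suffix := by simp [hfrz]
    int_frz := fun _ => hfrz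
    int_frac := fun hi => absurd hi hnint
    blk_frz := fun _ => hfrz
    blk_sus := fun _ => hsus
    blkInt_blk := fun _ => trivial
    anti := by
      intro i hi i' hi' hii
      rw [hld i ((hB i).1 (act_subset_B hi)).2, hld i' ((hB i').1 (act_subset_B hi')).2]
      exact h.anti i (hact hi) i' (hact hi') hii
    W_le := by
      intro i hi hs
      rw [hld i ((hB i).1 hi).2]
      exact h.W_le i ((hB i).1 hi).1 hs
    act_le := by
      rintro ⟨i, hi, hs⟩
      refine le_trans ?_ (h.act_le ⟨i, ((hB i).1 hi).1, hs⟩)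
      exact_mod_cast Finset.card_le_card hact
    int_size := fun hi => absurd hi hnint
    lag := h.lag
    past := by
      intro p hp
      refine le_trans ?_ (h.past p hp)
      norm_cast
      refine Finset.card_le_card ?_
      intro i hi
      rw [Finset.mem_filter] at hi ⊢
      have hA' : i ∉ A := fun ha => hst i ha (h.items_st p hp i (Piece.rest_subset _ _ hi.1))
      rw [hld i hA'] at hi
      exact hi
    first := fun _ => Or.inl hfrz
    sg_nonneg := h.sg_nonneg
    en_nonneg := h.en_nonneg }

/-- The structural invariants do not depend on the pseudo-dual costs and the ended weights. -/
theorem Inv.withCosts (h : V.Inv X k K) {sg : Batch → ℝ} {en : ℝ} (hs : ∀ b, 0 ≤ sg b)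
    (he : 0 ≤ en) : ({ V with sg := sg, en := en } : ColorView).Inv X k K where
  t_ge := h.t_ge
  items_sub := h.items_sub
  items_lt := h.items_lt
  items_st := h.items_st
  weight_nonneg := h.weight_nonneg
  start_le := h.start_le
  le_next := h.le_next
  ld_nonneg := h.ld_nonneg
  ld_le := h.ld_le
  ld_future := h.ld_future
  ld_zero := h.ld_zero
  suffix := h.suffix
  int_frz := h.int_frz
  int_frac := h.int_frac
  blk_frz := h.blk_frz
  blk_sus := h.blk_sus
  blkInt_blk := h.blkInt_blk
  anti := h.anti
  W_le := h.W_le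
  act_le := h.act_le
  int_size := h.int_size
  lag := h.lag
  past := h.past
  first := h.first
  sg_nonneg := hs
  en_nonneg := he

end ColorView

end

end RBM

/-! ### One color: the phases and the accounting invariants -/

namespace RBM

noncomputable section

open scoped Classical

namespace ColorView

/-- `clean`: the loads of the active items dominate the pseudo-primal variables; `dirty`: nothing is
known about the pseudo-primal variables before the next reset; `live`: they are dominated by the
loads plus a weight that is part of the loads of a large set of items; `counted`: most of this set
has been satisfied. -/
inductive Phase where
  | clean
  | dirty
  | live
  | counted

/-- The history of a color: `F` is the reference set of the phases `live` and `counted`, `ξ` the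
weight that its items share, `m` the number of reference sets used up, `R` the weight scheduled by
regular execution, `Cr` the credit from the dual cost. -/
structure Ghost where
  phase : Phase
  F : Finset ℕ
  ξ : ℝ
  m : ℝ
  R : ℝ
  Cr : ℝ

/-- The value held by an item of load x. Its growth is at most proportional to the load, as the
credit is; it vanishes up to 1/4, so that frozen items appended with a small load need no financing.
-/
def phi (x : ℝ) : ℝ := max 0 (x ^ 2 - 1 / 16)

/-- A reserve depending on the open weight. It is 0 up to 1/10, where values may be cashed, and
reaches 1/4 at w = 1/4, which exceeds anything the loads can hold after an appending. -/
def beta (w : ℝ) : ℝ := max 0 (5 / 3 * (w - 1 / 10))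

variable (k : ℕ) (K : ℝ) (X : Finset ℕ) (Bt : Set Batch) (V : ColorView)

/-- The value held by the loads of the items of `A`. -/
def hold (A : Finset ℕ) : ℝ := (∑ i ∈ A, phi (V.ld i)) / K

/-- Frozen items are not counted, because they may still be appended to `p`. If `p` ends and no item
is frozen, then fewer than `p.nextSlot - b.2` items of the batch have arrived, so the next one to
come would be matched before its arrival. -/
def Catches (b : Batch) (p : Piece) : Prop :=
  b.2 + (b.1.filter (fun i => i < V.t ∧ i ∉ p.items ∧ i ∉ V.frz X)).card < p.start

/-- The weight of the open pieces that cannot end before the whole batch has arrived, unless there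
are frozen items. -/
def eff (b : Batch) : ℝ := ((V.op.filter (fun p => V.Catches X b p)).map Piece.weight).sum

/-- Only in the phase `live` do satisfied items keep their value, to be cashed later. -/
def Ghost.held (g : Ghost) : Finset ℕ :=
  match g.phase with
  | .live => g.F
  | _ => ∅

/-- The allowance for weight that is not covered by credit. -/
def Ghost.allowance (g : Ghost) : ℝ :=
  match g.phase with
  | .clean => 0
  | .live => 0
  | .dirty => max 0 (1 / 5 - (V.en + V.Wr))
  | .counted => max 0 (1 - g.ξ) + 1 / 5

/-- Nothing is claimed about x̂ while the color is integral or its frozen block is full: in both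
cases a reset comes before its next scheduling by regular execution. In the phase `clean`, items
that are not active yet are compared with the weight of the pieces they can still be appended to. -/
def PhaseInv (g : Ghost) : Prop :=
  match g.phase with
  | .clean => g.F = ∅ ∧ (¬ V.Int X → ¬ K / 100 < (V.frz X).card → ∀ b ∈ Bt,
      (∀ i ∈ b.1, i ∈ V.act X → xhat k (V.sg b) ≤ V.ld i) ∧
      (∀ i ∈ b.1, i ∈ V.frz X ∨ V.t ≤ i → xhat k (V.sg b) ≤ V.eff X b))
  | .dirty => g.F = ∅
  | .live => K / 10 ≤ g.F.card ∧ 0 ≤ g.ξ ∧ (∀ a ∈ g.F, V.ld a < 1 → g.ξ ≤ V.ld a) ∧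
      (¬ V.Int X → ¬ K / 100 < (V.frz X).card → ∀ b ∈ Bt,
        ∀ i ∈ b.1, i ∈ V.B X ∨ V.t ≤ i → xhat k (V.sg b) ≤ V.ld i + g.ξ)
  | .counted => 0 ≤ g.ξ ∧ ∀ a ∈ g.F, V.ld a < 1 → g.ξ ≤ V.ld a

/-- The accounting invariants of one color. -/
structure GInv (g : Ghost) : Prop where
  F_mem : ∀ a ∈ g.F, a ∈ X ∧ a < V.t ∧ V.st a = .fractional
  F_card : (g.F.card : ℝ) ≤ 11 / 100 * K
  -- Items are satisfied in their order, except that Case 6 overtakes the active block, which is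
  -- then recorded in `F`.
  pf : ∀ i ∈ X, ∀ i' ∈ X, i < i' → i' < V.t → 1 ≤ V.ld i' → V.ld i < 1 → i ∈ g.F
  bf : V.blk → V.B X ⊆ g.F
  beta_le : beta V.W ≤ 4 * g.Cr - g.m / 20
  hold_le : V.hold K (V.act X ∪ g.held) ≤ 4 * g.Cr - g.m / 20
  R_le : g.R + g.allowance V ≤ 12 * g.Cr + 2 * g.m
  -- A crude bound valid in every phase: x̂ never grows by more than the weight scheduled, and `en`
  -- is set to 0 only together with σ̂.
  x_le : ¬ V.Int X → ∀ b ∈ Bt, xhat k (V.sg b) ≤ V.en + V.Wr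
  phase : V.PhaseInv k K X Bt g

variable {k K X Bt V}

theorem phi_nonneg (x : ℝ) : 0 ≤ phi x := le_max_left _ _

theorem phi_le_of_le_one {x : ℝ} (h0 : 0 ≤ x) (h : x ≤ 1) : phi x ≤ 15 / 16 :=
  max_le (by norm_num) (by nlinarith)

theorem phi_eq_zero {x : ℝ} (h0 : 0 ≤ x) (h : x ≤ 1 / 4) : phi x = 0 :=
  max_eq_left (by nlinarith)

theorem phi_one : phi 1 = 15 / 16 := by unfold phi; norm_num

theorem phi_add_le {x w : ℝ} (hx : 0 ≤ x) (hw : 0 ≤ w) : phi (x + w) ≤ phi x + 2 * w * (x + w) := by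
  refine max_le ?_ ?_
  · have := phi_nonneg x
    positivity
  · have : x ^ 2 - 1 / 16 ≤ phi x := le_max_right _ _
    nlinarith

theorem beta_nonneg (x : ℝ) : 0 ≤ beta x := le_max_left _ _

theorem beta_eq_zero {x : ℝ} (h : x ≤ 1 / 10) : beta x = 0 := max_eq_left (by linarith)

theorem beta_mono {x y : ℝ} (h : x ≤ y) : beta x ≤ beta y :=
  max_le_max le_rfl (by linarith)

theorem beta_add_le {x w : ℝ} (hw : 0 ≤ w) : beta (x + w) ≤ beta x + 5 / 3 * w := by
  have h0 := beta_nonneg x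
  have h1 : 5 / 3 * (x - 1 / 10) ≤ beta x := le_max_right _ _
  exact max_le (by linarith) (by linarith)

theorem hold_nonneg (hK : 0 < K) (A : Finset ℕ) : 0 ≤ V.hold K A :=
  div_nonneg (Finset.sum_nonneg (fun _ _ => phi_nonneg _)) hK.le

theorem hold_mono (hK : 0 < K) {V' : ColorView} {A A' : Finset ℕ} (h : A' ⊆ A)
    (hl : ∀ i ∈ A', V'.ld i = V.ld i) : V'.hold K A' ≤ V.hold K A := by
  unfold hold
  gcongr ?_ / K
  calc ∑ i ∈ A', phi (V'.ld i) = ∑ i ∈ A', phi (V.ld i) :=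
        Finset.sum_congr rfl (fun i hi => by rw [hl i hi])
    _ ≤ _ := Finset.sum_le_sum_of_subset_of_nonneg h (fun _ _ _ => phi_nonneg _)

theorem allowance_nonneg (g : Ghost) : 0 ≤ g.allowance V := by
  unfold Ghost.allowance
  split
  · exact le_rfl
  · exact le_rfl
  · exact le_max_left _ _
  · have := le_max_left 0 (1 - g.ξ)
    linarith

theorem held_subset (g : Ghost) : g.held ⊆ g.F := by
  unfold Ghost.held
  split
  · exact subset_rfl
  · exact Finset.empty_subset _

theorem xhat_zero (k : ℕ) : xhat k 0 = 0 := by simp [xhat]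

theorem eff_nonneg (h : ∀ p ∈ V.op, 0 ≤ p.weight) (b : Batch) : 0 ≤ V.eff X b := by
  apply Multiset.sum_nonneg
  simp only [Multiset.mem_map, Multiset.mem_filter]
  rintro _ ⟨p, hp, rfl⟩
  exact h p hp.1

theorem eff_le_W (h : ∀ p ∈ V.op, 0 ≤ p.weight) (b : Batch) : V.eff X b ≤ V.W :=
  sum_filter_le h _

theorem sum_filter_map_le {s : Multiset Piece} {f : Piece → Piece} {P Q : Piece → Prop}
    [DecidablePred P] [DecidablePred Q]
    (h0 : ∀ p ∈ s, 0 ≤ p.weight) (hw : ∀ p ∈ s, (f p).weight = p.weight)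
    (h : ∀ p ∈ s, P p → Q (f p)) :
    ((s.filter P).map Piece.weight).sum ≤ (((s.map f).filter Q).map Piece.weight).sum := by
  induction s using Multiset.induction with
  | empty => simp
  | cons a s ih =>
    have ih := ih (fun p hp => h0 p (Multiset.mem_cons_of_mem hp))
      (fun p hp => hw p (Multiset.mem_cons_of_mem hp))
      (fun p hp => h p (Multiset.mem_cons_of_mem hp))
    have ha0 := h0 a (Multiset.mem_cons_self _ _)
    have haw := hw a (Multiset.mem_cons_self _ _)
    have ha := h a (Multiset.mem_cons_self _ _)
    rw [Multiset.map_cons]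
    by_cases hP : P a
    · rw [Multiset.filter_cons_of_pos _ hP, Multiset.filter_cons_of_pos _ (ha hP)]
      simp only [Multiset.map_cons, Multiset.sum_cons]
      linarith
    · rw [Multiset.filter_cons_of_neg _ hP]
      by_cases hQ : Q (f a)
      · rw [Multiset.filter_cons_of_pos _ hQ]
        simp only [Multiset.map_cons, Multiset.sum_cons]
        linarith
      · rwa [Multiset.filter_cons_of_neg _ hQ]

/-- Lowering the pseudo-dual costs, and raising the credit, preserves the accounting invariants. -/
theorem GInv.lower {g : Ghost} (h : V.GInv k K X Bt g) {sg : Batch → ℝ} {cr : ℝ} (hcr : 0 ≤ cr)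
    (hs : ¬ V.Int X → ∀ b ∈ Bt, xhat k (sg b) ≤ xhat k (V.sg b)) :
    ({ V with sg := sg } : ColorView).GInv k K X Bt { g with Cr := g.Cr + cr } := by
  have hb := h.beta_le
  have hh := h.hold_le
  have hR := h.R_le
  exact {
    F_mem := h.F_mem
    F_card := h.F_card
    pf := h.pf
    bf := h.bf
    beta_le := by
      change beta V.W ≤ _
      dsimp only
      linarith
    hold_le := by
      change V.hold K (V.act X ∪ g.held) ≤ _
      dsimp only
      linarith
    R_le := by
      change g.R + g.allowance V ≤ _
      dsimp only
      linarith
    x_le := fun hi b hbt => (hs hi b hbt).trans (h.x_le hi b hbt)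
    phase := by
      have hp := h.phase
      obtain ⟨ph, F, ξ, m, R, Cr⟩ := g
      cases ph with
      | clean =>
        refine ⟨hp.1, fun hi hf b hbt => ⟨fun i hib ha => ?_, fun i hib ha => ?_⟩⟩
        · exact (hs hi b hbt).trans ((hp.2 hi hf b hbt).1 i hib ha)
        · exact (hs hi b hbt).trans ((hp.2 hi hf b hbt).2 i hib ha)
      | dirty => exact hp
      | live =>
        refine ⟨hp.1, hp.2.1, hp.2.2.1, fun hi hf b hbt i hib ha => ?_⟩
        exact (hs hi b hbt).trans (hp.2.2.2 hi hf b hbt i hib ha)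
      | counted => exact hp }

/-- After a reset of the color, when the satisfied items precede the others. -/
theorem GInv.clean {g : Ghost} (h : V.GInv k K X Bt g) (hK : 0 < K) {V' : ColorView}
    (hinv : V'.Inv X k K) (hW : V'.W = V.W) (hsg : ∀ b, V'.sg b = 0)
    (hpf : ∀ i ∈ X, ∀ i' ∈ X, i < i' → i' < V'.t → 1 ≤ V'.ld i' → 1 ≤ V'.ld i)
    (hblk : V'.blk → V'.B X = ∅) (hact : ∀ i ∈ V'.act X, V'.ld i = 0) :
    V'.GInv k K X Bt { g with phase := .clean, F := ∅ } := by
  have hx : ∀ b, xhat k (V'.sg b) = 0 := fun b => by rw [hsg, xhat_zero]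
  have hb := h.beta_le
  exact {
    F_mem := by simp
    F_card := by simpa using hK.le
    pf := fun i hi i' hi' hii ht h1 h2 => absurd (hpf i hi i' hi' hii ht h1) (not_le.2 h2)
    bf := fun hb => (hblk hb).subset
    beta_le := by rw [hW]; exact hb
    hold_le := by
      have : V'.hold K (V'.act X ∪ ∅) = 0 := by
        unfold hold
        rw [Finset.union_empty, Finset.sum_eq_zero, zero_div]
        intro i hi
        rw [hact i hi, phi_eq_zero le_rfl (by norm_num)]
      change V'.hold K (V'.act X ∪ ∅) ≤ _
      rw [this]
      exact (beta_nonneg _).trans hb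
    R_le := by
      have := h.R_le
      have h2 := allowance_nonneg (V := V) g
      change g.R + 0 ≤ _
      dsimp only
      linarith
    x_le := fun _ b _ => by
      rw [hx]
      exact add_nonneg hinv.en_nonneg (Wr_nonneg hinv.weight_nonneg)
    phase := ⟨rfl, fun _ _ b _ => ⟨fun i _ _ => by rw [hx]; exact hinv.ld_nonneg i,
      fun i _ _ => by rw [hx]; exact eff_nonneg hinv.weight_nonneg b⟩⟩ }

theorem mem_B_iff {i : ℕ} : i ∈ V.B X ↔ i ∈ V.act X ∨ i ∈ V.frz X := by
  unfold act frz
  simp only [Finset.mem_filter]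
  tauto

theorem notMem_frz_of_act {i : ℕ} (h : i ∈ V.act X) : i ∉ V.frz X := fun hf =>
  (mem_act.1 h).2.2.2 (mem_frz.1 hf).2.2.2

theorem GInv.mkInt {g : Ghost} (h : V.GInv k K X Bt g) (hv : V.Inv X k K) (hK : 0 < K)
    (hfull : K / 100 < (V.frz X).card) (hact : V.act X = ∅) :
    (V.mkInt X).GInv k K X Bt { g with phase := .clean, F := ∅ } := by
  have hB : ∀ i, i ∈ V.B X → i ∈ V.frz X := by
    intro i hi
    rcases mem_B_iff.1 hi with ha | hf
    · simp [hact] at ha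
    · exact hf
  refine h.clean hK (hv.mkInt hfull hact) rfl (fun _ => rfl) ?_ ?_ ?_
  · intro i hi i' hi' hii ht h1
    by_contra hlt
    have ht : i' < V.t := ht
    have h1 : 1 ≤ V.ld i' := h1
    have hlt : V.ld i < 1 := not_le.1 hlt
    have hf := hB i (mem_B.2 ⟨hi, hii.trans ht, hlt⟩)
    have := hv.suffix i hf i' hi' ht (fun hf' => by
      have := (mem_frz.1 hf').2.2.1
      linarith)
    omega
  · intro hb
    have := hv.blk_frz hb
    refine Finset.eq_empty_of_forall_notMem (fun i hi => ?_)
    have := hB i hi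
    simp_all
  · intro i hi
    exact hv.ld_frz (hB i (act_subset_B (V := V.mkInt X) hi))

theorem GInv.unblock {g : Ghost} (h : V.GInv k K X Bt g) : V.unblock.GInv k K X Bt g where
  F_mem := h.F_mem
  F_card := h.F_card
  pf := h.pf
  bf := fun h => h.elim
  beta_le := h.beta_le
  hold_le := h.hold_le
  R_le := h.R_le
  x_le := h.x_le
  phase := h.phase

/-! ### Replenishing -/

theorem Wr_repl : (V.repl X).Wr = V.Wr := by
  unfold Wr repl
  rw [Multiset.filter_map, Multiset.map_map]
  rfl

theorem W_repl : (V.repl X).W = V.W := by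
  simp [W, repl, Multiset.map_map]

theorem Inv.repl_ld (h : V.Inv X k K) (i : ℕ) :
    (V.repl X).ld i = if i ∈ V.frz X then V.W else V.ld i := by
  change (if _ then _ else _) = _
  split_ifs with hi
  · rw [h.ld_frz hi, zero_add]
  · rfl

theorem Inv.frz_repl (h : V.Inv X k K) : (V.repl X).frz X = ∅ := by
  ext i
  simp only [Finset.notMem_empty, iff_false]
  intro hi
  obtain ⟨h1, h2, h3, h4⟩ := mem_frz.1 hi
  change (if _ then _ else _) = _ at h4
  rw [h.repl_ld] at h3
  split_ifs at h3 h4 with hf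
  exact hf (mem_frz.2 ⟨h1, h2, h3, h4⟩)

theorem Inv.act_repl (h : V.Inv X k K) : (V.repl X).act X ⊆ V.act X ∪ V.frz X := by
  intro i hi
  obtain ⟨h1, h2, h3, h4⟩ := mem_act.1 hi
  rw [Finset.mem_union, ← mem_B_iff, mem_B]
  refine ⟨h1, h2, ?_⟩
  rw [h.repl_ld] at h3
  split_ifs at h3 with hf
  · exact (mem_frz.1 hf).2.2.1
  · exact h3

theorem GInv.repl {g : Ghost} (h : V.GInv k K X Bt g) (hv : V.Inv X k K) (hK : 0 < K)
    (hint : ¬ V.Int X) (hlt : ((V.act X).card : ℝ) < K / 10)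
    (hnf : ((V.frz X).card : ℝ) ≤ K / 100) (hne : (V.frz X).Nonempty) (hW : V.W ≤ 1) :
    (V.repl X).GInv k K X Bt g := by
  have hld := hv.repl_ld
  have hv' := hv.repl hint hlt hnf hW
  have hfrz := hv.frz_repl
  have hact := hv.act_repl
  have hW0 := W_nonneg hv.weight_nonneg
  have hle : ∀ i, V.ld i ≤ (V.repl X).ld i := by
    intro i
    rw [hld]
    split_ifs with hi
    · rw [hv.ld_frz hi]; exact hW0
    · exact le_rfl
  have hnf' : ¬ K / 100 < ((V.frz X).card : ℝ) := not_lt.2 hnf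
  have hB : (V.repl X).B X ⊆ V.B X := by
    intro i hi
    rw [mem_B] at hi ⊢
    exact ⟨hi.1, hi.2.1, (hle i).trans_lt hi.2.2⟩
  have heff : ∀ b, V.eff X b ≤ (V.repl X).eff X b := by
    intro b
    refine sum_filter_map_le hv.weight_nonneg (fun _ _ => rfl) ?_
    intro p hp hc
    unfold Catches at hc ⊢
    rw [hfrz]
    refine lt_of_le_of_lt (Nat.add_le_add_left (Finset.card_le_card ?_) _) hc
    intro i hi
    simp only [Finset.mem_filter, Finset.mem_union, Finset.notMem_empty, not_false_eq_true,
      and_true, not_or] at hi ⊢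
    exact hi
  exact {
    F_mem := by
      intro a ha
      obtain ⟨h1, h2, h3⟩ := h.F_mem a ha
      refine ⟨h1, h2, ?_⟩
      change (if _ then _ else _) = _
      split_ifs
      · rfl
      · exact h3
    F_card := h.F_card
    pf := by
      intro i hi i' hi' hii ht h1 h2
      have ht : i' < V.t := ht
      have h2' := (hle i).trans_lt h2
      by_cases h3 : 1 ≤ V.ld i'
      · exact h.pf i hi i' hi' hii ht h3 h2'
      -- An appended item is satisfied at once only if `W` is at least 1, and then no fractional
      -- item is unsatisfied.
      · exfalso
        rw [hld] at h1 h2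
        split_ifs at h1 with hf'
        · split_ifs at h2 with hf
          · linarith
          · have hb : i ∈ V.B X := mem_B.2 ⟨hi, hii.trans ht, h2⟩
            have ha := (mem_B_iff.1 hb).resolve_right hf
            linarith [hv.W_le i hb (frac_of_act hint ha)]
        · exact h3 h1
    bf := by
      intro hb
      have := hv.blk_frz hb
      simp [this] at hne
    beta_le := by
      rw [W_repl]
      exact h.beta_le
    hold_le := by
      -- With W ≤ 1/4 the appended items hold nothing. Otherwise at most 22/100 K items, of value at
      -- most 15/16 each, hold less than 1/4, which the reserve `beta` covers.
      by_cases hW4 : V.W ≤ 1 / 4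
      · refine le_trans ?_ h.hold_le
        unfold hold
        gcongr ?_ / K
        have h1 : (V.repl X).act X ∪ g.held ⊆ (V.act X ∪ g.held) ∪ V.frz X := by
          intro i hi
          simp only [Finset.mem_union] at hi ⊢
          rcases hi with hi | hi
          · have := Finset.mem_union.1 (hact hi)
            tauto
          · tauto
        have hd : Disjoint (V.act X ∪ g.held) (V.frz X) := by
          rw [Finset.disjoint_left]
          intro i hi hf
          rcases Finset.mem_union.1 hi with ha | ha
          · exact notMem_frz_of_act ha hf
          · have := (h.F_mem i (held_subset g ha)).2.2
            rw [(mem_frz.1 hf).2.2.2] at this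
            cases this
        refine (Finset.sum_le_sum_of_subset_of_nonneg h1 (fun _ _ _ => phi_nonneg _)).trans ?_
        rw [Finset.sum_union hd]
        have h2 : ∑ i ∈ V.frz X, phi ((V.repl X).ld i) = 0 := by
          refine Finset.sum_eq_zero (fun i hi => ?_)
          rw [hld, if_pos hi, phi_eq_zero hW0 hW4]
        rw [h2, add_zero]
        refine (Finset.sum_congr rfl (fun i hi => ?_)).le
        rw [hld, if_neg (Finset.disjoint_left.1 hd hi)]
      · refine le_trans ?_ h.beta_le
        have hb : 1 / 4 ≤ beta V.W := le_max_of_le_right (by linarith)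
        refine le_trans ?_ hb
        unfold hold
        rw [div_le_iff₀ hK]
        have hcard : ((((V.repl X).act X ∪ g.held).card : ℕ) : ℝ) ≤ 22 / 100 * K := by
          have h1 : ((V.repl X).act X ∪ g.held).card ≤
              (V.act X).card + (V.frz X).card + g.F.card := by
            refine (Finset.card_union_le _ _).trans (Nat.add_le_add ?_ ?_)
            · exact (Finset.card_le_card hact).trans (Finset.card_union_le _ _)
            · exact Finset.card_le_card (held_subset g)
          have h2 : ((((V.repl X).act X ∪ g.held).card : ℕ) : ℝ) ≤
              (V.act X).card + (V.frz X).card + g.F.card := by exact_mod_cast h1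
          linarith [h.F_card]
        calc _ ≤ ∑ i ∈ (V.repl X).act X ∪ g.held, (15 / 16 : ℝ) :=
              Finset.sum_le_sum (fun i _ => phi_le_of_le_one (hv'.ld_nonneg i) (hv'.ld_le i))
          _ = (((V.repl X).act X ∪ g.held).card : ℝ) * (15 / 16) := by
              rw [Finset.sum_const, nsmul_eq_mul]
          _ ≤ _ := by nlinarith
    R_le := by
      have : g.allowance (V.repl X) = g.allowance V := by
        unfold Ghost.allowance
        rw [Wr_repl]
        rfl
      rw [this]
      exact h.R_le
    x_le := by
      intro _
      rw [Wr_repl]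
      exact h.x_le hint
    phase := by
      have hp := h.phase
      obtain ⟨ph, F, ξ, m, R, Cr⟩ := g
      cases ph with
      | clean =>
        -- A frozen item that joins all open pieces gets load `W`, which is at least the effective
        -- weight that dominated x̂ so far.
        refine ⟨hp.1, fun _ _ b hbt => ⟨fun i hib ha => ?_, fun i hib ha => ?_⟩⟩
        · change xhat k (V.sg b) ≤ _
          rw [hld]
          split_ifs with hf
          · exact ((hp.2 hint hnf' b hbt).2 i hib (Or.inl hf)).trans (eff_le_W hv.weight_nonneg b)
          · exact (hp.2 hint hnf' b hbt).1 i hib ((Finset.mem_union.1 (hact ha)).resolve_right hf)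
        · rw [hfrz] at ha
          simp only [Finset.notMem_empty, false_or] at ha
          exact ((hp.2 hint hnf' b hbt).2 i hib (Or.inr ha)).trans (heff b)
      | dirty => exact hp
      | live =>
        refine ⟨hp.1, hp.2.1, fun a ha hl => ?_, fun _ _ b hbt i hib ha => ?_⟩
        · exact (hp.2.2.1 a ha ((hle a).trans_lt hl)).trans (hle a)
        · refine (hp.2.2.2 hint hnf' b hbt i hib ?_).trans (by linarith [hle i])
          exact ha.imp (fun hb => hB hb) id
      | counted => exact ⟨hp.1, fun a ha hl => (hp.2 a ha ((hle a).trans_lt hl)).trans (hle a)⟩ }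

end ColorView

end

end RBM

/-! ### One color: accounting for closing, advancing, Case 3 and evictions -/

namespace RBM

noncomputable section

open scoped Classical

namespace ColorView

variable {X : Finset ℕ} {V : ColorView} {k : ℕ} {K : ℝ} {Bt : Set Batch}

theorem hold_le_hold (hK : 0 < K) {V' : ColorView} {A A' : Finset ℕ}
    (h : ∀ i ∈ A', (i ∈ A ∧ V'.ld i = V.ld i) ∨ phi (V'.ld i) = 0) :
    V'.hold K A' ≤ V.hold K A := by
  unfold hold
  gcongr ?_ / K
  rw [← Finset.sum_filter_ne_zero]
  have h1 : ∀ i ∈ A'.filter (fun i => phi (V'.ld i) ≠ 0), i ∈ A ∧ V'.ld i = V.ld i := by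
    intro i hi
    rw [Finset.mem_filter] at hi
    exact (h i hi.1).resolve_right hi.2
  calc _ = ∑ i ∈ A'.filter (fun i => phi (V'.ld i) ≠ 0), phi (V.ld i) :=
        Finset.sum_congr rfl (fun i hi => by rw [(h1 i hi).2])
    _ ≤ _ := Finset.sum_le_sum_of_subset_of_nonneg (fun i hi => (h1 i hi).1)
        (fun _ _ _ => phi_nonneg _)

/-- If a piece that catches a batch reaches its end, all items of the batch have arrived. -/
theorem no_future_of_catches {b : Batch} (hb : ∀ i ∈ b.1, i < slotOf b i) {p : Piece}
    (hend : p.nextSlot ≤ V.t) (hfrz : V.frz X = ∅) (hc : V.Catches X b p) :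
    ∀ i ∈ b.1, i < V.t := by
  by_contra hcon
  push Not at hcon
  obtain ⟨i, hi, hti⟩ := hcon
  have hne : (b.1.filter (fun i => V.t ≤ i)).Nonempty := ⟨i, Finset.mem_filter.2 ⟨hi, hti⟩⟩
  -- The first item m still to come is matched no later than `b.2` plus the number of arrived items
  -- of the batch, hence before slot t ≤ m.
  obtain ⟨m, hm, hmin⟩ := Finset.exists_min_image _ id hne
  rw [Finset.mem_filter] at hm
  have hr : rank b.1 m ≤ (b.1.filter (fun i => i < V.t)).card := by
    refine Finset.card_le_card (fun x hx => ?_)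
    rw [Finset.mem_filter] at hx ⊢
    refine ⟨hx.1, ?_⟩
    by_contra hn
    have := hmin x (Finset.mem_filter.2 ⟨hx.1, not_lt.1 hn⟩)
    simp only [id] at this
    omega
  have hsub : b.1.filter (fun i => i < V.t) ⊆
      b.1.filter (fun i => i < V.t ∧ i ∉ p.items ∧ i ∉ V.frz X) ∪ p.items := by
    intro x hx
    rw [hfrz]
    simp only [Finset.mem_filter, Finset.mem_union, Finset.notMem_empty] at hx ⊢
    tauto
  have h1 := (Finset.card_le_card hsub).trans (Finset.card_union_le _ _)
  have h2 := hb m hm.1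
  unfold Catches at hc
  unfold Piece.nextSlot at hend
  unfold slotOf at h2
  omega

theorem en_close : V.close.en + V.close.Wr = V.en + V.Wr := by
  have h : V.Wr = ((V.op.filter (fun p => p.nextSlot ≤ V.t ∧ p.regular)).map Piece.weight).sum +
      V.close.Wr := by
    unfold Wr
    conv_lhs => rw [← Multiset.filter_add_not (fun p : Piece => p.nextSlot ≤ V.t)
      (V.op.filter (fun p => p.regular))]
    rw [Multiset.map_add, Multiset.sum_add]
    congr 3
    · rw [Multiset.filter_filter]
    · change _ = Multiset.filter _ (Multiset.filter _ _)
      rw [Multiset.filter_filter, Multiset.filter_filter]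
      exact Multiset.filter_congr (fun p _ => by rw [not_le]; tauto)
  change V.en + _ + _ = _
  rw [h]
  ring

/-- Here domination by loads is lost: an ending piece takes weight away from what frozen items could
still receive. What is lost is at most the open weight, which a large active block carries. -/
theorem GInv.close {g : Ghost} (h : V.GInv k K X Bt g) (hv : V.Inv X k K)
    (hset : ¬ V.Int X → (V.frz X).Nonempty → ¬ K / 100 < (V.frz X).card →
      K / 10 ≤ (V.act X).card)
    (hBt : ∀ b ∈ Bt, ∀ i ∈ b.1, i < slotOf b i) :
    ∃ g', V.close.GInv k K X Bt g' ∧ g'.R = g.R ∧ g'.Cr = g.Cr ∧ g'.m = g.m := by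
  have hbeta : beta V.close.W ≤ 4 * g.Cr - g.m / 20 :=
    (beta_mono (W_close_le hv.weight_nonneg)).trans h.beta_le
  have hx : ¬ V.Int X → ∀ b ∈ Bt, xhat k (V.sg b) ≤ V.close.en + V.close.Wr := by
    rw [en_close]
    exact h.x_le
  have hal : g.allowance V.close = g.allowance V := by
    unfold Ghost.allowance
    rw [en_close]
  by_cases hc : g.phase = .clean ∧ ¬ V.Int X ∧ ¬ K / 100 < ((V.frz X).card : ℝ) ∧
      (V.frz X).Nonempty
  · obtain ⟨hph, hint, hnf, hne⟩ := hc
    obtain ⟨ph, F, ξ, m, R, Cr⟩ := g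
    simp only at hph
    subst hph
    have hp : F = ∅ ∧ _ := h.phase
    obtain ⟨rfl, hp2⟩ := hp
    -- The active block becomes the reference set; `W` bounds both the effective weight, hence x̂ on
    -- the items not yet active, and from below the load of each member.
    refine ⟨⟨.live, V.act X, V.W, m, R, Cr⟩, ?_, rfl, rfl, rfl⟩
    have hK10 := hset hint hne hnf
    have hpf : ∀ i ∈ X, ∀ i' ∈ X, i < i' → i' < V.t → 1 ≤ V.ld i' → ¬ V.ld i < 1 :=
      fun i hi i' hi' h1 h2 h3 h4 => by simpa using h.pf i hi i' hi' h1 h2 h3 h4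
    exact {
      F_mem := fun a ha => ⟨(mem_act.1 ha).1, (mem_act.1 ha).2.1, frac_of_act hint ha⟩
      F_card := by
        by_cases hn : (V.act X).Nonempty
        · exact hv.act_le (frac_of_nonempty hint hn)
        · rw [Finset.not_nonempty_iff_eq_empty] at hn
          have hF := h.F_card
          simpa [hn] using hF
      pf := fun i hi i' hi' h1 h2 h3 h4 => absurd h4 (hpf i hi i' hi' h1 h2 h3)
      bf := by
        intro hb
        have hB : V.B X ⊆ ∅ := h.bf hb
        obtain ⟨f, hf⟩ := hne
        have := hB (mem_B_iff.2 (Or.inr hf))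
        simp at this
      beta_le := hbeta
      hold_le := by
        have hh := h.hold_le
        have e1 : V.act X ∪ (⟨.clean, ∅, ξ, m, R, Cr⟩ : Ghost).held = V.act X := by
          simp [Ghost.held]
        have e2 : V.close.act X ∪ (⟨.live, V.act X, V.W, m, R, Cr⟩ : Ghost).held = V.act X := by
          change V.act X ∪ V.act X = _
          simp
        rw [e1] at hh
        rw [e2]
        exact hh
      R_le := h.R_le
      x_le := hx
      phase := by
        refine ⟨hK10, W_nonneg hv.weight_nonneg, fun a ha hl => ?_, fun _ _ b hb i hi hib => ?_⟩
        · exact hv.W_le a (act_subset_B ha) (frac_of_act hint ha)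
        · have h0 := hv.ld_nonneg i
          have hW := W_nonneg hv.weight_nonneg
          obtain ⟨h1, h2⟩ := hp2 hint hnf b hb
          change xhat k (V.sg b) ≤ V.ld i + V.W
          change i ∈ V.B X ∨ V.t ≤ i at hib
          rw [mem_B_iff, or_assoc] at hib
          rcases hib with hib | hib
          · linarith [h1 i hi hib]
          · linarith [h2 i hi hib, eff_le_W (X := X) hv.weight_nonneg b] }
  · refine ⟨g, ?_, rfl, rfl, rfl⟩
    exact {
      F_mem := h.F_mem
      F_card := h.F_card
      pf := h.pf
      bf := h.bf
      beta_le := hbeta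
      hold_le := h.hold_le
      R_le := by
        rw [hal]
        exact h.R_le
      x_le := hx
      phase := by
        have hp := h.phase
        obtain ⟨ph, F, ξ, m, R, Cr⟩ := g
        cases ph with
        | clean =>
          refine ⟨hp.1, fun hi hf b hbt => ⟨(hp.2 hi hf b hbt).1, fun i hib ha => ?_⟩⟩
          refine ((hp.2 hi hf b hbt).2 i hib ha).trans (le_of_eq ?_)
          -- Without frozen items, a piece that ends and catches the batch leaves no item of it to
          -- come, so the effective weight loses nothing relevant.
          have hfrz : V.frz X = ∅ := by
            by_contra hne
            exact hc ⟨rfl, hi, hf, Finset.nonempty_iff_ne_empty.2 hne⟩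
          change i ∈ V.frz X ∨ V.t ≤ i at ha
          rw [hfrz] at ha
          simp only [Finset.notMem_empty, false_or] at ha
          change _ = (Multiset.map _ (Multiset.filter (fun p => V.Catches X b p)
            (Multiset.filter _ V.op))).sum
          rw [Multiset.filter_filter]
          unfold eff
          congr 2
          refine Multiset.filter_congr (fun p _ => ⟨fun hc => ⟨hc, ?_⟩, fun hc => hc.1⟩)
          by_contra hlt
          have := no_future_of_catches (hBt b hbt) (not_lt.1 hlt) hfrz hc i hib
          omega
        | dirty => exact hp
        | live => exact hp
        | counted => exact hp }

theorem GInv.adv {g : Ghost} (h : V.GInv k K X Bt g) (hv : V.Inv X k K) (hK : 0 < K)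
    (hstart : V.sus → ∀ p ∈ V.op, p.start = V.t) (hBt : ∀ b ∈ Bt, b.1 ⊆ X) :
    (V.adv X).GInv k K X Bt g := by
  have hld : ∀ i, (V.adv X).ld i = if i = V.t ∧ i ∈ X ∧ V.blk then 1 else V.ld i := by
    intro i
    change (if i = V.t ∧ i ∈ X ∧ V.blk then V.ld i + 1 else V.ld i) = _
    split_ifs with hi
    · rw [hv.ld_future i hi.1.ge, zero_add]
    · rfl
  have hle : ∀ i, V.ld i ≤ (V.adv X).ld i := by
    intro i
    rw [hld]
    split_ifs
    · exact hv.ld_le i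
    · exact le_rfl
  have hF : ∀ a ∈ g.F, (V.adv X).ld a = V.ld a := fun a ha =>
    adv_ld_of_ne (h.F_mem a ha).2.1.ne
  have hal : g.allowance (V.adv X) = g.allowance V := by
    unfold Ghost.allowance
    rw [Wr_adv]
    rfl
  have hB : ∀ i, i ∈ (V.adv X).B X ∨ V.t + 1 ≤ i → i ∈ V.B X ∨ V.t ≤ i := by
    intro i hi
    rw [hv.mem_B_adv] at hi
    rcases hi with (hi | hi) | hi
    · exact Or.inl hi
    · exact Or.inr hi.1.ge
    · exact Or.inr (by omega)
  have hfull : ¬ K / 100 < (((V.adv X).frz X).card : ℝ) → ¬ K / 100 < ((V.frz X).card : ℝ) := by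
    intro hn hlt
    refine hn (hlt.trans_le ?_)
    exact_mod_cast Finset.card_le_card (fun i hi => hv.frz_adv.2 (Or.inl hi))
  exact {
    F_mem := by
      intro a ha
      obtain ⟨h1, h2, h3⟩ := h.F_mem a ha
      exact ⟨h1, Nat.lt_succ_of_lt h2, by rw [adv_st_of_ne h2.ne]; exact h3⟩
    F_card := h.F_card
    pf := by
      intro i hi i' hi' hii ht h1 h2
      have ht : i' < V.t + 1 := ht
      rw [adv_ld_of_ne (by omega)] at h2
      rcases Nat.lt_succ_iff_lt_or_eq.1 ht with ht | ht
      · rw [adv_ld_of_ne ht.ne] at h1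
        exact h.pf i hi i' hi' hii ht h1 h2
      · rw [hld] at h1
        split_ifs at h1 with hb
        -- An item absorbed by the block is satisfied before its unsatisfied predecessors; `bf`
        -- places these in the reference set.
        · exact h.bf hb.2.2 (mem_B.2 ⟨hi, by omega, h2⟩)
        · rw [hv.ld_future i' ht.ge] at h1
          norm_num at h1
    bf := by
      intro hb i hi
      rcases hv.mem_B_adv.1 hi with hi | hi
      · exact h.bf hb hi
      · exact absurd hb hi.2.2
    beta_le := by
      rw [W_adv]
      exact h.beta_le
    hold_le := by
      refine (hold_le_hold hK ?_).trans h.hold_le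
      intro i hi
      rw [Finset.mem_union, hv.act_adv] at hi
      rcases hi with (hi | hi) | hi
      · exact Or.inl ⟨Finset.mem_union_left _ hi, adv_ld_of_ne (mem_act.1 hi).2.1.ne⟩
      · refine Or.inr ?_
        rw [hld, if_neg (fun hn => hi.2.2.1 hn.2.2), hv.ld_future i hi.1.ge]
        exact phi_eq_zero le_rfl (by norm_num)
      · exact Or.inl ⟨Finset.mem_union_right _ hi, hF i (held_subset g hi)⟩
    R_le := by
      rw [hal]
      exact h.R_le
    x_le := by
      rw [hv.int_adv, Wr_adv]
      exact h.x_le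
    phase := by
      have hp := h.phase
      obtain ⟨ph, F, ξ, m, R, Cr⟩ := g
      cases ph with
      | clean =>
        refine ⟨hp.1, fun hi hf b hbt => ?_⟩
        rw [hv.int_adv] at hi
        obtain ⟨h1, h2⟩ := hp.2 hi (hfull hf) b hbt
        refine ⟨fun i hib ha => ?_, fun i hib ha => ?_⟩
        · rcases hv.act_adv.1 ha with ha | ha
          · exact (h1 i hib ha).trans (hle i)
          · exact absurd ha.2.2.2 hi
        · have ha' : i ∈ V.frz X ∨ V.t ≤ i := by
            rw [hv.frz_adv] at ha
            rcases ha with (ha | ha) | ha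
            · exact Or.inl ha
            · exact Or.inr ha.1.ge
            · exact Or.inr (le_trans (Nat.le_succ _) ha)
          refine (h2 i hib ha').trans ?_
          by_cases hs : V.sus
          · have hop : (V.adv X).op = V.op.map (fun p => { p with start := V.t + 1 }) := if_pos hs
            unfold eff
            rw [hop]
            refine sum_filter_map_le hv.weight_nonneg (fun _ _ => rfl) ?_
            intro p hp hc
            unfold Catches at hc ⊢
            -- Under suspension the start of the piece moves up by one, which makes room for the one
            -- item that arrives.
            have hst := hstart hs p hp
            have hsub : b.1.filter (fun i => i < V.t + 1 ∧ i ∉ p.items ∧ i ∉ (V.adv X).frz X) ⊆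
                insert V.t (b.1.filter (fun i => i < V.t ∧ i ∉ p.items ∧ i ∉ V.frz X)) := by
              intro x hx
              rw [Finset.mem_insert, Finset.mem_filter]
              rw [Finset.mem_filter, hv.frz_adv] at hx
              by_cases hxt : x = V.t
              · exact Or.inl hxt
              · exact Or.inr ⟨hx.1, by omega, hx.2.2.1, fun hf => hx.2.2.2 (Or.inl hf)⟩
            have h1 := (Finset.card_le_card hsub).trans (Finset.card_insert_le _ _)
            change b.2 + (b.1.filter
              (fun i => i < V.t + 1 ∧ i ∉ p.items ∧ i ∉ (V.adv X).frz X)).card < V.t + 1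
            omega
          · have hop : (V.adv X).op = V.op := if_neg hs
            -- Outside suspension an arriving item of this nonintegral color is frozen, and frozen
            -- items are not counted by `Catches`.
            have hnb : ¬ V.blk := fun hb => hs (hv.blk_sus hb)
            have := sum_filter_map_le (s := V.op) (f := id) (P := fun p => V.Catches X b p)
              (Q := fun p => (V.adv X).Catches X b p) hv.weight_nonneg (fun _ _ => rfl) ?_
            · rw [Multiset.map_id] at this
              unfold eff
              rw [hop]
              exact this
            intro p hp hc
            unfold Catches at hc ⊢
            refine lt_of_le_of_lt (Nat.add_le_add_left (Finset.card_le_card ?_) _) hc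
            intro x hx
            rw [Finset.mem_filter, hv.frz_adv] at hx
            rw [Finset.mem_filter]
            obtain ⟨hx1, hx2, hx3, hx4⟩ := hx
            have hx2 : x < V.t + 1 := hx2
            have hxt : x ≠ V.t := fun hxt => hx4 (Or.inr ⟨hxt, hBt b hbt hx1, hnb, hi⟩)
            exact ⟨hx1, by omega, hx3, fun hf => hx4 (Or.inl hf)⟩
      | dirty => exact hp
      | live =>
        refine ⟨hp.1, hp.2.1, fun a ha hl => ?_, fun hi hf b hbt i hib ha => ?_⟩
        · rw [hF a ha] at hl ⊢
          exact hp.2.2.1 a ha hl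
        · rw [hv.int_adv] at hi
          exact (hp.2.2.2 hi (hfull hf) b hbt i hib (hB i ha)).trans
            (add_le_add_left (hle i) _)
      | counted =>
        refine ⟨hp.1, fun a ha hl => ?_⟩
        rw [hF a ha] at hl ⊢
        exact hp.2 a ha hl }

theorem GInv.cut {g : Ghost} (h : V.GInv k K X Bt g) (hv : V.Inv X k K) :
    V.cut.GInv k K X Bt g where
  F_mem := h.F_mem
  F_card := h.F_card
  pf := h.pf
  bf := h.bf
  beta_le := by
    rw [W_cut]
    exact h.beta_le
  hold_le := h.hold_le
  R_le := by
    have hal : g.allowance V.cut = g.allowance V := by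
      unfold Ghost.allowance
      rw [Wr_cut]
      rfl
    rw [hal]
    exact h.R_le
  x_le := by
    rw [Wr_cut]
    exact h.x_le
  phase := by
    have hp := h.phase
    obtain ⟨ph, F, ξ, m, R, Cr⟩ := g
    cases ph with
    | clean =>
      refine ⟨hp.1, fun hi hf b hbt => ⟨(hp.2 hi hf b hbt).1, fun i hib ha => ?_⟩⟩
      refine ((hp.2 hi hf b hbt).2 i hib ha).trans ?_
      refine sum_filter_map_le hv.weight_nonneg (fun _ _ => rfl) ?_
      intro p hp hc
      unfold Catches at hc ⊢
      -- At most t - `p.start` items are cut off, which is exactly how far the start moves.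
      have hsub : b.1.filter (fun i => i < V.t ∧ i ∉ p.rest V.t ∧ i ∉ V.frz X) ⊆
          b.1.filter (fun i => i < V.t ∧ i ∉ p.items ∧ i ∉ V.frz X) ∪
            p.items.filter (fun i => slotOf (p.items, p.start) i < V.t) := by
        intro x hx
        rw [Finset.mem_union, Finset.mem_filter, Finset.mem_filter]
        rw [Finset.mem_filter] at hx
        by_cases hxi : x ∈ p.items
        · refine Or.inr ⟨hxi, ?_⟩
          by_contra hn
          exact hx.2.2.1 (Finset.mem_filter.2 ⟨hxi, not_lt.1 hn⟩)
        · exact Or.inl ⟨hx.1, hx.2.1, hxi, hx.2.2.2⟩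
      have h1 := (Finset.card_le_card hsub).trans (Finset.card_union_le _ _)
      rw [p.card_passed (hv.start_le p hp) (hv.le_next p hp)] at h1
      have := hv.start_le p hp
      change b.2 + (b.1.filter (fun i => i < V.t ∧ i ∉ p.rest V.t ∧ i ∉ V.frz X)).card < V.t
      omega
    | dirty => exact hp
    | live => exact hp
    | counted => exact hp

/-- Loads do not increase along the active block and all of them rise by the same amount, so earlier
items are satisfied first. -/
theorem pf_addPiece (hv : V.Inv X k K) {p : Piece} (hp : p.items = V.act X) (h0 : 0 ≤ p.weight)
    {F : Finset ℕ} (hpf : ∀ i ∈ X, ∀ i' ∈ X, i < i' → i' < V.t → 1 ≤ V.ld i' → V.ld i < 1 → i ∈ F) :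
    ∀ i ∈ X, ∀ i' ∈ X, i < i' → i' < V.t → 1 ≤ (V.addPiece p).ld i' →
      (V.addPiece p).ld i < 1 → i ∈ F := by
  intro i hi i' hi' hii ht h1 h2
  have h2' := (le_addPiece_ld h0 i).trans_lt h2
  by_cases h3 : 1 ≤ V.ld i'
  · exact hpf i hi i' hi' hii ht h3 h2'
  · rw [addPiece_ld hp] at h1 h2
    split_ifs at h1 with ha'
    · exfalso
      have hb : i ∈ V.B X := mem_B.2 ⟨hi, hii.trans ht, h2'⟩
      rcases mem_B_iff.1 hb with ha | hf
      · rw [if_pos ha] at h2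
        linarith [hv.anti i ha i' ha' hii]
      · have := hv.suffix i hf i' hi' ht (notMem_frz_of_act ha')
        omega
    · exact absurd h1 h3

/-- The increment of `phi` at each active item is at most 2w(x + w), where w is the new weight and x
+ w the new load. -/
theorem hold_addPiece (hv : V.Inv X k K) (hK : 0 < K) {p : Piece} (hp : p.items = V.act X)
    (h0 : 0 ≤ p.weight) {F : Finset ℕ} {D : ℝ}
    (hD : ∑ i ∈ V.act X, 2 * p.weight * (V.ld i + p.weight) ≤ D * K) :
    (V.addPiece p).hold K ((V.addPiece p).act X ∪ F) ≤ V.hold K (V.act X ∪ F) + D := by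
  have h1 : ∑ i ∈ (V.addPiece p).act X ∪ F, phi ((V.addPiece p).ld i) ≤
      ∑ i ∈ V.act X ∪ F, (phi (V.ld i) +
        if i ∈ V.act X then 2 * p.weight * (V.ld i + p.weight) else 0) := by
    refine (Finset.sum_le_sum_of_subset_of_nonneg
      (Finset.union_subset_union_left (act_addPiece h0)) (fun _ _ _ => phi_nonneg _)).trans ?_
    refine Finset.sum_le_sum (fun i _ => ?_)
    rw [addPiece_ld hp]
    split_ifs
    · exact phi_add_le (hv.ld_nonneg i) h0
    · simp
  have h2 : ∑ i ∈ V.act X ∪ F, (if i ∈ V.act X then 2 * p.weight * (V.ld i + p.weight) else 0) =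
      ∑ i ∈ V.act X, 2 * p.weight * (V.ld i + p.weight) := by
    rw [← Finset.sum_filter]
    congr 1
    ext i
    simp only [Finset.mem_filter, Finset.mem_union]
    tauto
  rw [Finset.sum_add_distrib, h2] at h1
  unfold hold
  rw [div_add' _ _ _ hK.ne']
  gcongr
  linarith

/-- The weight of Case 3 counts as credit here, which more than finances the growth of `hold`
(22/100 per unit) and of `beta` (5/3 per unit). It is settled later by the bound on fl. -/
theorem GInv.flush {g : Ghost} (h : V.GInv k K X Bt g) (hv : V.Inv X k K) (hK : 0 < K) {p : Piece}
    (hp : p.items = V.act X) (h0 : 0 ≤ p.weight) (hreg : ¬ p.regular) (hint : ¬ V.Int X)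
    (hne : (V.act X).Nonempty) (hfull : K / 100 < (V.frz X).card)
    (hl : ∀ i ∈ V.act X, V.ld i + p.weight ≤ 1) :
    (V.addPiece p).GInv k K X Bt { g with Cr := g.Cr + p.weight } := by
  have hfrz : (V.addPiece p).frz X = V.frz X := frz_addPiece hp
  have hWr : (V.addPiece p).Wr = V.Wr := by
    unfold Wr addPiece
    rw [Multiset.filter_add]
    simp [Multiset.filter_singleton, hreg]
  have hb := h.beta_le
  have hh := h.hold_le
  have hR := h.R_le
  have hb0 := beta_nonneg V.W
  exact {
    F_mem := h.F_mem
    F_card := h.F_card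
    pf := pf_addPiece hv hp h0 h.pf
    bf := fun hb => (B_addPiece h0).trans (h.bf hb)
    beta_le := by
      rw [W_addPiece]
      have := beta_add_le (x := V.W) h0
      dsimp only
      linarith
    hold_le := by
      have := hold_addPiece hv hK hp h0 (F := g.held) (D := p.weight * (22 / 100)) ?_
      · change (V.addPiece p).hold K ((V.addPiece p).act X ∪ g.held) ≤ _
        dsimp only
        linarith
      · calc _ ≤ ∑ i ∈ V.act X, 2 * p.weight :=
              Finset.sum_le_sum (fun i hi => by nlinarith [hl i hi])
          _ = ((V.act X).card : ℝ) * (2 * p.weight) := by rw [Finset.sum_const, nsmul_eq_mul]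
          _ ≤ 11 / 100 * K * (2 * p.weight) := by
              gcongr
              exact hv.act_le (frac_of_nonempty hint hne)
          _ = _ := by ring
    R_le := by
      have hal : g.allowance (V.addPiece p) = g.allowance V := by
        unfold Ghost.allowance
        rw [hWr]
        rfl
      change g.R + g.allowance (V.addPiece p) ≤ _
      rw [hal]
      dsimp only
      linarith
    x_le := by
      rw [hWr]
      exact fun _ => h.x_le hint
    phase := by
      have hp' := h.phase
      obtain ⟨ph, F, ξ, m, R, Cr⟩ := g
      cases ph with
      | clean => exact ⟨hp'.1, fun _ hf => absurd hfull (by rwa [← hfrz])⟩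
      | dirty => exact hp'
      | live =>
        refine ⟨hp'.1, hp'.2.1, fun a ha hl => ?_, fun _ hf => absurd hfull (by rwa [← hfrz])⟩
        exact (hp'.2.2.1 a ha ((le_addPiece_ld h0 a).trans_lt hl)).trans (le_addPiece_ld h0 a)
      | counted =>
        refine ⟨hp'.1, fun a ha hl => ?_⟩
        exact (hp'.2 a ha ((le_addPiece_ld h0 a).trans_lt hl)).trans (le_addPiece_ld h0 a) }

/-- Case 5, as seen by the evicted color. -/
def evInt (X : Finset ℕ) (V : ColorView) : ColorView :=
  { V.cut.sat (V.act X) True with sg := fun _ => 0 }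

/-- Case 6 with a nonempty frozen block, as seen by the evicted color. -/
def evFrz (X : Finset ℕ) (V : ColorView) : ColorView :=
  { V.cut.sat (V.frz X) False with sg := fun _ => 0, en := 0 }

theorem Inv.evInt (hv : V.Inv X k K) (hint : V.Int X) : (V.evInt X).Inv X k K := by
  have hfrz := hv.int_frz hint
  refine (hv.cut.sat (A := V.act X) act_subset_B ?_ ?_ (fun _ => subset_rfl) trivial).withCosts
    (fun _ => le_rfl) hv.en_nonneg
  · intro i hi hs
    exact hv.int_frac hint ⟨i, act_subset_B hi, hs⟩
  · change V.frz X ⊆ _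
    rw [hfrz]
    exact Finset.empty_subset _

theorem Inv.evFrz (hv : V.Inv X k K) (hne : (V.frz X).Nonempty) : (V.evFrz X).Inv X k K := by
  refine (hv.cut.sat (A := V.frz X) (fun i hi => mem_B_iff.2 (Or.inr hi)) ?_ subset_rfl ?_
    trivial).withCosts (fun _ => le_rfl) le_rfl
  · intro i hi hs
    have := (mem_frz.1 hi).2.2.2
    change V.st i = _ at hs
    rw [hs] at this
    cases this
  · intro hi
    have := hv.int_frz hi
    simp [this] at hne

theorem GInv.evInt {g : Ghost} (h : V.GInv k K X Bt g) (hv : V.Inv X k K) (hK : 0 < K)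
    (hint : V.Int X) : (V.evInt X).GInv k K X Bt { g with phase := .clean, F := ∅ } := by
  have hfrz := hv.int_frz hint
  have hB : (V.evInt X).B X = ∅ := by
    refine Finset.eq_empty_of_forall_notMem (fun i hi => ?_)
    have hi : i ∈ (V.cut.sat (V.act X) True).B X := hi
    rw [mem_B_sat hv.cut] at hi
    change i ∈ V.B X ∧ _ at hi
    rw [mem_B_iff, hfrz] at hi
    simp at hi
  refine (h.cut hv).clean hK (hv.evInt hint) rfl (fun _ => rfl) ?_ (fun _ => hB) ?_
  · intro i hi i' hi' hii ht _
    by_contra hlt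
    have : i ∈ (V.evInt X).B X := mem_B.2 ⟨hi, hii.trans ht, not_le.1 hlt⟩
    simp [hB] at this
  · intro i hi
    have := act_subset_B hi
    simp [hB] at this

/-- Case 6 satisfies the frozen items ahead of the active ones. The reset makes all x̂ vanish, but
the order is violated by the active block; so the phase becomes `live` with this block as reference
set and ξ = 0. -/
theorem GInv.evFrz {g : Ghost} (h : V.GInv k K X Bt g) (hv : V.Inv X k K) (hK : 0 < K)
    (hne : (V.frz X).Nonempty) (hK10 : K / 10 ≤ (V.act X).card) :
    (V.evFrz X).GInv k K X Bt { g with phase := .live, F := V.act X, ξ := 0 } := by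
  have hint : ¬ V.Int X := fun hi => by simp [hv.int_frz hi] at hne
  have hv' := hv.evFrz hne
  have hB : ∀ i, i ∈ (V.evFrz X).B X → i ∈ V.act X := by
    intro i hi
    have hi : i ∈ (V.cut.sat (V.frz X) False).B X := hi
    rw [mem_B_sat hv.cut] at hi
    change i ∈ V.B X ∧ _ at hi
    exact (mem_B_iff.1 hi.1).resolve_right hi.2
  have hld : ∀ i ∈ V.act X, (V.evFrz X).ld i = V.ld i := fun i hi =>
    if_neg (notMem_frz_of_act hi)
  have hW : (V.evFrz X).W = V.W := W_cut
  have hcard : ((V.act X).card : ℝ) ≤ 11 / 100 * K := by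
    by_cases hn : (V.act X).Nonempty
    · exact hv.act_le (frac_of_nonempty hint hn)
    · rw [Finset.not_nonempty_iff_eq_empty.1 hn]
      simp
      positivity
  exact {
    F_mem := fun a ha => ⟨(mem_act.1 ha).1, (mem_act.1 ha).2.1, frac_of_act hint ha⟩
    F_card := hcard
    pf := fun i hi i' hi' h1 h2 _ h4 => hB i (mem_B.2 ⟨hi, h1.trans h2, h4⟩)
    bf := fun _ => hB
    beta_le := by
      rw [hW]
      exact h.beta_le
    hold_le := by
      refine (hold_mono (V := V) hK ?_ ?_).trans h.hold_le
      · intro i hi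
        rcases Finset.mem_union.1 hi with hi | hi
        · exact Finset.mem_union_left _ (hB i (act_subset_B hi))
        · exact Finset.mem_union_left _ hi
      · intro i hi
        rcases Finset.mem_union.1 hi with hi | hi
        · exact hld i (hB i (act_subset_B hi))
        · exact hld i hi
    R_le := by
      have hR := h.R_le
      have := allowance_nonneg (V := V) g
      change g.R + 0 ≤ _
      dsimp only
      linarith
    x_le := fun _ b _ => by
      change xhat k 0 ≤ _
      rw [xhat_zero]
      exact add_nonneg hv'.en_nonneg (Wr_nonneg hv'.weight_nonneg)
    phase := by
      refine ⟨hK10, le_rfl, fun a _ _ => hv'.ld_nonneg a, fun _ _ b _ i _ _ => ?_⟩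
      change xhat k 0 ≤ _
      rw [xhat_zero, add_zero]
      exact hv'.ld_nonneg i }

/-- Case 6 with an empty frozen block. -/
theorem GInv.resetEnded {g : Ghost} (h : V.GInv k K X Bt g) (hv : V.Inv X k K) :
    ∃ g', ({ V with sg := fun _ => 0, en := 0 } : ColorView).GInv k K X Bt g' ∧
      g'.R = g.R ∧ g'.Cr = g.Cr ∧ g'.m = g.m := by
  have hWr := Wr_nonneg hv.weight_nonneg
  have h1 : g.R + (if g.phase = .dirty then 0 else g.allowance V) ≤ 12 * g.Cr + 2 * g.m := by
    have hR := h.R_le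
    have := allowance_nonneg (V := V) g
    split_ifs <;> linarith
  -- The allowance of `dirty` could grow when `en` drops to 0; since all x̂ are now 0, the color may
  -- count as `clean` and needs no allowance.
  refine ⟨if g.phase = .dirty then { g with phase := .clean } else g, ?_, by split_ifs <;> rfl,
    by split_ifs <;> rfl, by split_ifs <;> rfl⟩
  obtain ⟨ph, F, ξ, m, R, Cr⟩ := g
  have hx : ¬ V.Int X → ∀ b ∈ Bt, xhat k 0 ≤ 0 + V.Wr := fun _ b _ => by
    rw [xhat_zero, zero_add]
    exact hWr
  have hp := h.phase
  cases ph with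
  | clean =>
    rw [if_neg (by simp)]
    rw [if_neg (by simp)] at h1
    exact ⟨h.F_mem, h.F_card, h.pf, h.bf, h.beta_le, h.hold_le, h1, hx, hp.1,
      fun _ _ b _ => ⟨fun i _ _ => by change xhat k 0 ≤ _; rw [xhat_zero]; exact hv.ld_nonneg i,
      fun i _ _ => by
        change xhat k 0 ≤ _
        rw [xhat_zero]
        exact eff_nonneg (V := { V with sg := fun _ => 0, en := 0 }) hv.weight_nonneg b⟩⟩
  | dirty =>
    rw [if_pos rfl]
    rw [if_pos rfl] at h1
    exact ⟨h.F_mem, h.F_card, h.pf, h.bf, h.beta_le, h.hold_le, h1, hx, hp,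
      fun _ _ b _ => ⟨fun i _ _ => by change xhat k 0 ≤ _; rw [xhat_zero]; exact hv.ld_nonneg i,
      fun i _ _ => by
        change xhat k 0 ≤ _
        rw [xhat_zero]
        exact eff_nonneg (V := { V with sg := fun _ => 0, en := 0 }) hv.weight_nonneg b⟩⟩
  | live =>
    rw [if_neg (by simp)]
    rw [if_neg (by simp)] at h1
    exact ⟨h.F_mem, h.F_card, h.pf, h.bf, h.beta_le, h.hold_le, h1, hx, hp.1, hp.2.1, hp.2.2.1,
      fun _ _ b _ i _ _ => by
        change xhat k 0 ≤ V.ld i + ξ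
        rw [xhat_zero]
        exact add_nonneg (hv.ld_nonneg i) hp.2.1⟩
  | counted =>
    rw [if_neg (by simp)]
    rw [if_neg (by simp)] at h1
    exact ⟨h.F_mem, h.F_card, h.pf, h.bf, h.beta_le, h.hold_le, h1, hx, hp⟩

/-- The values held by the satisfied items of a used up reference set are cashed. -/
theorem GInv.count {g : Ghost} (h : V.GInv k K X Bt g) (hv : V.Inv X k K) (hK : 0 < K)
    (hph : g.phase = .live) (hF : ((g.F.filter (fun i => V.ld i < 1)).card : ℝ) < K / 100)
    (hW : V.W ≤ 1 / 10) : V.GInv k K X Bt { g with phase := .counted, m := g.m + 1 } := by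
  obtain ⟨ph, F, ξ, m, R, Cr⟩ := g
  simp only at hph hF
  subst hph
  have hp := h.phase
  have hR : R + 0 ≤ 12 * Cr + 2 * m := h.R_le
  have hh : V.hold K (V.act X ∪ F) ≤ 4 * Cr - m / 20 := h.hold_le
  -- More than 9/100 K items of F are satisfied, each holding 15/16, and 9/100 · 15/16 > 1/20.
  have key : V.hold K (V.act X) + 1 / 20 ≤ V.hold K (V.act X ∪ F) := by
    have hd : Disjoint (V.act X) (F.filter (fun i => ¬ V.ld i < 1)) := by
      rw [Finset.disjoint_left]
      intro i hi hi'
      exact (Finset.mem_filter.1 hi').2 (mem_act.1 hi).2.2.1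
    have h1 : ∑ i ∈ V.act X ∪ F.filter (fun i => ¬ V.ld i < 1), phi (V.ld i) ≤
        ∑ i ∈ V.act X ∪ F, phi (V.ld i) :=
      Finset.sum_le_sum_of_subset_of_nonneg
        (Finset.union_subset_union_right (Finset.filter_subset _ _)) (fun _ _ _ => phi_nonneg _)
    rw [Finset.sum_union hd] at h1
    have h2 : ∑ i ∈ F.filter (fun i => ¬ V.ld i < 1), phi (V.ld i) =
        ((F.filter (fun i => ¬ V.ld i < 1)).card : ℝ) * (15 / 16) := by
      rw [← nsmul_eq_mul, ← Finset.sum_const]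
      refine Finset.sum_congr rfl (fun i hi => ?_)
      have := not_lt.1 (Finset.mem_filter.1 hi).2
      rw [le_antisymm (hv.ld_le i) this, phi_one]
    have h3 : ((F.filter (fun i => V.ld i < 1)).card : ℝ) +
        ((F.filter (fun i => ¬ V.ld i < 1)).card : ℝ) = F.card := by
      exact_mod_cast Finset.card_filter_add_card_filter_not (s := F) (fun i => V.ld i < 1)
    have h4 : K / 10 ≤ (F.card : ℝ) := hp.1
    unfold hold
    rw [div_add' _ _ _ hK.ne']
    gcongr
    linarith
  have h0 := hold_nonneg (V := V) hK (V.act X)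
  have e : V.act X ∪ (⟨.counted, F, ξ, m + 1, R, Cr⟩ : Ghost).held = V.act X := by
    simp [Ghost.held]
  exact {
    F_mem := h.F_mem
    F_card := h.F_card
    pf := h.pf
    bf := h.bf
    beta_le := by
      rw [beta_eq_zero hW]
      dsimp only
      linarith
    hold_le := by
      rw [e]
      dsimp only
      linarith
    R_le := by
      change R + (max 0 (1 - ξ) + 1 / 5) ≤ 12 * Cr + 2 * (m + 1)
      -- One more unit of m is worth 2 on the right, while the new allowance is at most 6/5.
      have : max 0 (1 - ξ) ≤ 1 := max_le (by norm_num) (by linarith [hp.2.1])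
      linarith
    x_le := h.x_le
    phase := ⟨hp.2.1, hp.2.2.1⟩ }

/-- Once all of F is satisfied, the order of satisfaction is restored without F, and at most 1/5 of
the allowance is still needed. -/
theorem GInv.clear {g : Ghost} (h : V.GInv k K X Bt g) (hv : V.Inv X k K)
    (hph : g.phase = .counted) (hF : ∀ a ∈ g.F, ¬ V.ld a < 1) :
    V.GInv k K X Bt { g with phase := .dirty, F := ∅ } := by
  obtain ⟨ph, F, ξ, m, R, Cr⟩ := g
  simp only at hph hF
  subst hph
  have hR : R + (max 0 (1 - ξ) + 1 / 5) ≤ 12 * Cr + 2 * m := h.R_le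
  have hFc : (F.card : ℝ) ≤ 11 / 100 * K := h.F_card
  exact {
    F_mem := by simp
    F_card := by
      have : (0 : ℝ) ≤ F.card := Nat.cast_nonneg _
      simp only [Finset.card_empty, Nat.cast_zero]
      linarith
    pf := fun i hi i' hi' h1 h2 h3 h4 => absurd h4 (hF i (h.pf i hi i' hi' h1 h2 h3 h4))
    bf := fun hb i hi => absurd (mem_B.1 hi).2.2 (hF i (h.bf hb hi))
    beta_le := h.beta_le
    hold_le := h.hold_le
    R_le := by
      change R + max 0 (1 / 5 - (V.en + V.Wr)) ≤ 12 * Cr + 2 * m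
      have h1 : max 0 (1 / 5 - (V.en + V.Wr)) ≤ 1 / 5 :=
        max_le (by norm_num) (by linarith [hv.en_nonneg, Wr_nonneg hv.weight_nonneg])
      have h2 := le_max_left 0 (1 - ξ)
      linarith
    x_le := h.x_le
    phase := rfl }

end ColorView

end

end RBM

/-! ### One color: regular execution -/

namespace RBM

noncomputable section

open scoped Classical

namespace ColorView

variable {X : Finset ℕ} {V : ColorView} {k : ℕ} {K : ℝ} {Bt : Set Batch}

/-- The reference set is renewed where it is used up. -/
theorem GInv.normalize {g : Ghost} (h : V.GInv k K X Bt g) (hv : V.Inv X k K) (hK : 0 < K) :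
    ∃ g', V.GInv k K X Bt g' ∧ g'.R = g.R ∧ g'.Cr = g.Cr ∧
      (V.W ≤ 1 / 10 → g'.phase = .live →
        K / 100 ≤ ((g'.F.filter (fun i => V.ld i < 1)).card : ℝ)) ∧
      (g'.phase = .counted → ∃ a ∈ g'.F, V.ld a < 1) := by
  have clear : ∀ g : Ghost, V.GInv k K X Bt g → g.phase = .counted →
      ∃ g', V.GInv k K X Bt g' ∧ g'.R = g.R ∧ g'.Cr = g.Cr ∧
      (V.W ≤ 1 / 10 → g'.phase = .live →
        K / 100 ≤ ((g'.F.filter (fun i => V.ld i < 1)).card : ℝ)) ∧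
      (g'.phase = .counted → ∃ a ∈ g'.F, V.ld a < 1) := by
    intro g h hph
    by_cases hF : ∃ a ∈ g.F, V.ld a < 1
    · exact ⟨g, h, rfl, rfl, fun _ hl => by simp [hph] at hl, fun _ => hF⟩
    · push Not at hF
      exact ⟨_, h.clear hv hph (fun a ha => not_lt.2 (hF a ha)), rfl, rfl,
        fun _ hl => by simp at hl, fun hl => by simp at hl⟩
  by_cases hlive : V.W ≤ 1 / 10 ∧ g.phase = .live ∧
      ((g.F.filter (fun i => V.ld i < 1)).card : ℝ) < K / 100
  · have := clear _ (h.count hv hK hlive.2.1 hlive.2.2 hlive.1) rfl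
    exact this
  · by_cases hph : g.phase = .counted
    · exact clear g h hph
    · refine ⟨g, h, rfl, rfl, fun hW hl => ?_, fun hc => absurd hc hph⟩
      by_contra hn
      exact hlive ⟨hW, hl, not_le.1 hn⟩

theorem eff_addPiece {p : Piece} (hfrz : (V.addPiece p).frz X = V.frz X) (b : Batch) :
    (V.addPiece p).eff X b = V.eff X b + if V.Catches X b p then p.weight else 0 := by
  have hc : ∀ q, (V.addPiece p).Catches X b q ↔ V.Catches X b q := by
    intro q
    unfold Catches
    rw [hfrz]
    rfl
  unfold eff
  simp only [hc]
  change (Multiset.map _ (Multiset.filter _ (V.op + {p}))).sum = _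
  rw [Multiset.filter_add, Multiset.map_add, Multiset.sum_add, Multiset.filter_singleton]
  split_ifs <;> simp

/-- The credit that a fractional color gets from the dual cost during regular execution for time
`δ`. -/
def credit (V : ColorView) (X : Finset ℕ) (L δ w : ℝ) : ℝ :=
  δ * ((V.act X).card / L + ∑ i ∈ V.act X, (V.ld i + w))

set_option maxHeartbeats 800000 in
-- The weight is compared with the credit phase by phase. Hypothesis `hw` is the rate bound, with x̂
-- taken at the end of the time interval; `hx` and `hJ` say that x̂ grows by at most the new weight,
-- and only for batches matching an active item before slot t.
theorem GInv.regular {g : Ghost} (h₀ : V.GInv k K X Bt g) (hv : V.Inv X k K) (hK : 0 < K)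
    {L δ : ℝ} (hL : 2 ≤ L) (hδ : 0 < δ) {p : Piece} (hp : p.items = V.act X)
    (hps : p.start = V.t) (h0 : 0 ≤ p.weight) (hreg : p.regular) (hint : ¬ V.Int X)
    (hne : (V.act X).Nonempty) (hfull : ¬ K / 100 < (V.frz X).card) (hen : V.en < 1 / 10)
    (hW1 : V.W + p.weight ≤ 1)
    (hl : ∀ i ∈ V.act X, V.ld i + p.weight ≤ 1) (hBt : ∀ b ∈ Bt, b.1 ⊆ X) {sg : Batch → ℝ}
    (hx : ∀ b ∈ Bt, xhat k (sg b) ≤ xhat k (V.sg b) + p.weight)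
    (hJ : ∀ b ∈ Bt, (∀ i ∈ b.1, i ∈ V.act X → ¬ slotOf b i < V.t) →
      xhat k (sg b) ≤ xhat k (V.sg b))
    (hw : ∀ D, 0 ≤ D → (∀ b ∈ Bt, ∀ J ⊆ V.act X, (∀ i ∈ J, i ∈ b.1) →
      J.card * (1 / L + xhat k (sg b)) ≤ D) → p.weight ≤ δ * D) :
    ∃ g', ({ V.addPiece p with sg := sg } : ColorView).GInv k K X Bt g' ∧
      g'.R = g.R + p.weight ∧ g'.Cr = g.Cr + V.credit X L δ p.weight := by
  obtain ⟨g, h, hgR, hgC, hlive, hcnt⟩ := h₀.normalize hv hK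
  rw [← hgR, ← hgC]
  clear h₀ hgR hgC
  have hfrac := frac_of_nonempty hint hne
  have hWr := Wr_le_W hv.weight_nonneg
  have hWr0 := Wr_nonneg hv.weight_nonneg
  have hfrz : (V.addPiece p).frz X = V.frz X := frz_addPiece hp
  have hWr' : (V.addPiece p).Wr = V.Wr + p.weight := by
    unfold Wr addPiece
    rw [Multiset.filter_add]
    simp [Multiset.filter_singleton, hreg]
  have hxle := h.x_le hint
  have hcard := hv.act_le hfrac
  have hact0 : (0 : ℝ) ≤ (V.act X).card := Nat.cast_nonneg _
  have hL1 : 1 / L ≤ 1 / 2 := by gcongr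
  have hL0 : 0 < 1 / L := by positivity
  have hsum0 : 0 ≤ ∑ i ∈ V.act X, (V.ld i + p.weight) :=
    Finset.sum_nonneg (fun i _ => add_nonneg (hv.ld_nonneg i) h0)
  set cr := V.credit X L δ p.weight with hcr
  have hcr' : cr = δ * ((V.act X).card / L + ∑ i ∈ V.act X, (V.ld i + p.weight)) := rfl
  have hcr0 : δ * ∑ i ∈ V.act X, (V.ld i + p.weight) ≤ cr := by
    rw [hcr']
    gcongr
    have : 0 ≤ ((V.act X).card : ℝ) / L := by positivity
    linarith
  have hcr00 : 0 ≤ cr := le_trans (by positivity) hcr0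
  -- a bound for the scheduled weight from a bound on the pseudo-primal variables
  have good : ∀ C : ℝ, 1 ≤ C → ∀ D : ℕ → ℝ, (∀ i ∈ V.act X, 0 ≤ D i) →
      (∑ i ∈ V.act X, D i ≤ C * ∑ i ∈ V.act X, (V.ld i + p.weight)) →
      (∀ b ∈ Bt, ∀ i ∈ b.1, i ∈ V.act X → xhat k (sg b) ≤ D i) → p.weight ≤ C * cr := by
    intro C hC D hD0 hDs hD
    have := hw (C * ((V.act X).card / L + ∑ i ∈ V.act X, (V.ld i + p.weight)))
      (by positivity) ?_
    · rw [hcr']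
      linarith
    · intro b hb J hJs hJb
      have h1 : (J.card : ℝ) * (1 / L + xhat k (sg b)) ≤ ∑ i ∈ J, (1 / L + D i) := by
        rw [← nsmul_eq_mul, ← Finset.sum_const]
        refine Finset.sum_le_sum (fun i hi => ?_)
        linarith [hD b hb i (hJb i hi) (hJs hi)]
      have h2 : ∑ i ∈ J, (1 / L + D i) ≤ ∑ i ∈ V.act X, (1 / L + D i) :=
        Finset.sum_le_sum_of_subset_of_nonneg hJs
          (fun i hi _ => add_nonneg hL0.le (hD0 i hi))
      rw [Finset.sum_add_distrib (s := V.act X), Finset.sum_const, nsmul_eq_mul] at h2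
      have h3 : 0 ≤ ((V.act X).card : ℝ) * (1 / L) := by positivity
      have h4 : ((V.act X).card : ℝ) / L = (V.act X).card * (1 / L) := by ring
      rw [h4]
      nlinarith
  have hact_ld : ∀ i ∈ V.act X, V.W ≤ V.ld i := fun i hi =>
    hv.W_le i (act_subset_B hi) (frac_of_act hint hi)
  -- x̂ ends at most at 1/10 + 1 and 1/L ≤ 1/2, which gives 11/100 · 16/10 for at most 11/100 K
  -- items. This keeps the increments of `phi` proportional to the credit.
  have hwK : p.weight ≤ 176 / 1000 * K * δ := by
    have := hw ((V.act X).card * (1 / L + 11 / 10)) (by positivity) (fun b hb J hJs _ => by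
      have h1 : (J.card : ℝ) ≤ (V.act X).card := by exact_mod_cast Finset.card_le_card hJs
      have h2 : xhat k (sg b) ≤ 11 / 10 := by linarith [hx b hb, hxle b hb]
      calc (J.card : ℝ) * (1 / L + xhat k (sg b)) ≤ J.card * (1 / L + 11 / 10) := by gcongr
        _ ≤ _ := by gcongr)
    have h1 : ((V.act X).card : ℝ) * (1 / L + 11 / 10) ≤ 11 / 100 * K * (16 / 10) := by
      gcongr
      linarith
    have h2 := mul_le_mul_of_nonneg_left h1 hδ.le
    nlinarith
  -- The new x̂ is below 1/10 + W + w ≤ 2(W + w), and every active item has load at least W.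
  have hbig : 1 / 10 ≤ V.W + p.weight → p.weight ≤ 2 * cr := by
    intro hbig
    refine good 2 (by norm_num) (fun i => 2 * (V.ld i + p.weight)) ?_ ?_ ?_
    · intro i _
      have := hv.ld_nonneg i
      positivity
    · rw [Finset.mul_sum]
    · intro b hb i _ hia
      linarith [hx b hb, hxle b hb, hact_ld i hia]
  have hF : ∀ a ∈ g.F, V.ld a < 1 → a ∈ V.act X := by
    intro a ha hla
    obtain ⟨h1, h2, h3⟩ := h.F_mem a ha
    exact mem_act.2 ⟨h1, h2, hla, by simp [h3]⟩
  have hld : ∀ i, (V.addPiece p).ld i = if i ∈ V.act X then V.ld i + p.weight else V.ld i :=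
    addPiece_ld hp
  have hbeta := h.beta_le
  have hhold := h.hold_le
  have hR := h.R_le
  have hb0 := beta_nonneg V.W
  have hWp := W_addPiece (V := V) p
  -- The unsatisfied items of F are active, so their loads rise along with ξ. In the phases `clean`
  -- and `dirty` the value of ξ does not matter.
  refine ⟨{ g with ξ := g.ξ + p.weight, R := g.R + p.weight, Cr := g.Cr + cr }, ?_, rfl, rfl⟩
  exact {
    F_mem := h.F_mem
    F_card := h.F_card
    pf := pf_addPiece hv hp h0 h.pf
    bf := fun hb => (B_addPiece h0).trans (h.bf hb)
    beta_le := by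
      change beta (V.addPiece p).W ≤ 4 * (g.Cr + cr) - g.m / 20
      rw [hWp]
      by_cases hb : 1 / 10 ≤ V.W + p.weight
      · have := hbig hb
        have := beta_add_le (x := V.W) h0
        linarith
      · rw [beta_eq_zero (by linarith)]
        linarith
    hold_le := by
      -- The increment is at most 2w times the sum of the new active loads, divided by K; one factor
      -- w is bounded by `hwK`, and the sum times δ by the credit.
      have := hold_addPiece hv hK hp h0 (F := g.held) (D := 352 / 1000 * cr) ?_
      · change (V.addPiece p).hold K ((V.addPiece p).act X ∪ g.held) ≤ 4 * (g.Cr + cr) - g.m / 20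
        linarith
      · rw [← Finset.mul_sum]
        calc 2 * p.weight * ∑ i ∈ V.act X, (V.ld i + p.weight) ≤
            2 * (176 / 1000 * K * δ) * ∑ i ∈ V.act X, (V.ld i + p.weight) := by gcongr
          _ = 352 / 1000 * K * (δ * ∑ i ∈ V.act X, (V.ld i + p.weight)) := by ring
          _ ≤ 352 / 1000 * K * cr := by gcongr
          _ = _ := by ring
    R_le := by
      obtain ⟨ph, F, ξ, m, R, Cr⟩ := g
      cases ph with
      | clean =>
        change R + p.weight + 0 ≤ 12 * (Cr + cr) + 2 * m
        have hR : R + 0 ≤ 12 * Cr + 2 * m := hR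
        have : p.weight ≤ 1 * cr := by
          refine good 1 le_rfl (fun i => V.ld i + p.weight) ?_ ?_ ?_
          · exact fun i _ => add_nonneg (hv.ld_nonneg i) h0
          · rw [one_mul]
          · intro b hb i hib hia
            linarith [hx b hb, (h.phase.2 hint hfull b hb).1 i hib hia]
        linarith
      | dirty =>
        change R + p.weight + max 0 (1 / 5 - (V.en + (V.addPiece p).Wr)) ≤ 12 * (Cr + cr) + 2 * m
        rw [hWr']
        have hR : R + max 0 (1 / 5 - (V.en + V.Wr)) ≤ 12 * Cr + 2 * m := hR
        by_cases hb : 1 / 10 ≤ V.W + p.weight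
        · have := hbig hb
          have : max 0 (1 / 5 - (V.en + (V.Wr + p.weight))) ≤ max 0 (1 / 5 - (V.en + V.Wr)) :=
            max_le_max le_rfl (by linarith)
          linarith
        -- Both the ended and the open regular weight are below 1/10, so the maximum is not 0 and
        -- the allowance shrinks by exactly the new weight.
        · rw [max_eq_right (by linarith)] at hR
          rw [max_eq_right (by linarith)]
          linarith
      | live =>
        change R + p.weight + 0 ≤ 12 * (Cr + cr) + 2 * m
        have hR : R + 0 ≤ 12 * Cr + 2 * m := hR
        by_cases hb : 1 / 10 ≤ V.W + p.weight
        · have := hbig hb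
          linarith
        · have hcF := hlive (by linarith) rfl
          simp only at hcF
          obtain ⟨-, hξ, hFξ, hxb⟩ := h.phase
          have hsub : F.filter (fun i => V.ld i < 1) ⊆ V.act X := fun a ha =>
            hF a (Finset.mem_filter.1 ha).1 (Finset.mem_filter.1 ha).2
          -- At least K/100 items of F are unsatisfied, hence active, and each has load at least ξ.
          have h1 : K / 100 * (ξ + p.weight) ≤ ∑ i ∈ V.act X, (V.ld i + p.weight) := by
            calc K / 100 * (ξ + p.weight) ≤
                ((F.filter (fun i => V.ld i < 1)).card : ℝ) * (ξ + p.weight) := by gcongr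
              _ = ∑ i ∈ F.filter (fun i => V.ld i < 1), (ξ + p.weight) := by
                rw [Finset.sum_const, nsmul_eq_mul]
              _ ≤ ∑ i ∈ F.filter (fun i => V.ld i < 1), (V.ld i + p.weight) := by
                refine Finset.sum_le_sum (fun i hi => ?_)
                rw [Finset.mem_filter] at hi
                linarith [hFξ i hi.1 hi.2]
              _ ≤ _ := Finset.sum_le_sum_of_subset_of_nonneg hsub
                (fun i _ _ => add_nonneg (hv.ld_nonneg i) h0)
          -- 12 = 1 + 11: the loads count once, and 11/100 K copies of ξ + w cost at most 11 times
          -- the sum of the loads.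
          have : p.weight ≤ 12 * cr := by
            refine good 12 (by norm_num) (fun i => (V.ld i + p.weight) + (ξ + p.weight)) ?_ ?_ ?_
            · intro i _
              have := hv.ld_nonneg i
              linarith
            · rw [Finset.sum_add_distrib, Finset.sum_const, nsmul_eq_mul]
              have : ((V.act X).card : ℝ) * (ξ + p.weight) ≤ 11 / 100 * K * (ξ + p.weight) := by
                gcongr
              linarith
            · intro b hb i hib hia
              linarith [hx b hb, hxb hint hfull b hb i hib (Or.inl (act_subset_B hia))]
          linarith
      | counted =>
        change R + p.weight + (max 0 (1 - (ξ + p.weight)) + 1 / 5) ≤ 12 * (Cr + cr) + 2 * m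
        have hR : R + (max 0 (1 - ξ) + 1 / 5) ≤ 12 * Cr + 2 * m := hR
        -- An unsatisfied a in F has load at least ξ, and its new load is at most 1; so ξ + w ≤ 1
        -- and the allowance pays for w in full.
        obtain ⟨a, ha, hla⟩ := hcnt rfl
        have := h.phase.2 a ha hla
        have := hl a (hF a ha hla)
        rw [max_eq_right (by linarith)] at hR ⊢
        linarith
    x_le := by
      intro _ b hb
      change xhat k (sg b) ≤ V.en + (V.addPiece p).Wr
      rw [hWr']
      linarith [hx b hb, hxle b hb]
    phase := by
      obtain ⟨ph, F, ξ, m, R, Cr⟩ := g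
      cases ph with
      | clean =>
        obtain ⟨hF0, hp2⟩ : F = ∅ ∧ _ := h.phase
        refine ⟨hF0, fun _ _ b hbt => ⟨fun i hib ha => ?_, fun i hib ha => ?_⟩⟩
        · have ha := act_addPiece (V := V) h0 ha
          have h1 := (hp2 hint hfull b hbt).1 i hib ha
          change xhat k (sg b) ≤ (V.addPiece p).ld i
          rw [hld, if_pos ha]
          linarith [hx b hbt]
        · have ha' : i ∈ V.frz X ∨ V.t ≤ i := by
            rw [← hfrz]
            exact ha
          have h2 := (hp2 hint hfull b hbt).2 i hib ha'
          change xhat k (sg b) ≤ (V.addPiece p).eff X b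
          rw [eff_addPiece hfrz]
          by_cases hJe : ∀ i ∈ b.1, i ∈ V.act X → ¬ slotOf b i < V.t
          · have h3 := hJ b hbt hJe
            split_ifs <;> linarith
          · push Not at hJe
            -- The batch matches an active item a before slot t, so the new piece catches it: an
            -- arrived item of the batch that is neither active nor frozen is satisfied and hence
            -- precedes a.
            obtain ⟨a, hab, haa, hat⟩ := hJe
            rw [if_pos]
            · linarith [hx b hbt]
            · unfold Catches
              rw [hps, hp]
              refine lt_of_le_of_lt (Nat.add_le_add_left (Finset.card_le_card ?_) _) hat
              intro x hxm
              rw [Finset.mem_filter] at hxm ⊢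
              refine ⟨hxm.1, ?_⟩
              by_contra hax
              have hxa : x ≠ a := fun he => hxm.2.2.1 (he ▸ haa)
              have h1 : 1 ≤ V.ld x := by
                by_contra hlt
                have hxB : x ∈ V.B X := mem_B.2 ⟨hBt b hbt hxm.1, hxm.2.1, not_le.1 hlt⟩
                exact (mem_B_iff.1 hxB).elim hxm.2.2.1 hxm.2.2.2
              have := h.pf a (hBt b hbt hab) x (hBt b hbt hxm.1) (by omega) hxm.2.1 h1
                (mem_act.1 haa).2.2.1
              simp [hF0] at this
      | dirty => exact h.phase
      | live =>
        obtain ⟨h1, hξ, hFξ, hxb⟩ := h.phase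
        refine ⟨h1, ?_, fun a ha hla => ?_, fun _ _ b hbt i hib ha => ?_⟩
        · change 0 ≤ ξ + p.weight
          linarith
        · have hla' := (le_addPiece_ld h0 a).trans_lt hla
          change ξ + p.weight ≤ (V.addPiece p).ld a
          rw [hld, if_pos (hF a ha hla')]
          linarith [hFξ a ha hla']
        · have := hxb hint hfull b hbt i hib (ha.imp (fun hb => B_addPiece h0 hb) id)
          have h3 : V.ld i ≤ (V.addPiece p).ld i := le_addPiece_ld h0 i
          change xhat k (sg b) ≤ (V.addPiece p).ld i + (ξ + p.weight)
          dsimp only at this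
          linarith [hx b hbt]
      | counted =>
        obtain ⟨hξ, hFξ⟩ := h.phase
        refine ⟨?_, fun a ha hla => ?_⟩
        · change 0 ≤ ξ + p.weight
          linarith
        · have hla' := (le_addPiece_ld h0 a).trans_lt hla
          change ξ + p.weight ≤ (V.addPiece p).ld a
          rw [hld, if_pos (hF a ha hla')]
          linarith [hFξ a ha hla'] }

end ColorView

end

end RBM

/-! ### The ledger of one color -/

namespace RBM

noncomputable section

open scoped Classical

namespace ColorView

/-- The history of a color together with the weight `fl` scheduled in Case 3 and the numbers `n5`,
`n6` of its weight-1 batches from Cases 5 and 6. -/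
structure Ledger where
  g : Ghost
  fl : ℝ
  n5 : ℝ
  n6 : ℝ

/-- A bound on the weight that has been scheduled on account of the color. -/
def Ledger.cost (l : Ledger) : ℝ := l.g.R + l.fl + 2 * l.n5 + 2 * l.n6

/-- The credit from regular execution. -/
def Ledger.credit (l : Ledger) : ℝ := l.g.Cr - l.fl

def Ledger.Moves (l l' : Ledger) (dc dr d5 : ℝ) : Prop :=
  l'.cost = l.cost + dc ∧ l'.credit = l.credit + dr ∧ l'.n5 = l.n5 + d5

theorem Ledger.moves_zero {l l' : Ledger} (hR : l'.g.R = l.g.R) (hC : l'.g.Cr = l.g.Cr)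
    (hfl : l'.fl = l.fl) (h5 : l'.n5 = l.n5) (h6 : l'.n6 = l.n6) : l.Moves l' 0 0 0 := by
  simp [Moves, cost, credit, *]

/-- All invariants of one color. -/
structure ColorInv (k : ℕ) (K : ℝ) (X : Finset ℕ) (Bt : Set Batch) (V : ColorView) (l : Ledger) :
    Prop where
  inv : V.Inv X k K
  ginv : V.GInv k K X Bt l.g
  -- Each eviction counted by `n6` has used up regular weight 1/10 from `en`.
  n6_le : V.en + V.Wr + l.n6 / 10 ≤ l.g.R
  -- Runs of Case 3 and applications of Case 5 alternate: after a run the color is integral, and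
  -- only Case 5 ends this.
  fl_le : ¬ V.Int X → ¬ K / 100 < (V.frz X).card → l.fl ≤ l.n5
  fl_le_add_one : l.fl ≤ l.n5 + 1
  -- Within a run all the weight goes to every item that is still active, whose load stays at most
  -- 1; so a whole run schedules at most 1.
  fl_full : K / 100 < (V.frz X).card → ∀ i ∈ V.act X, l.fl ≤ l.n5 + V.ld i
  fl_first : V.t = k + 1 → l.fl = 0

variable {X : Finset ℕ} {V : ColorView} {k : ℕ} {K : ℝ} {Bt : Set Batch} {l : Ledger}

theorem ColorInv.of_le (inv : V.Inv X k K) (ginv : V.GInv k K X Bt l.g)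
    (n6_le : V.en + V.Wr + l.n6 / 10 ≤ l.g.R) (hle : l.fl ≤ l.n5)
    (fl_first : V.t = k + 1 → l.fl = 0) : V.ColorInv k K X Bt l where
  inv := inv
  ginv := ginv
  n6_le := n6_le
  fl_le := fun _ _ => hle
  fl_le_add_one := by linarith
  fl_full := fun _ i _ => by linarith [inv.ld_nonneg i]
  fl_first := fl_first

/-- The weight scheduled by regular execution is at most a constant times the credit. -/
theorem ColorInv.R_le (h : V.ColorInv k K X Bt l) (hK : 0 < K) :
    l.g.R ≤ 172 * (l.credit + l.fl) := by
  have h1 := h.ginv.R_le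
  have h2 := allowance_nonneg (V := V) l.g
  -- Since held values are nonnegative, m ≤ 80 Cr, and 172 = 12 + 2 · 80.
  have h3 := h.ginv.hold_le
  have h4 := hold_nonneg (V := V) hK (V.act X ∪ l.g.held)
  unfold Ledger.credit
  linarith

/-- From n6 ≤ 10 R the cost is at most 21 R + fl + 2 n5, and 3612 = 21 · 172. -/
theorem ColorInv.cost_le (h : V.ColorInv k K X Bt l) (hK : 0 < K) :
    l.cost ≤ 3612 * l.credit + 3613 * l.fl + 2 * l.n5 := by
  have h1 := h.R_le hK
  have h2 := h.n6_le
  have h3 := h.inv.en_nonneg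
  have h4 := Wr_nonneg h.inv.weight_nonneg
  unfold Ledger.cost
  linarith

theorem full_nonempty {A : Finset ℕ} (hK : 0 < K) (h : K / 100 < A.card) : A.Nonempty := by
  rw [Finset.nonempty_iff_ne_empty]
  rintro rfl
  rw [Finset.card_empty, Nat.cast_zero] at h
  linarith

theorem Inv.not_int_of_full (h : V.Inv X k K) (hK : 0 < K) (hf : K / 100 < (V.frz X).card) :
    ¬ V.Int X := by
  intro hi
  have := full_nonempty hK hf
  simp [h.int_frz hi] at this

theorem ColorInv.mkInt (h : V.ColorInv k K X Bt l) (hK : 0 < K)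
    (hfull : K / 100 < (V.frz X).card) (hact : V.act X = ∅) :
    ∃ l', (V.mkInt X).ColorInv k K X Bt l' ∧ l.Moves l' 0 0 0 := by
  have hv' := h.inv.mkInt hfull hact
  have hi : (V.mkInt X).Int X := by
    obtain ⟨i, hi⟩ := full_nonempty hK hfull
    exact ⟨i, show i ∈ V.B X from mem_B_iff.2 (Or.inr hi), if_pos hi⟩
  refine ⟨{ l with g := { l.g with phase := .clean, F := ∅ } },
    { inv := hv'
      ginv := h.ginv.mkInt h.inv hK hfull hact
      n6_le := h.n6_le
      fl_le := fun hn => absurd hi hn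
      fl_le_add_one := h.fl_le_add_one
      fl_full := fun hf => absurd hi (hv'.not_int_of_full hK hf)
      fl_first := h.fl_first }, Ledger.moves_zero rfl rfl rfl rfl rfl⟩

theorem ColorInv.repl (h : V.ColorInv k K X Bt l) (hK : 0 < K)
    (hint : ¬ V.Int X) (hlt : ((V.act X).card : ℝ) < K / 10)
    (hnf : ((V.frz X).card : ℝ) ≤ K / 100) (hne : (V.frz X).Nonempty) (hW : V.W ≤ 1) :
    ∃ l', (V.repl X).ColorInv k K X Bt l' ∧ l.Moves l' 0 0 0 := by
  refine ⟨l, .of_le (h.inv.repl hint hlt hnf hW) (h.ginv.repl h.inv hK hint hlt hnf hne hW) ?_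
    (h.fl_le hint (not_lt.2 hnf)) h.fl_first, Ledger.moves_zero rfl rfl rfl rfl rfl⟩
  rw [Wr_repl]
  exact h.n6_le

theorem ColorInv.close (h : V.ColorInv k K X Bt l)
    (hset : ¬ V.Int X → (V.frz X).Nonempty → ¬ K / 100 < (V.frz X).card →
      K / 10 ≤ (V.act X).card)
    (hBt : ∀ b ∈ Bt, ∀ i ∈ b.1, i < slotOf b i) :
    ∃ l', V.close.ColorInv k K X Bt l' ∧ l.Moves l' 0 0 0 := by
  obtain ⟨g', hg', hR, hC, hm⟩ := h.ginv.close h.inv hset hBt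
  refine ⟨{ l with g := g' }, ⟨h.inv.close, hg', ?_, h.fl_le, h.fl_le_add_one, h.fl_full,
    h.fl_first⟩, Ledger.moves_zero hR hC rfl rfl rfl⟩
  rw [en_close]
  dsimp only
  rw [hR]
  exact h.n6_le

theorem ColorInv.unblock (h : V.ColorInv k K X Bt l) :
    ∃ l', V.unblock.ColorInv k K X Bt l' ∧ l.Moves l' 0 0 0 :=
  ⟨l, ⟨h.inv.unblock, h.ginv.unblock, h.n6_le, h.fl_le, h.fl_le_add_one, h.fl_full, h.fl_first⟩,
    Ledger.moves_zero rfl rfl rfl rfl rfl⟩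

theorem ColorInv.cut (h : V.ColorInv k K X Bt l) :
    ∃ l', V.cut.ColorInv k K X Bt l' ∧ l.Moves l' 0 0 0 := by
  refine ⟨l, ⟨h.inv.cut, h.ginv.cut h.inv, ?_, h.fl_le, h.fl_le_add_one, h.fl_full, h.fl_first⟩,
    Ledger.moves_zero rfl rfl rfl rfl rfl⟩
  rw [Wr_cut]
  exact h.n6_le

theorem ColorInv.withCosts (h : V.ColorInv k K X Bt l) {sg : Batch → ℝ} (h0 : ∀ b, 0 ≤ sg b)
    (hs : ¬ V.Int X → ∀ b ∈ Bt, xhat k (sg b) ≤ xhat k (V.sg b)) :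
    ∃ l', ({ V with sg := sg } : ColorView).ColorInv k K X Bt l' ∧ l.Moves l' 0 0 0 :=
  ⟨{ l with g := { l.g with Cr := l.g.Cr + 0 } },
    ⟨h.inv.withCosts h0 h.inv.en_nonneg, h.ginv.lower le_rfl hs, h.n6_le, h.fl_le,
      h.fl_le_add_one, h.fl_full, h.fl_first⟩,
    Ledger.moves_zero rfl (add_zero _) rfl rfl rfl⟩

theorem ColorInv.adv (h : V.ColorInv k K X Bt l) (hK : 0 < K)
    (hend : ¬ V.sus → ∀ p ∈ V.op, V.t < p.nextSlot)
    (hstart : V.sus → ∀ p ∈ V.op, p.start = V.t) (hBt : ∀ b ∈ Bt, b.1 ⊆ X) :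
    ∃ l', (V.adv X).ColorInv k K X Bt l' ∧ l.Moves l' 0 0 0 := by
  have hv' := h.inv.adv hend hstart
  have hfull : K / 100 < ((V.frz X).card : ℝ) → K / 100 < (((V.adv X).frz X).card : ℝ) := by
    intro hlt
    refine hlt.trans_le ?_
    exact_mod_cast Finset.card_le_card (fun i hi => h.inv.frz_adv.2 (Or.inl hi))
  refine ⟨l, ⟨hv', h.ginv.adv h.inv hK hstart hBt, ?_, ?_, h.fl_le_add_one, ?_, ?_⟩,
    Ledger.moves_zero rfl rfl rfl rfl rfl⟩
  · rw [Wr_adv]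
    exact h.n6_le
  · intro hi hf
    rw [h.inv.int_adv] at hi
    exact h.fl_le hi (fun hf' => hf (hfull hf'))
  · intro hf i hi
    have hni := hv'.not_int_of_full hK hf
    rw [h.inv.int_adv] at hni
    by_cases hf' : K / 100 < ((V.frz X).card : ℝ)
    · rcases h.inv.act_adv.1 hi with hi | hi
      · rw [adv_ld_of_ne (mem_act.1 hi).2.1.ne]
        exact h.fl_full hf' i hi
      · exact absurd hi.2.2.2 hni
    · linarith [h.fl_le hni hf', hv'.ld_nonneg i]
  · intro ht
    have ht : V.t + 1 = k + 1 := ht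
    have := h.inv.t_ge
    omega

theorem Wr_addPiece (p : Piece) :
    (V.addPiece p).Wr = V.Wr + if p.regular then p.weight else 0 := by
  unfold Wr addPiece
  rw [Multiset.filter_add, Multiset.map_add, Multiset.sum_add, Multiset.filter_singleton]
  split_ifs <;> simp

theorem ColorInv.flush (h : V.ColorInv k K X Bt l) (hK : 0 < K) {p : Piece}
    (hp : p.items = V.act X) (hps : p.start = V.t) (h0 : 0 ≤ p.weight) (hreg : ¬ p.regular)
    (hne : (V.act X).Nonempty) (hfull : K / 100 < (V.frz X).card) (hW : V.W < 1)
    (hl : ∀ i ∈ V.act X, V.ld i + p.weight ≤ 1) :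
    ∃ l', (V.addPiece p).ColorInv k K X Bt l' ∧ l.Moves l' p.weight 0 0 := by
  have hint := h.inv.not_int_of_full hK hfull
  refine ⟨{ l with g := { l.g with Cr := l.g.Cr + p.weight }, fl := l.fl + p.weight },
    ⟨h.inv.addPiece hp hps h0 hint hne hW hl, h.ginv.flush h.inv hK hp h0 hreg hint hne hfull hl,
      ?_, ?_, ?_, ?_, ?_⟩, ?_⟩
  · rw [Wr_addPiece, if_neg hreg, add_zero]
    exact h.n6_le
  · intro _ hf
    rw [frz_addPiece hp] at hf
    exact absurd hfull hf
  · obtain ⟨i, hi⟩ := hne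
    change l.fl + p.weight ≤ l.n5 + 1
    linarith [h.fl_full hfull i hi, hl i hi]
  · intro _ i hi
    have hi := act_addPiece (V := V) h0 hi
    rw [addPiece_ld hp, if_pos hi]
    change l.fl + p.weight ≤ l.n5 + _
    linarith [h.fl_full hfull i hi]
  · intro ht
    rcases h.inv.first ht with hf | hf
    · have := full_nonempty hK hfull
      simp [hf] at this
    · simp [hf] at hne
  · unfold Ledger.Moves Ledger.cost Ledger.credit
    refine ⟨?_, ?_, ?_⟩ <;> dsimp only <;> ring

/-- Raising n5 by 1 turns fl ≤ n5 + 1 back into fl ≤ n5. -/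
theorem ColorInv.evInt (h : V.ColorInv k K X Bt l) (hK : 0 < K) (hint : V.Int X) :
    ∃ l', (V.evInt X).ColorInv k K X Bt l' ∧ l.Moves l' 2 0 1 := by
  refine ⟨{ l with g := { l.g with phase := .clean, F := ∅ }, n5 := l.n5 + 1 },
    .of_le (h.inv.evInt hint) (h.ginv.evInt h.inv hK hint) ?_ h.fl_le_add_one h.fl_first, ?_⟩
  · have : (V.evInt X).Wr = V.Wr := Wr_cut
    rw [this]
    exact h.n6_le
  · unfold Ledger.Moves Ledger.cost Ledger.credit
    refine ⟨?_, ?_, ?_⟩ <;> dsimp only <;> ring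

theorem ColorInv.evFrz (h : V.ColorInv k K X Bt l) (hK : 0 < K) (hne : (V.frz X).Nonempty)
    (hfull : ¬ K / 100 < (V.frz X).card) (hK10 : K / 10 ≤ (V.act X).card)
    (hen : 1 / 10 ≤ V.en) :
    ∃ l', (V.evFrz X).ColorInv k K X Bt l' ∧ l.Moves l' 2 0 0 := by
  have hint : ¬ V.Int X := fun hi => by simp [h.inv.int_frz hi] at hne
  refine ⟨{ l with g := { l.g with phase := .live, F := V.act X, ξ := 0 }, n6 := l.n6 + 1 },
    .of_le (h.inv.evFrz hne) (h.ginv.evFrz h.inv hK hne hK10) ?_ (h.fl_le hint hfull)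
      h.fl_first, ?_⟩
  · have h1 : (V.evFrz X).Wr = V.Wr := Wr_cut
    have h2 := h.n6_le
    rw [h1]
    change 0 + V.Wr + (l.n6 + 1) / 10 ≤ l.g.R
    linarith
  · unfold Ledger.Moves Ledger.cost Ledger.credit
    refine ⟨?_, ?_, ?_⟩ <;> dsimp only <;> ring

theorem ColorInv.resetEnded (h : V.ColorInv k K X Bt l) :
    ∃ l', ({ V with sg := fun _ => 0, en := 0 } : ColorView).ColorInv k K X Bt l' ∧
      l.Moves l' 0 0 0 := by
  obtain ⟨g', hg', hR, hC, -⟩ := h.ginv.resetEnded h.inv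
  refine ⟨{ l with g := g' }, ⟨h.inv.withCosts (fun _ => le_rfl) le_rfl, hg', ?_, h.fl_le,
    h.fl_le_add_one, h.fl_full, h.fl_first⟩, Ledger.moves_zero hR hC rfl rfl rfl⟩
  have h1 := h.n6_le
  have h2 := h.inv.en_nonneg
  change 0 + V.Wr + l.n6 / 10 ≤ g'.R
  rw [hR]
  linarith

theorem ColorInv.regular (h : V.ColorInv k K X Bt l) (hK : 0 < K)
    {L δ : ℝ} (hL : 2 ≤ L) (hδ : 0 < δ) {p : Piece} (hp : p.items = V.act X)
    (hps : p.start = V.t) (h0 : 0 ≤ p.weight) (hreg : p.regular) (hint : ¬ V.Int X)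
    (hne : (V.act X).Nonempty) (hfull : ¬ K / 100 < (V.frz X).card) (hen : V.en < 1 / 10)
    (hW : V.W < 1) (hW1 : V.W + p.weight ≤ 1)
    (hl : ∀ i ∈ V.act X, V.ld i + p.weight ≤ 1) (hBt : ∀ b ∈ Bt, b.1 ⊆ X) {sg : Batch → ℝ}
    (hsg : ∀ b, 0 ≤ sg b)
    (hx : ∀ b ∈ Bt, xhat k (sg b) ≤ xhat k (V.sg b) + p.weight)
    (hJ : ∀ b ∈ Bt, (∀ i ∈ b.1, i ∈ V.act X → ¬ slotOf b i < V.t) →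
      xhat k (sg b) ≤ xhat k (V.sg b))
    (hw : ∀ D, 0 ≤ D → (∀ b ∈ Bt, ∀ J ⊆ V.act X, (∀ i ∈ J, i ∈ b.1) →
      J.card * (1 / L + xhat k (sg b)) ≤ D) → p.weight ≤ δ * D) :
    ∃ l', ({ V.addPiece p with sg := sg } : ColorView).ColorInv k K X Bt l' ∧
      l.Moves l' p.weight (V.credit X L δ p.weight) 0 := by
  obtain ⟨g', hg', hR, hC⟩ := h.ginv.regular h.inv hK hL hδ hp hps h0 hreg hint hne hfull hen
    hW1 hl hBt hx hJ hw
  have hv' := h.inv.addPiece hp hps h0 hint hne hW hl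
  refine ⟨{ l with g := g' }, .of_le (hv'.withCosts hsg hv'.en_nonneg) hg' ?_
    (h.fl_le hint hfull) h.fl_first, ?_⟩
  · change V.en + (V.addPiece p).Wr + l.n6 / 10 ≤ g'.R
    rw [Wr_addPiece, if_pos hreg, hR]
    linarith [h.n6_le]
  · unfold Ledger.Moves Ledger.cost Ledger.credit
    refine ⟨?_, ?_, ?_⟩ <;> dsimp only <;> linarith

end ColorView

end

end RBM

/-! ### From states to the views of their colors -/

namespace RBM

noncomputable section

open scoped Classical

/-! ### Sums of weights -/

/-- The total weight of a multiset of pieces. -/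
def wt (s : Multiset Piece) : ℝ := (s.map Piece.weight).sum

theorem wt_zero : wt 0 = 0 := by simp [wt]

theorem wt_add (s s' : Multiset Piece) : wt (s + s') = wt s + wt s' := by simp [wt]

theorem wt_singleton (p : Piece) : wt {p} = p.weight := by simp [wt]

theorem wt_cons (p : Piece) (s : Multiset Piece) : wt (p ::ₘ s) = p.weight + wt s := by simp [wt]

theorem wt_nonneg {s : Multiset Piece} (h : ∀ p ∈ s, 0 ≤ p.weight) : 0 ≤ wt s := by
  refine Multiset.sum_nonneg ?_
  simp only [Multiset.mem_map]
  rintro _ ⟨p, hp, rfl⟩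
  exact h p hp

theorem wt_map {s : Multiset Piece} {f : Piece → Piece} (h : ∀ p ∈ s, (f p).weight = p.weight) :
    wt (s.map f) = wt s := by
  unfold wt
  rw [Multiset.map_map]
  congr 1
  exact Multiset.map_congr rfl h

theorem wt_filter_add_not (s : Multiset Piece) (P : Piece → Prop) [DecidablePred P] :
    wt (s.filter P) + wt (s.filter (fun p => ¬ P p)) = wt s := by
  rw [← wt_add, Multiset.filter_add_not]

theorem wt_filter_le {s : Multiset Piece} (h : ∀ p ∈ s, 0 ≤ p.weight) (P : Piece → Prop)
    [DecidablePred P] : wt (s.filter P) ≤ wt s := ColorView.sum_filter_le h P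

/-- The weight with which the pieces schedule an item. -/
def ldOf (s : Multiset Piece) (i : ℕ) : ℝ := wt (s.filter (fun p => i ∈ p.items))

theorem ldOf_zero (i : ℕ) : ldOf 0 i = 0 := by simp [ldOf, wt]

theorem ldOf_add (s s' : Multiset Piece) (i : ℕ) : ldOf (s + s') i = ldOf s i + ldOf s' i := by
  simp [ldOf, wt_add]

theorem ldOf_singleton (p : Piece) (i : ℕ) :
    ldOf {p} i = if i ∈ p.items then p.weight else 0 := by
  unfold ldOf
  rw [Multiset.filter_singleton]
  split_ifs <;> simp [wt]

theorem ldOf_cons (p : Piece) (s : Multiset Piece) (i : ℕ) :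
    ldOf (p ::ₘ s) i = (if i ∈ p.items then p.weight else 0) + ldOf s i := by
  rw [← Multiset.singleton_add, ldOf_add, ldOf_singleton]

theorem ldOf_nonneg {s : Multiset Piece} (h : ∀ p ∈ s, 0 ≤ p.weight) (i : ℕ) : 0 ≤ ldOf s i :=
  wt_nonneg (fun p hp => h p (Multiset.mem_filter.1 hp).1)

theorem ldOf_map {s : Multiset Piece} {f : Piece → Piece} {i : ℕ}
    (hw : ∀ p ∈ s, (f p).weight = p.weight) (h : ∀ p ∈ s, i ∈ (f p).items ↔ i ∈ p.items) :
    ldOf (s.map f) i = ldOf s i := by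
  unfold ldOf
  rw [Multiset.filter_map, wt_map]
  · congr 1
    exact Multiset.filter_congr (fun p hp => h p hp)
  · exact fun p hp => hw p (Multiset.mem_filter.1 hp).1

theorem filter_map_congr {s : Multiset Piece} {f g : Piece → Piece} {P : Piece → Prop}
    [DecidablePred P] (h : ∀ p ∈ s, P (f p) ↔ P p) (hg : ∀ p ∈ s, P p → f p = g p) :
    (s.map f).filter P = (s.filter P).map g := by
  have : s.filter (P ∘ f) = s.filter P := Multiset.filter_congr (fun p hp => h p hp)
  rw [Multiset.filter_map, this]
  exact Multiset.map_congr rfl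
    (fun p hp => hg p (Multiset.mem_filter.1 hp).1 (Multiset.mem_filter.1 hp).2)

theorem filter_map_of_color (T : Finset ℕ) {f : ℕ → Piece} (hf : ∀ x, (f x).color = x) (col : ℕ) :
    (T.val.map f).filter (fun p => p.color = col) = if col ∈ T then {f col} else 0 := by
  rw [Multiset.filter_map]
  have : (T.val.filter ((fun p : Piece => p.color = col) ∘ f)) = (T.filter (· = col)).val := by
    rw [Finset.filter_val]
    exact Multiset.filter_congr (fun x _ => by simp [hf])
  rw [this, Finset.filter_eq']
  split_ifs <;> simp

/-! ### Views -/

def colorItems (n : ℕ) (c : ℕ → ℕ) (col : ℕ) : Finset ℕ :=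
  (Finset.Icc 1 n).filter (fun i => c i = col)

theorem mem_colorItems {n : ℕ} {c : ℕ → ℕ} {col i : ℕ} :
    i ∈ colorItems n c col ↔ (1 ≤ i ∧ i ≤ n) ∧ c i = col := by
  simp [colorItems]

theorem IsBatch.subset {κ n : ℕ} {c : ℕ → ℕ} {col : ℕ} {b : Batch} (h : IsBatch κ n c col b) :
    b.1 ⊆ colorItems n c col := fun i hi =>
  Finset.mem_filter.2 ⟨h.2.1 hi, h.2.2.1 i hi⟩

theorem IsBatch.lt_slotOf {κ n : ℕ} {c : ℕ → ℕ} {col : ℕ} {b : Batch} (h : IsBatch κ n c col b) :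
    ∀ i ∈ b.1, i < slotOf b i := by
  intro i hi
  obtain ⟨-, h2, -, -, π, hπ, he⟩ := h
  rw [← he i hi]
  exact hπ.2.2 i (by simpa using h2 hi)

theorem IsBatch.color_unique {κ n : ℕ} {c : ℕ → ℕ} {col col' : ℕ} {b : Batch}
    (h : IsBatch κ n c col b) (h' : IsBatch κ n c col' b) : col = col' := by
  obtain ⟨i, hi⟩ := h.1
  rw [← h.2.2.1 i hi, h'.2.2.1 i hi]

theorem frozenBound_eq (k : ℕ) : frozenBound k = k / Real.log k / 100 := by
  unfold frozenBound
  rw [div_div, mul_comm]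

theorem activeBound_eq (k : ℕ) : activeBound k = k / Real.log k / 10 := by
  unfold activeBound
  rw [div_div, mul_comm]

theorem ColorView.eq_of {V V' : ColorView} (ht : V.t = V'.t) (hst : ∀ i, V.st i = V'.st i)
    (hld : ∀ i, V.ld i = V'.ld i) (hop : V.op = V'.op) (hen : V.en = V'.en)
    (hsg : ∀ b, V.sg b = V'.sg b) (hsus : V.sus ↔ V'.sus) (hblk : V.blk ↔ V'.blk)
    (hbi : V.blkInt ↔ V'.blkInt) : V = V' := by
  have h1 := funext hst
  have h2 := funext hld
  have h3 := funext hsg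
  have h4 := propext hsus
  have h5 := propext hblk
  have h6 := propext hbi
  cases V
  cases V'
  simp_all

namespace State

variable (k n : ℕ) (c : ℕ → ℕ) (S : State)

/-- The state as seen by a color. -/
def view (col : ℕ) : ColorView where
  t := S.t
  -- Fixed default values outside the color make the view independent of what happens to other
  -- items, so that steps on other colors leave it unchanged as an equality.
  st := fun i => if i ∈ colorItems n c col then S.status i else .frozen
  ld := fun i => if i ∈ colorItems n c col then S.load i else 0
  op := (S.live + S.susp.map (fun p => ({ p with start := S.t } : Piece))).filter (fun p => p.color = col)
  en := S.ended col
  sg := fun b => if IsBatch (smallBuffer k) n c col b then S.sigma b else 0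
  sus := S.block ≠ none
  blk := ∃ p, S.block = some p ∧ p.color = col
  blkInt := S.blockIntegral ∧ ∃ p, S.block = some p ∧ p.color = col

theorem load_eq (i : ℕ) :
    S.load i = ldOf S.past i + ldOf S.live i + ldOf S.blockPieces i + ldOf S.susp i := by
  change ldOf S.placed i = _
  unfold placed
  rw [ldOf_add, ldOf_add, ldOf_add]
  congr 1
  exact ldOf_map (fun _ _ => rfl) (fun _ _ => Iff.rfl)

variable {k n c S}

theorem view_ld {col i : ℕ} (h : i ∈ colorItems n c col) : (S.view k n c col).ld i = S.load i :=
  if_pos h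

theorem view_st {col i : ℕ} (h : i ∈ colorItems n c col) : (S.view k n c col).st i = S.status i :=
  if_pos h

theorem view_B (col : ℕ) : (S.view k n c col).B (colorItems n c col) = S.Bcol n c col := by
  ext i
  rw [ColorView.mem_B]
  unfold Bcol B
  simp only [Finset.mem_filter]
  constructor
  · rintro ⟨h1, h2, h3⟩
    rw [view_ld h1] at h3
    exact ⟨⟨(Finset.mem_filter.1 h1).1, h2, h3⟩, (Finset.mem_filter.1 h1).2⟩
  · rintro ⟨⟨h1, h2, h3⟩, h4⟩
    have h5 : i ∈ colorItems n c col := Finset.mem_filter.2 ⟨h1, h4⟩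
    exact ⟨h5, h2, by rw [view_ld h5]; exact h3⟩

theorem mem_colorItems_of_Bcol {col i : ℕ} (h : i ∈ S.Bcol n c col) : i ∈ colorItems n c col := by
  rw [← view_B (k := 0), ColorView.mem_B] at h
  exact h.1

theorem view_frz (col : ℕ) : (S.view k n c col).frz (colorItems n c col) = S.frz n c col := by
  unfold ColorView.frz frz
  rw [view_B]
  exact Finset.filter_congr (fun i hi => by rw [view_st (mem_colorItems_of_Bcol hi)])

theorem view_act (col : ℕ) : (S.view k n c col).act (colorItems n c col) = S.act n c col := by
  unfold ColorView.act act
  rw [view_B]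
  exact Finset.filter_congr (fun i hi => by rw [view_st (mem_colorItems_of_Bcol hi)])

theorem view_int (col : ℕ) :
    (S.view k n c col).Int (colorItems n c col) ↔ S.IsIntegral n c col := by
  unfold ColorView.Int IsIntegral
  rw [view_B]
  exact exists_congr (fun i => and_congr_right (fun hi => by
    rw [view_st (mem_colorItems_of_Bcol hi)]))

theorem view_frac (col : ℕ) :
    (S.view k n c col).Frac (colorItems n c col) ↔ S.IsFractional n c col := by
  unfold ColorView.Frac IsFractional
  rw [view_B]
  exact exists_congr (fun i => and_congr_right (fun hi => by
    rw [view_st (mem_colorItems_of_Bcol hi)]))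

theorem mem_colorItems_of_frz {col i : ℕ} (h : i ∈ S.frz n c col) : i ∈ colorItems n c col :=
  mem_colorItems_of_Bcol (Finset.mem_filter.1 h).1

theorem mem_colorItems_of_act {col i : ℕ} (h : i ∈ S.act n c col) : i ∈ colorItems n c col :=
  mem_colorItems_of_Bcol (Finset.mem_filter.1 h).1

theorem color_eq {col col' i : ℕ} (h : i ∈ colorItems n c col) (h' : i ∈ colorItems n c col') :
    col = col' := by
  rw [← (mem_colorItems.1 h).2, (mem_colorItems.1 h').2]

theorem resetColor_self {col : ℕ} (b : Batch) :
    (if IsBatch (smallBuffer k) n c col b then S.resetColor k n c col b else 0) = 0 := by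
  unfold resetColor
  split_ifs <;> rfl

theorem resetColor_of_ne {col col' : ℕ} (h : col' ≠ col) (b : Batch) :
    (if IsBatch (smallBuffer k) n c col' b then S.resetColor k n c col b else 0) =
      if IsBatch (smallBuffer k) n c col' b then S.sigma b else 0 := by
  unfold resetColor
  split_ifs with h1 h2
  · exact absurd (h1.color_unique h2) h
  · rfl
  · rfl

/-! ### The steps, as seen by a color -/

theorem view_makeIntegral (col : ℕ) : (S.makeIntegral k n c col).view k n c col =
    (S.view k n c col).mkInt (colorItems n c col) := by
  refine ColorView.eq_of rfl (fun i => ?_) (fun _ => rfl) rfl rfl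
    (fun b => resetColor_self b) Iff.rfl Iff.rfl Iff.rfl
  change _ = if i ∈ (S.view k n c col).frz _ then ItemState.integral else (S.view k n c col).st i
  rw [view_frz]
  by_cases hi : i ∈ S.frz n c col
  · rw [view_st (mem_colorItems_of_frz hi), if_pos hi]
    exact if_pos hi
  · rw [if_neg hi]
    by_cases hX : i ∈ colorItems n c col
    · rw [view_st hX, view_st hX]
      exact if_neg hi
    · exact (if_neg hX).trans (if_neg hX).symm

theorem view_makeIntegral_of_ne {col col' : ℕ} (h : col' ≠ col) :
    (S.makeIntegral k n c col).view k n c col' = S.view k n c col' := by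
  refine ColorView.eq_of rfl (fun i => ?_) (fun _ => rfl) rfl rfl
    (fun b => resetColor_of_ne h b) Iff.rfl Iff.rfl Iff.rfl
  by_cases hX : i ∈ colorItems n c col'
  · rw [view_st hX, view_st hX]
    exact if_neg (fun hf => h (color_eq hX (mem_colorItems_of_frz hf)))
  · exact (if_neg hX).trans (if_neg hX).symm

/-- An appended item gains the full weight only of pieces that did not contain it before, hence the
hypothesis `h`. -/
theorem ldOf_append {s : Multiset Piece} {col i : ℕ} {F : Finset ℕ} (hi : i ∈ F)
    (h : ∀ p ∈ s, p.color = col → i ∉ p.items) :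
    ldOf (s.map (fun p => if p.color = col then { p with items := p.items ∪ F } else p)) i =
      ldOf s i + wt (s.filter (fun p => p.color = col)) := by
  induction s using Multiset.induction with
  | empty => simp [ldOf_zero, wt_zero]
  | cons a s ih =>
    have ih := ih (fun p hp => h p (Multiset.mem_cons_of_mem hp))
    have ha := h a (Multiset.mem_cons_self _ _)
    rw [Multiset.map_cons, ldOf_cons, ldOf_cons, ih]
    by_cases hc : a.color = col
    · rw [if_pos hc, if_pos (Finset.mem_union_right _ hi), if_neg (ha hc),
        Multiset.filter_cons_of_pos (p := fun p : Piece => p.color = col) _ hc, wt_cons]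
      ring
    · rw [if_neg hc, Multiset.filter_cons_of_neg (p := fun p : Piece => p.color = col) _ hc]
      ring

theorem ldOf_append_of_notMem {s : Multiset Piece} {col i : ℕ} {F : Finset ℕ} (hi : i ∉ F) :
    ldOf (s.map (fun p => if p.color = col then { p with items := p.items ∪ F } else p)) i =
      ldOf s i := by
  refine ldOf_map (fun p _ => ?_) (fun p _ => ?_)
  · split_ifs <;> rfl
  · split_ifs <;> simp [hi]

theorem view_op_W (col : ℕ) : (S.view k n c col).W =
    wt (S.live.filter (fun p => p.color = col)) + wt (S.susp.filter (fun p => p.color = col)) := by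
  change wt ((_ + _ : Multiset Piece).filter _) = _
  rw [Multiset.filter_add, wt_add]
  congr 1
  have := filter_map_congr (s := S.susp) (f := fun p : Piece => ({ p with start := S.t } : Piece))
    (g := fun p : Piece => ({ p with start := S.t } : Piece)) (P := fun p => p.color = col)
    (fun p _ => Iff.rfl) (fun p _ _ => rfl)
  rw [this]
  exact wt_map (fun _ _ => rfl)

theorem mem_view_op_of_live {p : Piece} (h : p ∈ S.live) : p ∈ (S.view k n c p.color).op :=
  Multiset.mem_filter.2 ⟨Multiset.mem_add.2 (Or.inl h), rfl⟩

theorem mem_view_op_of_susp {p : Piece} (h : p ∈ S.susp) :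
    ({ p with start := S.t } : Piece) ∈ (S.view k n c p.color).op :=
  Multiset.mem_filter.2 ⟨Multiset.mem_add.2 (Or.inr (Multiset.mem_map.2 ⟨p, h, rfl⟩)), rfl⟩

theorem load_replenish (col : ℕ) (i : ℕ)
    (hst : ∀ p ∈ S.live + S.susp, p.color = col → i ∈ S.frz n c col → i ∉ p.items) :
    (S.replenish n c col).load i =
      if i ∈ S.frz n c col then S.load i + (S.view k n c col).W else S.load i := by
  rw [load_eq, load_eq]
  change ldOf S.past i + ldOf (S.live.map _) i + ldOf S.blockPieces i + ldOf (S.susp.map _) i = _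
  split_ifs with hi
  · rw [ldOf_append hi (fun p hp hc => hst p (Multiset.mem_add.2 (Or.inl hp)) hc hi),
      ldOf_append hi (fun p hp hc => hst p (Multiset.mem_add.2 (Or.inr hp)) hc hi), view_op_W]
    ring
  · rw [ldOf_append_of_notMem hi, ldOf_append_of_notMem hi]

theorem op_replenish (col col' : ℕ) : ((S.replenish n c col).view k n c col').op =
    (S.view k n c col').op.map (fun p =>
      if p.color = col then { p with items := p.items ∪ S.frz n c col } else p) := by
  change ((S.live.map _ + (S.susp.map _).map _).filter _ : Multiset Piece) = _
  have h : (S.susp.map (fun p => if p.color = col then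
      { p with items := p.items ∪ S.frz n c col } else p)).map
        (fun p => ({ p with start := S.t } : Piece)) = (S.susp.map (fun p => { p with start := S.t })).map
      (fun p => if p.color = col then { p with items := p.items ∪ S.frz n c col } else p) := by
    rw [Multiset.map_map, Multiset.map_map]
    refine Multiset.map_congr rfl (fun p _ => ?_)
    simp only [Function.comp]
    split_ifs <;> rfl
  change Multiset.filter _ (_ + Multiset.map _ (Multiset.map _ S.susp)) = _
  erw [h]
  rw [← Multiset.map_add]
  refine filter_map_congr (fun p _ => ?_) (fun p _ _ => rfl)
  split_ifs <;> rfl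

theorem view_replenish (col : ℕ)
    (hst : ∀ p ∈ S.live + S.susp, p.color = col → ∀ i ∈ S.frz n c col, i ∉ p.items) :
    (S.replenish n c col).view k n c col = (S.view k n c col).repl (colorItems n c col) := by
  refine ColorView.eq_of rfl (fun i => ?_) (fun i => ?_) ?_ rfl (fun _ => rfl) Iff.rfl Iff.rfl
    Iff.rfl
  · change _ = if i ∈ (S.view k n c col).frz _ then ItemState.fractional
      else (S.view k n c col).st i
    rw [view_frz]
    by_cases hi : i ∈ S.frz n c col
    · rw [view_st (mem_colorItems_of_frz hi), if_pos hi]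
      exact if_pos hi
    · rw [if_neg hi]
      by_cases hX : i ∈ colorItems n c col
      · rw [view_st hX, view_st hX]
        exact if_neg hi
      · exact (if_neg hX).trans (if_neg hX).symm
  · change _ = if i ∈ (S.view k n c col).frz _ then
      (S.view k n c col).ld i + (S.view k n c col).W else (S.view k n c col).ld i
    rw [view_frz]
    by_cases hX : i ∈ colorItems n c col
    · rw [view_ld hX, view_ld hX]
      exact load_replenish col i (fun p hp hc hi => hst p hp hc i hi)
    · rw [if_neg (fun hf => hX (mem_colorItems_of_frz hf))]
      exact (if_neg hX).trans (if_neg hX).symm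
  · rw [op_replenish]
    refine Multiset.map_congr rfl (fun p hp => ?_)
    have hc : p.color = col := (Multiset.mem_filter.1 hp).2
    rw [if_pos hc, view_frz]

theorem view_replenish_of_ne {col col' : ℕ} (h : col' ≠ col) :
    (S.replenish n c col).view k n c col' = S.view k n c col' := by
  have hf : ∀ i ∈ colorItems n c col', i ∉ S.frz n c col := fun i hX hf =>
    h (color_eq hX (mem_colorItems_of_frz hf))
  refine ColorView.eq_of rfl (fun i => ?_) (fun i => ?_) ?_ rfl (fun _ => rfl) Iff.rfl Iff.rfl
    Iff.rfl
  · by_cases hX : i ∈ colorItems n c col'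
    · rw [view_st hX, view_st hX]
      exact if_neg (hf i hX)
    · exact (if_neg hX).trans (if_neg hX).symm
  · by_cases hX : i ∈ colorItems n c col'
    · rw [view_ld hX, view_ld hX, load_replenish (k := k) col i
        (fun _ _ _ hi => absurd hi (hf i hX)), if_neg (hf i hX)]
    · exact (if_neg hX).trans (if_neg hX).symm
  · rw [op_replenish]
    conv_rhs => rw [← Multiset.map_id (S.view k n c col').op]
    refine Multiset.map_congr rfl (fun p hp => ?_)
    have hc : p.color = col' := (Multiset.mem_filter.1 hp).2
    rw [if_neg (fun he => h (hc.symm.trans he))]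
    rfl

end State

end

end RBM

/-! ### Views under closing, advancing, scheduling and evicting -/

namespace RBM

noncomputable section

open scoped Classical

namespace State

variable {k n : ℕ} {c : ℕ → ℕ} {S : State}

theorem ldOf_shift (s : Multiset Piece) (t i : ℕ) :
    ldOf (s.map (fun p => ({ p with start := t } : Piece))) i = ldOf s i :=
  ldOf_map (fun _ _ => rfl) (fun _ _ => Iff.rfl)

theorem wt_shift (s : Multiset Piece) (t : ℕ) :
    wt (s.map (fun p => ({ p with start := t } : Piece))) = wt s :=
  wt_map (fun _ _ => rfl)

theorem blockPieces_none (h : S.block = none) : S.blockPieces = 0 := by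
  unfold blockPieces
  rw [h]
  rfl

theorem blockPieces_some {p : Piece} (h : S.block = some p) : S.blockPieces = {p} := by
  unfold blockPieces
  rw [h]
  rfl

theorem view_congr {S' : State} {col : ℕ} {V : ColorView} (ht : S'.t = V.t)
    (hst : ∀ i ∈ colorItems n c col, S'.status i = V.st i)
    (hst' : ∀ i ∉ colorItems n c col, V.st i = .frozen)
    (hld : ∀ i ∈ colorItems n c col, S'.load i = V.ld i)
    (hld' : ∀ i ∉ colorItems n c col, V.ld i = 0)
    (hop : (S'.view k n c col).op = V.op) (hen : S'.ended col = V.en)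
    (hsg : ∀ b, (S'.view k n c col).sg b = V.sg b) (hsus : S'.block ≠ none ↔ V.sus)
    (hblk : (∃ p, S'.block = some p ∧ p.color = col) ↔ V.blk)
    (hbi : (S'.blockIntegral ∧ ∃ p, S'.block = some p ∧ p.color = col) ↔ V.blkInt) :
    S'.view k n c col = V := by
  refine ColorView.eq_of ht (fun i => ?_) (fun i => ?_) hop hen hsg hsus hblk hbi
  · by_cases hX : i ∈ colorItems n c col
    · rw [view_st hX, hst i hX]
    · rw [hst' i hX]
      exact if_neg hX
  · by_cases hX : i ∈ colorItems n c col
    · rw [view_ld hX, hld i hX]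
    · rw [hld' i hX]
      exact if_neg hX

/-! ### Closing -/

/-- Closing falls into two cases: without a weight-1 block there are no suspended pieces, and with
one there are no live pieces. So it is either `close` or `unblock` for all colors. -/
theorem closeEnded_none (hb : S.block = none) (hs : S.susp = 0) :
    (S.closeEnded n c).past = S.past + S.live.filter (fun p => p.nextSlot ≤ S.t) ∧
    (S.closeEnded n c).live = S.live.filter (fun p => S.t < p.nextSlot) ∧
    (S.closeEnded n c).susp = 0 ∧ (S.closeEnded n c).block = none := by
  have h0 := blockPieces_none hb
  unfold closeEnded
  simp [h0, hs, hb]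

theorem closeEnded_some {p : Piece} (hb : S.block = some p) (hl : S.live = 0)
    (he : p.nextSlot ≤ S.t) :
    (S.closeEnded n c).past = S.past + {p} ∧
    (S.closeEnded n c).live = S.susp.map (fun p => ({ p with start := S.t } : Piece)) ∧
    (S.closeEnded n c).susp = 0 ∧ (S.closeEnded n c).block = none := by
  have h0 := blockPieces_some hb
  unfold closeEnded
  simp [h0, hl, he]

theorem load_closeEnded_none (hb : S.block = none) (hs : S.susp = 0) (i : ℕ) :
    (S.closeEnded n c).load i = S.load i := by
  obtain ⟨h1, h2, h3, h4⟩ := closeEnded_none (n := n) (c := c) hb hs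
  rw [load_eq, load_eq, h1, h2, h3, blockPieces_none h4, blockPieces_none hb, hs, ldOf_add]
  have : S.live.filter (fun p => S.t < p.nextSlot) =
      S.live.filter (fun p => ¬ p.nextSlot ≤ S.t) :=
    Multiset.filter_congr (fun p _ => not_le.symm)
  rw [this, add_assoc (ldOf S.past i), ← ldOf_add, Multiset.filter_add_not]

theorem load_closeEnded_some {p : Piece} (hb : S.block = some p) (hl : S.live = 0)
    (he : p.nextSlot ≤ S.t) (i : ℕ) : (S.closeEnded n c).load i = S.load i := by
  obtain ⟨h1, h2, h3, h4⟩ := closeEnded_some (n := n) (c := c) hb hl he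
  rw [load_eq, load_eq, h1, h2, h3, blockPieces_none h4, blockPieces_some hb, hl, ldOf_add,
    ldOf_shift, ldOf_zero]
  ring

theorem view_ld_of_notMem {col i : ℕ} (h : i ∉ colorItems n c col) :
    (S.view k n c col).ld i = 0 := if_neg h

theorem view_st_of_notMem {col i : ℕ} (h : i ∉ colorItems n c col) :
    (S.view k n c col).st i = .frozen := if_neg h

theorem view_op_of_none (hs : S.susp = 0) (col : ℕ) :
    (S.view k n c col).op = S.live.filter (fun p => p.color = col) := by
  change Multiset.filter _ (S.live + S.susp.map _) = _
  rw [hs]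
  simp

theorem view_closeEnded_none (hb : S.block = none) (hs : S.susp = 0) (col : ℕ) :
    (S.closeEnded n c).view k n c col = (S.view k n c col).close := by
  obtain ⟨h1, h2, h3, h4⟩ := closeEnded_none (n := n) (c := c) hb hs
  have hop := view_op_of_none (k := k) (n := n) (c := c) hs col
  refine view_congr rfl (fun i hi => (view_st (k := k) (S := S) hi).symm) (fun i hi => view_st_of_notMem (k := k) (S := S) hi)
    (fun i hi => ?_) (fun i hi => view_ld_of_notMem (k := k) (S := S) hi) ?_ ?_ (fun _ => rfl) ?_ ?_ ?_
  · rw [load_closeEnded_none hb hs]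
    exact (view_ld (k := k) hi).symm
  · rw [view_op_of_none h3, h2]
    change _ = Multiset.filter _ (S.view k n c col).op
    rw [hop, Multiset.filter_filter, Multiset.filter_filter]
    exact Multiset.filter_congr (fun p _ => and_comm)
  · change S.ended col + (Multiset.map _ (Multiset.filter _ _)).sum =
      S.ended col + (Multiset.map _ (Multiset.filter _ (S.view k n c col).op)).sum
    rw [hop, Multiset.filter_filter]
    congr 3
    exact Multiset.filter_congr (fun p _ => and_assoc.symm)
  · rw [h4.trans hb.symm]
    exact Iff.rfl
  · rw [h4.trans hb.symm]
    exact Iff.rfl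
  · rw [h4.trans hb.symm]
    exact Iff.rfl

theorem view_closeEnded_some {p : Piece} (hb : S.block = some p) (hl : S.live = 0)
    (he : p.nextSlot ≤ S.t) (col : ℕ) :
    (S.closeEnded n c).view k n c col = (S.view k n c col).unblock := by
  obtain ⟨h1, h2, h3, h4⟩ := closeEnded_some (n := n) (c := c) hb hl he
  refine view_congr rfl (fun i hi => (view_st (k := k) (S := S) hi).symm) (fun i hi => view_st_of_notMem (k := k) (S := S) hi)
    (fun i hi => ?_) (fun i hi => view_ld_of_notMem (k := k) (S := S) hi) ?_ ?_ (fun _ => rfl) ?_ ?_ ?_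
  · rw [load_closeEnded_some hb hl he]
    exact (view_ld (k := k) hi).symm
  · rw [view_op_of_none h3, h2]
    change _ = Multiset.filter _ (S.live + _)
    rw [hl, zero_add]
  · change S.ended col + (Multiset.map _ (Multiset.filter _ _)).sum = S.ended col
    rw [hl]
    simp
  · rw [h4]
    exact ⟨fun h => h rfl, fun h => h.elim⟩
  · rw [h4]
    exact ⟨fun ⟨_, h, _⟩ => by simp at h, fun h => h.elim⟩
  · rw [h4]
    exact ⟨fun ⟨_, _, h, _⟩ => by simp at h, fun h => h.elim⟩

/-! ### Advancing -/

theorem load_advance (hb : ∀ p, S.block = some p → p.weight = 1 ∧ S.t ∉ p.items) (i : ℕ) :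
    (S.advance n c).load i =
      if i = S.t ∧ S.t ≤ n ∧ ∃ p, S.block = some p ∧ p.color = c S.t then S.load i + 1
      else S.load i := by
  rw [load_eq, load_eq]
  change ldOf S.past i + ldOf S.live i + ldOf (S.advance n c).blockPieces i + ldOf S.susp i = _
  cases h : S.block with
  | none =>
    have : (S.advance n c).block = none := by
      unfold advance
      simp [h]
    rw [blockPieces_none h, blockPieces_none this]
    simp
  | some p =>
    have h' : (S.advance n c).block = some (if S.t ≤ n ∧ p.color = c S.t then
        { p with items := insert S.t p.items } else p) := by
      unfold advance
      rw [h]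
      rfl
    obtain ⟨hw, hni⟩ := hb p h
    rw [blockPieces_some h, blockPieces_some h', ldOf_singleton, ldOf_singleton]
    simp only [Option.some.injEq, exists_eq_left']
    by_cases hc : S.t ≤ n ∧ p.color = c S.t
    · by_cases hi : i = S.t
      · simp only [hi, hc, and_self, if_true, Finset.mem_insert, true_or, hni, if_false, hw]
        ring
      · simp [hi, hc]
    · simp only [hc, and_false, if_false]

theorem view_advance (hb : ∀ p, S.block = some p → p.weight = 1 ∧ S.t ∉ p.items)
    (hl : ∀ p, S.block = some p → S.live = 0) (hs : S.block = none → S.susp = 0) (col : ℕ) :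
    (S.advance n c).view k n c col = (S.view k n c col).adv (colorItems n c col) := by
  have hblock : ∀ col', (∃ p, (S.advance n c).block = some p ∧ p.color = col') ↔
      ∃ p, S.block = some p ∧ p.color = col' := by
    intro col'
    change (∃ p : Piece, S.block.map _ = some p ∧ p.color = col') ↔ _
    cases h : S.block with
    | none => simp
    | some p =>
      simp only [Option.map_some, Option.some.injEq, exists_eq_left']
      split_ifs <;> rfl
  have hnone : (S.advance n c).block = none ↔ S.block = none := by
    change S.block.map _ = none ↔ _
    simp
  refine view_congr rfl (fun i hi => ?_) (fun i hi => ?_) (fun i hi => ?_) (fun i hi => ?_) ?_ rfl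
    (fun _ => rfl) (not_congr hnone) (hblock col) (and_congr Iff.rfl (hblock col))
  · change Function.update S.status S.t _ i = if i = S.t ∧ i ∈ colorItems n c col then
      (if (S.view k n c col).Int _ ∨ _ then ItemState.integral else ItemState.frozen)
      else (S.view k n c col).st i
    rw [view_int]
    by_cases hit : i = S.t
    · refine Eq.trans ?_ (if_pos ⟨hit, hi⟩).symm
      have hct : c S.t = col := by rw [← hit]; exact (mem_colorItems.1 hi).2
      rw [hit, Function.update_self, hct]
      exact if_congr Iff.rfl rfl rfl
    · refine Eq.trans ?_ (if_neg (fun h => hit h.1)).symm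
      rw [Function.update_of_ne hit]
      exact (view_st (k := k) hi).symm
  · exact (if_neg (fun h => hi h.2)).trans (view_st_of_notMem hi)
  · rw [load_advance hb]
    change _ = if i = S.t ∧ i ∈ colorItems n c col ∧ _ then (S.view k n c col).ld i + 1
      else (S.view k n c col).ld i
    rw [view_ld hi]
    have hX := mem_colorItems.1 hi
    refine if_congr ⟨?_, ?_⟩ rfl rfl
    · rintro ⟨h1, h2, h3⟩
      refine ⟨h1, hi, ?_⟩
      rw [← h1, hX.2] at h3
      exact h3
    · rintro ⟨h1, -, h3⟩
      refine ⟨h1, by omega, ?_⟩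
      rw [← h1, hX.2]
      exact h3
  · exact (if_neg (fun h => hi h.2.1)).trans (view_ld_of_notMem hi)
  · have hadv : ((S.view k n c col).adv (colorItems n c col)).op = if S.block ≠ none then
        (S.view k n c col).op.map (fun p => ({ p with start := S.t + 1 } : Piece))
        else (S.view k n c col).op := if_congr Iff.rfl rfl rfl
    rw [hadv]
    cases h : S.block with
    | none =>
      rw [if_neg (by simp), view_op_of_none (hs h), view_op_of_none (show (S.advance n c).susp = 0
        from hs h)]
      rfl
    | some p =>
      rw [if_pos (by simp)]
      change Multiset.filter _ (S.live + S.susp.map (fun p => ({ p with start := S.t + 1 } : Piece)))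
        = Multiset.map _ (Multiset.filter _ (S.live + S.susp.map _))
      rw [hl p h, zero_add, zero_add]
      rw [← filter_map_congr (f := fun p : Piece => ({ p with start := S.t + 1 } : Piece))
        (fun p _ => Iff.rfl) (fun p _ _ => rfl), Multiset.map_map]
      rfl

/-! ### Scheduling new pieces -/

theorem filter_items_of_color {s : Multiset Piece} {col i : ℕ}
    (hs : ∀ p ∈ s, p.items ⊆ colorItems n c p.color) (hi : i ∈ colorItems n c col) :
    ldOf s i = ldOf (s.filter (fun p => p.color = col)) i := by
  unfold ldOf
  rw [Multiset.filter_filter]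
  congr 1
  exact Multiset.filter_congr
    (fun p hp => ⟨fun h => ⟨h, color_eq (hs p hp h) hi⟩, fun h => h.1⟩)

/-- Adding pieces that start now. -/
theorem view_add_live {S' : State} {s : Multiset Piece} {col : ℕ} (ht : S'.t = S.t)
    (hst : S'.status = S.status) (hp : S'.past = S.past) (hl : S'.live = S.live + s)
    (hs : S'.susp = S.susp) (hb : S'.block = S.block) (hbi : S'.blockIntegral = S.blockIntegral)
    (hen : S'.ended = S.ended) (hitems : ∀ p ∈ s, p.items ⊆ colorItems n c p.color) :
    (∀ p, s.filter (fun p => p.color = col) = {p} → S'.view k n c col =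
      { (S.view k n c col).addPiece p with sg := (S'.view k n c col).sg }) ∧
    (s.filter (fun p => p.color = col) = 0 → S'.view k n c col =
      { S.view k n c col with sg := (S'.view k n c col).sg }) := by
  have hload : ∀ i, S'.load i = S.load i + ldOf s i := by
    intro i
    rw [load_eq, load_eq, hp, hl, hs, show S'.blockPieces = S.blockPieces by
      unfold blockPieces; rw [hb], ldOf_add]
    ring
  have hop : (S'.view k n c col).op =
      (S.view k n c col).op + s.filter (fun p => p.color = col) := by
    change Multiset.filter _ (S'.live + S'.susp.map _) =
      Multiset.filter _ (S.live + S.susp.map _) + _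
    rw [hl, hs, ht, Multiset.filter_add, Multiset.filter_add, Multiset.filter_add]
    abel
  constructor
  · intro p hsp
    have hps : p ∈ s ∧ p.color = col := by
      have : p ∈ s.filter (fun p => p.color = col) := by rw [hsp]; simp
      simpa using this
    refine view_congr ht (fun i hi => ?_) (fun i hi => view_st_of_notMem (k := k) (S := S) hi) (fun i hi => ?_)
      (fun i hi => ?_) ?_ ?_ (fun _ => rfl) ?_ ?_ ?_
    · rw [hst]
      exact (view_st (k := k) hi).symm
    · rw [hload, filter_items_of_color hitems hi, hsp, ldOf_singleton]
      change _ = if i ∈ p.items then (S.view k n c col).ld i + p.weight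
        else (S.view k n c col).ld i
      rw [view_ld hi]
      split_ifs <;> simp
    · change (if i ∈ p.items then _ else (S.view k n c col).ld i) = _
      rw [if_neg, view_ld_of_notMem hi]
      intro h
      have := hitems p hps.1 h
      rw [hps.2] at this
      exact hi this
    · rw [hop, hsp]
      rfl
    · rw [hen]
      rfl
    · rw [hb]
      exact Iff.rfl
    · rw [hb]
      exact Iff.rfl
    · rw [hb, hbi]
      exact Iff.rfl
  · intro hsp
    refine view_congr ht (fun i hi => ?_) (fun i hi => view_st_of_notMem (k := k) (S := S) hi) (fun i hi => ?_)
      (fun i hi => view_ld_of_notMem (k := k) (S := S) hi) ?_ ?_ (fun _ => rfl) ?_ ?_ ?_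
    · rw [hst]
      exact (view_st (k := k) hi).symm
    · rw [hload, filter_items_of_color hitems hi, hsp, ldOf_zero, add_zero]
      exact (view_ld (k := k) hi).symm
    · rw [hop, hsp, add_zero]
    · rw [hen]
      rfl
    · rw [hb]
      exact Iff.rfl
    · rw [hb]
      exact Iff.rfl
    · rw [hb, hbi]
      exact Iff.rfl

/-! ### Evicting -/

/-- The cut splits each live piece into a passed part and a rest with disjoint item sets, so only
the new block changes loads. -/
theorem load_evict (hb : S.block = none) (hs : S.susp = 0) (col : ℕ) (A : Finset ℕ) (P : Prop)
    (i : ℕ) : (S.evict k n c col A P).load i = if i ∈ A then S.load i + 1 else S.load i := by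
  rw [load_eq, load_eq]
  have hbp : (S.evict k n c col A P).blockPieces =
      {{ color := col, items := A, start := S.t, weight := 1, regular := False, rel := ∅ }} :=
    blockPieces_some rfl
  -- Dropping empty passed parts costs no load.
  have key : ∀ s : Multiset Piece,
      ldOf ((s.map (fun p => ({ p with
          items := p.items.filter (fun i => slotOf (p.items, p.start) i < S.t) } : Piece))).filter
        (fun p => p.items.Nonempty)) i +
      ldOf (s.map (fun p => ({ p with
          items := p.items.filter (fun i => S.t ≤ slotOf (p.items, p.start) i) } : Piece))) i =
      ldOf s i := by
    intro s
    induction s using Multiset.induction with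
    | empty => simp [ldOf_zero]
    | cons a s ih =>
      rw [Multiset.map_cons, Multiset.map_cons, ldOf_cons, ldOf_cons, ← ih]
      have h1 : ldOf (Multiset.filter (fun p => p.items.Nonempty) ({ a with
          items := a.items.filter (fun i => slotOf (a.items, a.start) i < S.t) } ::ₘ
          s.map (fun p => ({ p with
            items := p.items.filter (fun i => slotOf (p.items, p.start) i < S.t) } : Piece)))) i =
          (if i ∈ a.items.filter (fun i => slotOf (a.items, a.start) i < S.t) then a.weight else 0)
          + ldOf (Multiset.filter (fun p => p.items.Nonempty) (s.map (fun p => ({ p with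
            items := p.items.filter (fun i => slotOf (p.items, p.start) i < S.t) } : Piece)))) i := by
        by_cases hne : (a.items.filter (fun i => slotOf (a.items, a.start) i < S.t)).Nonempty
        · rw [Multiset.filter_cons_of_pos (p := fun p : Piece => p.items.Nonempty) _ hne, ldOf_cons]
        · rw [Multiset.filter_cons_of_neg (p := fun p : Piece => p.items.Nonempty) _ hne, if_neg,
            zero_add]
          exact fun h => hne ⟨i, h⟩
      rw [h1]
      dsimp only
      simp only [Finset.mem_filter]
      by_cases h2 : i ∈ a.items
      · by_cases h3 : slotOf (a.items, a.start) i < S.t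
        · simp [h2, h3, not_le.2 h3]
          ring
        · simp [h2, h3, not_lt.1 h3]
          ring
      · simp [h2]
  rw [hbp, blockPieces_none hb, hs, ldOf_singleton]
  change ldOf (S.past + _) i + ldOf 0 i + _ + ldOf (S.live.map _) i = _
  rw [ldOf_add, ldOf_zero]
  have := key S.live
  dsimp only
  split_ifs <;> linarith

theorem op_evict (hs : S.susp = 0) (col col' : ℕ) (A : Finset ℕ) (P : Prop) :
    ((S.evict k n c col A P).view k n c col').op = (S.view k n c col').cut.op := by
  change Multiset.filter _ (0 + Multiset.map _ (Multiset.map _ S.live)) =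
    Multiset.map _ (S.view k n c col').op
  rw [zero_add, view_op_of_none hs, Multiset.map_map]
  exact filter_map_congr (fun p _ => Iff.rfl) (fun p _ _ => rfl)

theorem view_evict_of_ne {S' : State} (hb : S.block = none) (hs : S.susp = 0) {col col' : ℕ}
    (h : col' ≠ col) {A : Finset ℕ} (hA : A ⊆ colorItems n c col) {P : Prop}
    (hS' : S'.view k n c col' = (S.evict k n c col A P).view k n c col') :
    S'.view k n c col' = (S.view k n c col').cut := by
  rw [hS']
  refine view_congr rfl (fun i hi => (view_st (k := k) (S := S) hi).symm) (fun i hi => view_st_of_notMem (k := k) (S := S) hi)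
    (fun i hi => ?_) (fun i hi => view_ld_of_notMem (k := k) (S := S) hi) (op_evict hs _ _ _ _) rfl
    (fun b => resetColor_of_ne h b) ?_ ?_ ?_
  · rw [load_evict hb hs, if_neg (fun hiA => h (color_eq hi (hA hiA)))]
    exact (view_ld (k := k) hi).symm
  · exact ⟨fun _ => trivial, fun _ hn => by simp [evict] at hn⟩
  · constructor
    · rintro ⟨p, hp, hc⟩
      simp only [evict, Option.some.injEq] at hp
      subst hp
      exact absurd hc.symm h
    · rintro ⟨p, hp, hc⟩
      simp [hb] at hp
  · constructor
    · rintro ⟨_, p, hp, hc⟩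
      simp only [evict, Option.some.injEq] at hp
      subst hp
      exact absurd hc.symm h
    · rintro ⟨_, p, hp, hc⟩
      simp [hb] at hp

theorem view_evict_self (hb : S.block = none) (hs : S.susp = 0) (col : ℕ)
    {A : Finset ℕ} (hA : A ⊆ colorItems n c col) (P : Prop) :
    (S.evict k n c col A P).view k n c col =
      { (S.view k n c col).cut.sat A P with sg := fun _ => 0 } := by
  refine view_congr rfl (fun i hi => (view_st (k := k) (S := S) hi).symm) (fun i hi => view_st_of_notMem (k := k) (S := S) hi)
    (fun i hi => ?_) (fun i hi => ?_) (op_evict hs _ _ _ _) rfl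
    (fun b => resetColor_self b) ?_ ?_ ?_
  · rw [load_evict hb hs]
    change _ = if i ∈ A then (S.view k n c col).ld i + 1 else (S.view k n c col).ld i
    rw [view_ld hi]
  · change (if i ∈ A then _ else (S.view k n c col).ld i) = _
    rw [if_neg (fun h => hi (hA h)), view_ld_of_notMem hi]
  · exact ⟨fun _ => trivial, fun _ hn => by simp [evict] at hn⟩
  · exact ⟨fun _ => trivial, fun _ => ⟨_, rfl, rfl⟩⟩
  · exact ⟨fun h => h.1, fun h => ⟨h, _, rfl, rfl⟩⟩

theorem view_evictIntegral_self (hb : S.block = none) (hs : S.susp = 0) (col : ℕ) :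
    (S.evictIntegral k n c col).view k n c col = (S.view k n c col).evInt (colorItems n c col) := by
  have := view_evict_self (k := k) (n := n) (c := c) hb hs col (A := S.act n c col)
    (fun i hi => mem_colorItems_of_act hi) True
  unfold ColorView.evInt
  rw [view_act]
  exact this

theorem view_evictIntegral_of_ne (hb : S.block = none) (hs : S.susp = 0) {col col' : ℕ}
    (h : col' ≠ col) :
    (S.evictIntegral k n c col).view k n c col' = (S.view k n c col').cut :=
  view_evict_of_ne hb hs h (A := S.act n c col) (fun _ hi => mem_colorItems_of_act hi)
    (P := True) rfl

theorem view_evictFrozen_self (hb : S.block = none) (hs : S.susp = 0) {col : ℕ}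
    (hne : (S.frz n c col).Nonempty) :
    (S.evictFrozen k n c col).view k n c col = (S.view k n c col).evFrz (colorItems n c col) := by
  have := view_evict_self (k := k) (n := n) (c := c) hb hs col (A := S.frz n c col)
    (fun i hi => mem_colorItems_of_frz hi) False
  unfold ColorView.evFrz evictFrozen
  rw [view_frz, if_pos hne]
  refine ColorView.eq_of rfl (fun i => ?_) (fun i => ?_) ?_ ?_ (fun i => ?_) ?_ ?_ ?_
  · exact congrFun (congrArg ColorView.st this) i
  · exact congrFun (congrArg ColorView.ld this) i
  · have h := congrArg ColorView.op this
    exact h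
  · exact Function.update_self _ _ _
  · exact congrFun (congrArg ColorView.sg this) i
  · have h := congrArg ColorView.sus this
    exact iff_of_eq h
  · have h := congrArg ColorView.blk this
    exact iff_of_eq h
  · have h := congrArg ColorView.blkInt this
    exact iff_of_eq h

theorem view_evictFrozen_of_ne (hb : S.block = none) (hs : S.susp = 0) {col col' : ℕ}
    (h : col' ≠ col) (hne : (S.frz n c col).Nonempty) :
    (S.evictFrozen k n c col).view k n c col' = (S.view k n c col').cut := by
  refine view_evict_of_ne hb hs h (A := S.frz n c col) (fun i hi => mem_colorItems_of_frz hi)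
    (P := False) ?_
  unfold evictFrozen
  rw [if_pos hne]
  refine ColorView.eq_of rfl (fun i => rfl) (fun i => rfl) rfl ?_ (fun i => rfl) Iff.rfl Iff.rfl
    Iff.rfl
  exact Function.update_of_ne h _ _

theorem view_evictFrozen_self_empty {col : ℕ} (hne : ¬ (S.frz n c col).Nonempty) :
    (S.evictFrozen k n c col).view k n c col =
      { S.view k n c col with sg := fun _ => 0, en := 0 } := by
  unfold evictFrozen
  rw [if_neg hne]
  refine ColorView.eq_of rfl (fun i => rfl) (fun i => rfl) rfl ?_ (fun b => resetColor_self b)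
    Iff.rfl Iff.rfl Iff.rfl
  exact Function.update_self _ _ _

theorem view_evictFrozen_of_ne_empty {col col' : ℕ} (h : col' ≠ col)
    (hne : ¬ (S.frz n c col).Nonempty) :
    (S.evictFrozen k n c col).view k n c col' = S.view k n c col' := by
  unfold evictFrozen
  rw [if_neg hne]
  refine ColorView.eq_of rfl (fun i => rfl) (fun i => rfl) rfl ?_
    (fun b => resetColor_of_ne h b) Iff.rfl Iff.rfl Iff.rfl
  exact Function.update_of_ne h _ _

end State

end

end RBM

/-! ### The growth of the pseudo-primal variables -/

namespace RBM

noncomputable section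

open scoped Classical

/-! ### The pseudo-primal variables -/

/-- The derivative of `xhat`. -/
def xhatDeriv (k : ℕ) (σ : ℝ) : ℝ :=
  if σ < 1 then 1 / Real.log k else Real.exp (σ - 1) / Real.log k

/-- The linear and the exponential branch meet at 1 with equal values and equal slopes, so the
function is differentiable everywhere. -/
theorem hasDerivAt_xhat (k : ℕ) (σ : ℝ) : HasDerivAt (xhat k) (xhatDeriv k σ) σ := by
  have h1 : ∀ s, HasDerivAt (fun σ : ℝ => σ / Real.log k) (1 / Real.log k) s := fun s =>
    (hasDerivAt_id s).div_const _
  have h2 : ∀ s, HasDerivAt (fun σ : ℝ => Real.exp (σ - 1) / Real.log k)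
      (Real.exp (s - 1) / Real.log k) s := by
    intro s
    have := ((hasDerivAt_id s).sub_const 1).exp.div_const (Real.log k)
    simpa using this
  unfold xhatDeriv
  rcases lt_trichotomy σ 1 with h | h | h
  · rw [if_pos h]
    refine (h1 σ).congr_of_eventuallyEq ?_
    filter_upwards [Iio_mem_nhds h] with s hs
    exact if_pos hs
  · subst h
    rw [if_neg (lt_irrefl _), sub_self, Real.exp_zero]
    have hl : HasDerivWithinAt (xhat k) (1 / Real.log k) (Set.Iic 1) 1 := by
      refine (h1 1).hasDerivWithinAt.congr (fun s hs => ?_) ?_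
      · rcases eq_or_lt_of_le (Set.mem_Iic.1 hs) with rfl | hs
        · simp [xhat]
        · exact if_pos hs
      · simp [xhat]
    have hr : HasDerivWithinAt (xhat k) (1 / Real.log k) (Set.Ici 1) 1 := by
      have := (h2 1).hasDerivWithinAt (s := Set.Ici 1)
      rw [sub_self, Real.exp_zero] at this
      refine this.congr (fun s hs => ?_) ?_
      · exact if_neg (not_lt.2 hs)
      · simp [xhat]
    have := hl.union hr
    rwa [Set.Iic_union_Ici, hasDerivWithinAt_univ] at this
  · rw [if_neg (not_lt.2 h.le)]
    refine (h2 σ).congr_of_eventuallyEq ?_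
    filter_upwards [Ioi_mem_nhds h] with s hs
    exact if_neg (not_lt.2 (le_of_lt hs))

variable {k : ℕ}

theorem xhatDeriv_nonneg (hL : 0 < Real.log k) (σ : ℝ) : 0 ≤ xhatDeriv k σ := by
  unfold xhatDeriv
  split_ifs <;> positivity

theorem xhatDeriv_mono (hL : 0 < Real.log k) : Monotone (xhatDeriv k) := by
  intro σ σ' h
  unfold xhatDeriv
  split_ifs with h1 h2 h2
  · exact le_rfl
  · gcongr
    exact Real.one_le_exp (by linarith)
  · exact absurd (h.trans_lt h2) h1
  · gcongr

/-- The differential inequality behind the credit: the slope is 1 / ln k on the linear branch and x̂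
itself on the exponential one. -/
theorem xhatDeriv_le (hL : 0 < Real.log k) {σ : ℝ} (h : 0 ≤ σ) :
    xhatDeriv k σ ≤ 1 / Real.log k + xhat k σ := by
  unfold xhatDeriv xhat
  split_ifs
  · have : 0 ≤ σ / Real.log k := by positivity
    linarith
  · have : 0 ≤ 1 / Real.log k := by positivity
    linarith

theorem xhat_mono (hL : 0 < Real.log k) : Monotone (xhat k) :=
  monotone_of_deriv_nonneg (fun σ => (hasDerivAt_xhat k σ).differentiableAt)
    (fun σ => by rw [(hasDerivAt_xhat k σ).deriv]; exact xhatDeriv_nonneg hL σ)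

theorem hasDerivAt_xhat_linear (k : ℕ) (σ r μ : ℝ) :
    HasDerivAt (fun u : ℝ => xhat k (σ + r * u)) (xhatDeriv k (σ + r * μ) * r) μ := by
  have h : HasDerivAt (fun u : ℝ => σ + r * u) r μ := by
    simpa using ((hasDerivAt_id μ).const_mul r).const_add σ
  exact (hasDerivAt_xhat k (σ + r * μ)).comp μ h

/-! ### The rates of regular execution -/

/-- Finiteness makes the supremum defining the rate an upper bound for every batch. -/
theorem finite_batches (κ n : ℕ) (c : ℕ → ℕ) (col : ℕ) : {b | IsBatch κ n c col b}.Finite := by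
  refine Set.Finite.subset
    (((Finset.Icc 1 n).powerset ×ˢ Finset.range (κ + n + 1)).finite_toSet) ?_
  rintro b ⟨⟨i, hi⟩, h2, -, -, π, hπ, he⟩
  simp only [Finset.coe_product, Set.mem_prod, Finset.mem_coe, Finset.mem_powerset,
    Finset.mem_range]
  refine ⟨h2, ?_⟩
  have h1 := hπ.1.mapsTo (show i ∈ Set.Icc 1 n by simpa using h2 hi)
  have h3 := he i hi
  have h4 := (Set.mem_Icc.1 h1).2
  unfold slotOf at h3
  omega

namespace State

variable {n : ℕ} {c : ℕ → ℕ} {S : State}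

theorem colorRate_eq (col : ℕ) (μ : ℝ) : S.colorRate k n c col μ =
    sSup ((fun b => xhatDeriv k (S.sigma b + S.rate n b * μ) * S.rate n b) ''
      {b | IsBatch (smallBuffer k) n c col b}) := by
  unfold colorRate
  congr 2
  ext b
  exact (hasDerivAt_xhat_linear k (S.sigma b) (S.rate n b) μ).deriv

theorem le_colorRate {col : ℕ} {b : Batch} (hb : IsBatch (smallBuffer k) n c col b) (μ : ℝ) :
    xhatDeriv k (S.sigma b + S.rate n b * μ) * S.rate n b ≤ S.colorRate k n c col μ := by
  rw [colorRate_eq]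
  exact le_csSup (((finite_batches _ _ _ _).image _).bddAbove) ⟨b, hb, rfl⟩

theorem colorRate_le {col : ℕ} {μ D : ℝ} (hD : 0 ≤ D)
    (h : ∀ b, IsBatch (smallBuffer k) n c col b →
      xhatDeriv k (S.sigma b + S.rate n b * μ) * S.rate n b ≤ D) :
    S.colorRate k n c col μ ≤ D := by
  rw [colorRate_eq]
  refine Real.sSup_le ?_ hD
  rintro _ ⟨b, hb, rfl⟩
  exact h b hb

theorem colorRate_nonneg (hL : 0 < Real.log k) (col : ℕ) (μ : ℝ) :
    0 ≤ S.colorRate k n c col μ := by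
  rw [colorRate_eq]
  refine Real.sSup_nonneg ?_
  rintro _ ⟨b, -, rfl⟩
  exact mul_nonneg (xhatDeriv_nonneg hL _) (Nat.cast_nonneg _)

/-- Monotonicity in time provides integrability and lets the rate be bounded by its value at the end
of an interval. -/
theorem colorRate_mono (hL : 0 < Real.log k) (col : ℕ) : Monotone (S.colorRate k n c col) := by
  intro μ μ' h
  refine colorRate_le (colorRate_nonneg hL _ _) (fun b hb => le_trans ?_ (le_colorRate hb μ'))
  have := xhatDeriv_mono hL (show S.sigma b + S.rate n b * μ ≤ S.sigma b + S.rate n b * μ' by gcongr)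
  gcongr

theorem colorWeight_nonneg (hL : 0 < Real.log k) (col : ℕ) {δ : ℝ} (hδ : 0 ≤ δ) :
    0 ≤ S.colorWeight k n c col δ :=
  intervalIntegral.integral_nonneg hδ (fun _ _ => colorRate_nonneg hL _ _)

theorem colorWeight_le (hL : 0 < Real.log k) {col : ℕ} {δ D : ℝ} (hδ : 0 ≤ δ) (hD : 0 ≤ D)
    (h : ∀ b, IsBatch (smallBuffer k) n c col b →
      xhatDeriv k (S.sigma b + S.rate n b * δ) * S.rate n b ≤ D) :
    S.colorWeight k n c col δ ≤ δ * D := by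
  have h1 : S.colorWeight k n c col δ ≤ ∫ _ in (0 : ℝ)..δ, D := by
    refine intervalIntegral.integral_mono_on hδ (colorRate_mono hL col).intervalIntegrable
      intervalIntegrable_const (fun μ hμ => ?_)
    exact (colorRate_mono hL col hμ.2).trans (colorRate_le hD h)
  simpa using h1

/-- The weight is the integral of a rate that is at least the derivative of x̂ for each single
batch. -/
theorem xhat_le_add_colorWeight (hL : 0 < Real.log k) {col : ℕ} {b : Batch}
    (hb : IsBatch (smallBuffer k) n c col b) {δ : ℝ} (hδ : 0 ≤ δ) :
    xhat k (S.sigma b + S.rate n b * δ) ≤ xhat k (S.sigma b) + S.colorWeight k n c col δ := by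
  have hmono : Monotone (fun μ : ℝ => xhatDeriv k (S.sigma b + S.rate n b * μ) * S.rate n b) := by
    intro μ μ' h
    have := xhatDeriv_mono hL
      (show S.sigma b + S.rate n b * μ ≤ S.sigma b + S.rate n b * μ' by gcongr)
    dsimp only
    gcongr
  have h1 := intervalIntegral.integral_eq_sub_of_hasDerivAt (a := 0) (b := δ)
    (fun μ _ => hasDerivAt_xhat_linear k (S.sigma b) (S.rate n b) μ) hmono.intervalIntegrable
  have h2 := intervalIntegral.integral_mono_on (μ := MeasureTheory.volume) hδ
    hmono.intervalIntegrable
    (colorRate_mono (S := S) (n := n) (c := c) hL col).intervalIntegrable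
    (fun μ _ => le_colorRate hb μ)
  rw [h1, mul_zero, add_zero] at h2
  have h3 : S.colorWeight k n c col δ = ∫ μ in (0 : ℝ)..δ, S.colorRate k n c col μ := rfl
  linarith

theorem continuous_colorWeight (hL : 0 < Real.log k) (col : ℕ) :
    Continuous (S.colorWeight k n c col) :=
  intervalIntegral.continuous_primitive (fun _ _ => (colorRate_mono hL col).intervalIntegrable) 0

theorem colorWeight_zero (col : ℕ) : S.colorWeight k n c col 0 = 0 :=
  intervalIntegral.integral_same

end State

end

end RBM

/-! ### Global invariants: mass, slots and blocks -/

namespace RBM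

noncomputable section

open scoped Classical

/-! ### The mass of scheduled pieces -/

/-- The same mass can be summed over items, as total load, or over slots; comparing the two counts
gives the size of B. -/
def area (s : Multiset Piece) : ℝ := (s.map (fun p : Piece => p.weight * (p.items.card : ℝ))).sum

/-- The mass of the part of the pieces that precedes slot `t`. -/
def elapsed (t : ℝ) (s : Multiset Piece) : ℝ := (s.map (fun p : Piece => p.weight * (t - p.start))).sum

theorem area_add (s s' : Multiset Piece) : area (s + s') = area s + area s' := by simp [area]

theorem area_zero : area 0 = 0 := by simp [area]

theorem area_singleton (p : Piece) : area {p} = p.weight * p.items.card := by simp [area]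

theorem elapsed_add (t : ℝ) (s s' : Multiset Piece) :
    elapsed t (s + s') = elapsed t s + elapsed t s' := by simp [elapsed]

theorem elapsed_zero (t : ℝ) : elapsed t 0 = 0 := by simp [elapsed]

theorem elapsed_singleton (t : ℝ) (p : Piece) : elapsed t {p} = p.weight * (t - p.start) := by
  simp [elapsed]

theorem elapsed_eq_zero {t : ℕ} {s : Multiset Piece} (h : ∀ p ∈ s, p.start = t) :
    elapsed t s = 0 := by
  refine Multiset.sum_eq_zero ?_
  simp only [Multiset.mem_map]
  rintro _ ⟨p, hp, rfl⟩
  rw [h p hp]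
  ring

theorem elapsed_succ (t : ℝ) (s : Multiset Piece) : elapsed (t + 1) s = elapsed t s + wt s := by
  unfold elapsed wt
  rw [← Multiset.sum_map_add]
  congr 1
  refine Multiset.map_congr rfl (fun p _ => ?_)
  ring

theorem elapsed_map {t : ℝ} {s : Multiset Piece} {f : Piece → Piece}
    (hw : ∀ p ∈ s, (f p).weight = p.weight) (hs : ∀ p ∈ s, (f p).start = p.start) :
    elapsed t (s.map f) = elapsed t s := by
  unfold elapsed
  rw [Multiset.map_map]
  congr 1
  exact Multiset.map_congr rfl (fun p hp => by simp [hw p hp, hs p hp])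

theorem area_eq_elapsed {t : ℕ} {s : Multiset Piece} (h : ∀ p ∈ s, p.nextSlot = t) :
    area s = elapsed t s := by
  unfold area elapsed
  congr 1
  refine Multiset.map_congr rfl (fun p hp => ?_)
  rw [← h p hp]
  unfold Piece.nextSlot
  push_cast
  ring

theorem sum_ldOf {n : ℕ} {s : Multiset Piece} (h : ∀ p ∈ s, p.items ⊆ Finset.Icc 1 n) :
    ∑ i ∈ Finset.Icc 1 n, ldOf s i = area s := by
  induction s using Multiset.induction with
  | empty => simp [ldOf_zero, area_zero]
  | cons a s ih =>
    have ih := ih (fun p hp => h p (Multiset.mem_cons_of_mem hp))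
    have ha := h a (Multiset.mem_cons_self _ _)
    rw [← Multiset.singleton_add, area_add, area_singleton, ← ih]
    simp_rw [ldOf_add, ldOf_singleton]
    rw [Finset.sum_add_distrib, ← Finset.sum_filter, Finset.sum_const, nsmul_eq_mul,
      Finset.filter_mem_eq_inter, Finset.inter_eq_right.2 ha, mul_comm]

theorem colorItems_subset {n : ℕ} {c : ℕ → ℕ} {col : ℕ} : colorItems n c col ⊆ Finset.Icc 1 n :=
  Finset.filter_subset _ _

namespace State

/-- The invariants that involve all colors. -/
structure Shape (k n : ℕ) (c : ℕ → ℕ) (S : State) : Prop where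
  block_live : ∀ p, S.block = some p → S.live = 0
  block_ok : ∀ p, S.block = some p → p.weight = 1 ∧ p.start ≤ S.t ∧ S.t ≤ p.nextSlot ∧
    (∀ i ∈ p.items, i < S.t) ∧ p.items ⊆ colorItems n c p.color
  susp_none : S.block = none → S.susp = 0
  past_ok : ∀ p ∈ S.past, p.nextSlot ≤ S.t ∧ 0 ≤ p.weight ∧ p.items ⊆ colorItems n c p.color
  live_le : wt S.live ≤ 1
  susp_le : wt S.susp ≤ 1
  -- Says that the slots k + 1, ..., t - 1 are, in total, filled with weight exactly 1 each.
  mass : area S.past + elapsed S.t S.live + elapsed S.t S.blockPieces = S.t - 1 - k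
  -- Ensures that Case 5 assigns ȳ to items that had none, so that the dual cost gains the full 1/2.
  ybar : ∀ i ∈ Finset.Icc 1 n, S.load i < 1 → S.ybar i = 0

variable {k n : ℕ} {c : ℕ → ℕ} {S : State} {K : ℝ}

theorem shape_init : (State.init k).Shape k n c where
  block_live := by simp [State.init]
  block_ok := by simp [State.init]
  susp_none := by simp [State.init]
  past_ok := by simp [State.init]
  live_le := by simp [State.init, wt]
  susp_le := by simp [State.init, wt]
  mass := by simp [State.init, area, elapsed, blockPieces]
  ybar := by simp [State.init]

/-- The structural invariants of all colors. -/
def ViewInv (k n : ℕ) (c : ℕ → ℕ) (K : ℝ) (S : State) : Prop :=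
  ∀ col, (S.view k n c col).Inv (colorItems n c col) k K

theorem ViewInv.live (h : S.ViewInv k n c K) {p : Piece} (hp : p ∈ S.live) :
    p.items ⊆ colorItems n c p.color ∧ 0 ≤ p.weight ∧ p.start ≤ S.t ∧ S.t ≤ p.nextSlot :=
  have hm := mem_view_op_of_live (k := k) (n := n) (c := c) hp
  ⟨(h _).items_sub p hm, (h _).weight_nonneg p hm, (h _).start_le p hm, (h _).le_next p hm⟩

theorem ViewInv.susp (h : S.ViewInv k n c K) {p : Piece} (hp : p ∈ S.susp) :
    p.items ⊆ colorItems n c p.color ∧ 0 ≤ p.weight :=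
  have hm := mem_view_op_of_susp (k := k) (n := n) (c := c) hp
  ⟨(h p.color).items_sub ({ p with start := S.t } : Piece) hm,
    (h p.color).weight_nonneg ({ p with start := S.t } : Piece) hm⟩

theorem ViewInv.not_mem_items (h : S.ViewInv k n c K) {p : Piece} (hp : p ∈ S.live + S.susp)
    {col : ℕ} (hc : p.color = col) {i : ℕ} (hi : i ∈ S.frz n c col) : i ∉ p.items := by
  subst hc
  intro hip
  have hst : S.status i = .frozen := (Finset.mem_filter.1 hi).2
  have hX := mem_colorItems_of_frz hi
  have : (S.view k n c p.color).st i = .fractional := by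
    rcases Multiset.mem_add.1 hp with hp | hp
    · exact (h _).items_st p (mem_view_op_of_live hp) i hip
    · exact (h p.color).items_st _ (mem_view_op_of_susp hp) i hip
  rw [view_st hX, hst] at this
  cases this

theorem ViewInv.W_nonneg (h : S.ViewInv k n c K) (col : ℕ) : 0 ≤ (S.view k n c col).W :=
  ColorView.W_nonneg (h col).weight_nonneg

theorem Shape.of_eq (h : S.Shape k n c) {S' : State} (ht : S'.t = S.t) (hp : S'.past = S.past)
    (hl : S'.live = S.live) (hs : S'.susp = S.susp) (hb : S'.block = S.block)
    (hy : S'.ybar = S.ybar) : S'.Shape k n c := by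
  have hbp : S'.blockPieces = S.blockPieces := by unfold blockPieces; rw [hb]
  have hload : ∀ i, S'.load i = S.load i := fun i => by rw [load_eq, load_eq, hp, hl, hs, hbp]
  refine ⟨?_, ?_, ?_, ?_, ?_, ?_, ?_, ?_⟩
  · rw [hb, hl]; exact h.block_live
  · rw [hb, ht]; exact h.block_ok
  · rw [hb, hs]; exact h.susp_none
  · rw [hp, ht]; exact h.past_ok
  · rw [hl]; exact h.live_le
  · rw [hs]; exact h.susp_le
  · rw [hp, ht, hl, hbp]; exact h.mass
  · intro i hi hlt
    rw [hload] at hlt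
    rw [hy]
    exact h.ybar i hi hlt

theorem Shape.replenish (h : S.Shape k n c) (hv : S.ViewInv k n c K) (col : ℕ) :
    (S.replenish n c col).Shape k n c := by
  have hw : ∀ p : Piece, (if p.color = col then
      ({ p with items := p.items ∪ S.frz n c col } : Piece) else p).weight = p.weight := by
    intro p
    split_ifs <;> rfl
  have hst : ∀ p : Piece, (if p.color = col then
      ({ p with items := p.items ∪ S.frz n c col } : Piece) else p).start = p.start := by
    intro p
    split_ifs <;> rfl
  exact {
    block_live := by
      intro p hp
      change S.live.map _ = 0
      rw [h.block_live p hp, Multiset.map_zero]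
    block_ok := h.block_ok
    susp_none := by
      intro hb
      change S.susp.map _ = 0
      rw [h.susp_none hb, Multiset.map_zero]
    past_ok := h.past_ok
    live_le := by
      change wt (S.live.map _) ≤ 1
      rw [wt_map (fun p _ => hw p)]
      exact h.live_le
    susp_le := by
      change wt (S.susp.map _) ≤ 1
      rw [wt_map (fun p _ => hw p)]
      exact h.susp_le
    mass := by
      change area S.past + elapsed S.t (S.live.map _) + elapsed S.t S.blockPieces = _
      rw [elapsed_map (fun p _ => hw p) (fun p _ => hst p)]
      exact h.mass
    ybar := by
      intro i hi hlt
      refine h.ybar i hi (lt_of_le_of_lt ?_ hlt)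
      rw [load_replenish (k := k) col i (fun p hp hc hif => hv.not_mem_items hp hc hif)]
      have := hv.W_nonneg col
      split_ifs <;> linarith }

theorem Shape.someEnded_none (hb : S.block = none) :
    S.SomeEnded ↔ ∃ p ∈ S.live, p.nextSlot ≤ S.t := by
  unfold SomeEnded
  rw [blockPieces_none hb, add_zero]

theorem Shape.someEnded_some (h : S.Shape k n c) {p : Piece} (hb : S.block = some p) :
    S.SomeEnded ↔ p.nextSlot ≤ S.t := by
  unfold SomeEnded
  rw [blockPieces_some hb, h.block_live p hb, zero_add]
  simp

theorem Shape.closeEnded_none (h : S.Shape k n c) (hv : S.ViewInv k n c K) (hb : S.block = none) :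
    (S.closeEnded n c).Shape k n c := by
  obtain ⟨h1, h2, h3, h4⟩ := State.closeEnded_none (n := n) (c := c) hb (h.susp_none hb)
  refine ⟨?_, ?_, fun _ => h3, ?_, ?_, ?_, ?_, ?_⟩
  · rw [h4]; simp
  · rw [h4]; simp
  · rw [h1]
    intro p hp
    rcases Multiset.mem_add.1 hp with hp | hp
    · exact h.past_ok p hp
    · obtain ⟨hp, he⟩ := Multiset.mem_filter.1 hp
      have := hv.live hp
      exact ⟨he, this.2.1, this.1⟩
  · rw [h2]
    exact (wt_filter_le (fun p hp => (hv.live hp).2.1) _).trans h.live_le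
  · rw [h3, wt_zero]
    norm_num
  · have hm := h.mass
    rw [h1, h2, blockPieces_none h4, area_add]
    rw [blockPieces_none hb] at hm
    -- A piece is closed exactly when the slot reaches its end, so its whole mass has elapsed.
    have e1 : area (S.live.filter (fun p => p.nextSlot ≤ S.t)) =
        elapsed S.t (S.live.filter (fun p => p.nextSlot ≤ S.t)) := by
      refine area_eq_elapsed (fun p hp => ?_)
      obtain ⟨hp, he⟩ := Multiset.mem_filter.1 hp
      exact le_antisymm he (hv.live hp).2.2.2
    have e2 : S.live.filter (fun p => S.t < p.nextSlot) =
        S.live.filter (fun p => ¬ p.nextSlot ≤ S.t) :=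
      Multiset.filter_congr (fun p _ => not_le.symm)
    have e3 : elapsed S.t S.live = elapsed S.t (S.live.filter (fun p => p.nextSlot ≤ S.t)) +
        elapsed S.t (S.live.filter (fun p => ¬ p.nextSlot ≤ S.t)) := by
      rw [← elapsed_add, Multiset.filter_add_not]
    change _ + elapsed S.t _ + elapsed S.t _ = (S.t : ℝ) - 1 - k
    rw [e1, e2]
    linarith
  · intro i hi hlt
    rw [load_closeEnded_none hb (h.susp_none hb)] at hlt
    exact h.ybar i hi hlt

theorem Shape.closeEnded_some (h : S.Shape k n c) {p : Piece} (hb : S.block = some p)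
    (he : p.nextSlot ≤ S.t) : (S.closeEnded n c).Shape k n c := by
  have hl := h.block_live p hb
  obtain ⟨h1, h2, h3, h4⟩ := State.closeEnded_some (n := n) (c := c) hb hl he
  obtain ⟨hw, hs, hn, hi, hX⟩ := h.block_ok p hb
  refine ⟨?_, ?_, fun _ => h3, ?_, ?_, ?_, ?_, ?_⟩
  · rw [h4]; simp
  · rw [h4]; simp
  · rw [h1]
    intro q hq
    rcases Multiset.mem_add.1 hq with hq | hq
    · exact h.past_ok q hq
    · rw [Multiset.mem_singleton.1 hq]
      exact ⟨he, by rw [hw]; norm_num, hX⟩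
  · rw [h2, wt_shift]
    exact h.susp_le
  · rw [h3, wt_zero]
    norm_num
  · have hm := h.mass
    rw [h1, h2, blockPieces_none h4, area_add]
    rw [blockPieces_some hb, hl, elapsed_zero] at hm
    change _ + elapsed S.t _ + elapsed S.t _ = (S.t : ℝ) - 1 - k
    rw [elapsed_eq_zero (s := S.susp.map _) (fun q hq => by
      obtain ⟨q', -, rfl⟩ := Multiset.mem_map.1 hq
      rfl), elapsed_zero, area_eq_elapsed (t := S.t) (s := {p}) (fun q hq => by
      rw [Multiset.mem_singleton.1 hq]
      exact le_antisymm he hn)]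
    linarith
  · intro i hi hlt
    rw [load_closeEnded_some hb hl he] at hlt
    exact h.ybar i hi hlt

/-! ### The current slot -/

theorem Shape.slotLoad_le (h : S.Shape k n c) (hv : S.ViewInv k n c K) (hb : S.block = none) :
    S.slotLoad S.t ≤ wt S.live := by
  change wt (S.placed.filter _) ≤ _
  unfold placed
  rw [h.susp_none hb, blockPieces_none hb, Multiset.map_zero, add_zero, add_zero,
    Multiset.filter_add, wt_add]
  have : S.past.filter (fun p => p.start ≤ S.t ∧ S.t < p.nextSlot) = 0 := by
    rw [Multiset.filter_eq_nil]
    intro p hp hc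
    have := (h.past_ok p hp).1
    omega
  rw [this, wt_zero, zero_add]
  exact wt_filter_le (fun p hp => (hv.live hp).2.1) _

theorem Shape.slotLoad_eq (h : S.Shape k n c) (hv : S.ViewInv k n c K) (hb : S.block = none)
    (he : ¬ S.SomeEnded) : S.slotLoad S.t = wt S.live := by
  rw [Shape.someEnded_none hb] at he
  refine le_antisymm (h.slotLoad_le hv hb) ?_
  change _ ≤ wt (S.placed.filter _)
  unfold placed
  rw [h.susp_none hb, blockPieces_none hb, Multiset.map_zero, add_zero, add_zero,
    Multiset.filter_add, wt_add]
  have h1 : S.live.filter (fun p => p.start ≤ S.t ∧ S.t < p.nextSlot) = S.live := by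
    rw [Multiset.filter_eq_self]
    intro p hp
    refine ⟨(hv.live hp).2.2.1, ?_⟩
    by_contra hn
    exact he ⟨p, hp, not_lt.1 hn⟩
  rw [h1]
  have := wt_nonneg (s := S.past.filter (fun p => p.start ≤ S.t ∧ S.t < p.nextSlot))
    (fun p hp => (h.past_ok p (Multiset.mem_filter.1 hp).1).2.1)
  linarith

/-- A weight-1 block that has not ended fills slot t by itself, so the slot would be tight. -/
theorem Shape.block_none (h : S.Shape k n c) (hv : S.ViewInv k n c K) (he : ¬ S.SomeEnded)
    (ht : ¬ S.Tight) : S.block = none := by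
  by_contra hb
  obtain ⟨p, hp⟩ := Option.ne_none_iff_exists'.1 hb
  rw [h.someEnded_some hp, not_le] at he
  obtain ⟨hw, hs, -⟩ := h.block_ok p hp
  refine ht ?_
  change 1 ≤ wt (S.placed.filter _)
  unfold placed
  rw [blockPieces_some hp, hp]
  dsimp only [Option.elim]
  rw [Multiset.filter_add, Multiset.filter_add, wt_add, wt_add, Multiset.filter_singleton,
    if_pos ⟨hs, he⟩, wt_singleton, hw]
  have h1 : 0 ≤ wt ((S.past + S.live).filter (fun p => p.start ≤ S.t ∧ S.t < p.nextSlot)) := by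
    refine wt_nonneg (fun q hq => ?_)
    rcases Multiset.mem_add.1 (Multiset.mem_filter.1 hq).1 with hq | hq
    · exact (h.past_ok q hq).2.1
    · exact (hv.live hq).2.1
  have h2 : 0 ≤ wt ((S.susp.map (fun q => ({ q with start := p.nextSlot } : Piece))).filter
      (fun p => p.start ≤ S.t ∧ S.t < p.nextSlot)) := by
    refine wt_nonneg (fun q hq => ?_)
    obtain ⟨q', hq', rfl⟩ := Multiset.mem_map.1 (Multiset.mem_filter.1 hq).1
    exact (hv.susp hq').2
  linarith

theorem Shape.advance (h : S.Shape k n c) (hv : S.ViewInv k n c K) (he : ¬ S.SomeEnded)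
    (ht : S.Tight) : (S.advance n c).Shape k n c := by
  have ht1 : 1 ≤ S.t := by
    have : k + 1 ≤ S.t := (hv 0).t_ge
    omega
  have hmap : ∀ q, (S.advance n c).block = some q → ∃ p, S.block = some p ∧
      q = if S.t ≤ n ∧ p.color = c S.t then { p with items := insert S.t p.items } else p := by
    intro q hq
    change S.block.map _ = some q at hq
    obtain ⟨p, hp, rfl⟩ := Option.map_eq_some_iff.1 hq
    exact ⟨p, hp, rfl⟩
  have hnone : (S.advance n c).block = none → S.block = none := by
    intro hn
    change S.block.map _ = none at hn
    simpa using hn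
  exact {
    block_live := by
      intro q hq
      obtain ⟨p, hp, -⟩ := hmap q hq
      exact h.block_live p hp
    block_ok := by
      intro q hq
      obtain ⟨p, hp, rfl⟩ := hmap q hq
      obtain ⟨hw, hs, hn, hi, hX⟩ := h.block_ok p hp
      rw [h.someEnded_some hp, not_le] at he
      change _ ∧ _ ≤ S.t + 1 ∧ S.t + 1 ≤ _ ∧ (∀ i ∈ _, i < S.t + 1) ∧ _
      split_ifs with hc
      · refine ⟨hw, by dsimp only; omega, ?_, ?_, ?_⟩
        · have : p.items.card ≤ (insert S.t p.items).card :=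
            Finset.card_le_card (Finset.subset_insert _ _)
          unfold Piece.nextSlot at he ⊢
          dsimp only
          omega
        · intro i hi'
          rcases Finset.mem_insert.1 hi' with rfl | hi'
          · omega
          · have := hi i hi'
            omega
        · intro i hi'
          rcases Finset.mem_insert.1 hi' with rfl | hi'
          · exact mem_colorItems.2 ⟨⟨ht1, hc.1⟩, hc.2.symm⟩
          · exact hX hi'
      · exact ⟨hw, by omega, by omega, fun i hi' => by have := hi i hi'; omega, hX⟩
    susp_none := fun hb => h.susp_none (hnone hb)
    past_ok := fun p hp => ⟨(h.past_ok p hp).1.trans (Nat.le_succ _), (h.past_ok p hp).2⟩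
    live_le := h.live_le
    susp_le := h.susp_le
    mass := by
      have hm := h.mass
      change area S.past + elapsed ((S.t + 1 : ℕ) : ℝ) S.live +
        elapsed ((S.t + 1 : ℕ) : ℝ) (S.advance n c).blockPieces = ((S.t + 1 : ℕ) : ℝ) - 1 - k
      push_cast
      cases hb : S.block with
      | none =>
        have hb' : (S.advance n c).block = none := by
          change S.block.map _ = none
          rw [hb]
          rfl
        -- A tight slot is never overfull, so the elapsed mass grows by exactly 1.
        have h1 : wt S.live = 1 := le_antisymm h.live_le (le_trans ht (h.slotLoad_le hv hb))
        rw [blockPieces_none hb, elapsed_zero] at hm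
        rw [blockPieces_none hb', elapsed_zero, elapsed_succ, h1]
        linarith
      | some p =>
        have hb' : ∃ q, (S.advance n c).block = some q ∧ q.weight = p.weight ∧
            q.start = p.start := by
          refine ⟨_, show S.block.map _ = _ by rw [hb]; rfl, ?_, ?_⟩ <;>
            (dsimp only; split_ifs <;> rfl)
        obtain ⟨q, hq, hqw, hqs⟩ := hb'
        rw [blockPieces_some hb, h.block_live p hb, elapsed_zero, elapsed_singleton,
          (h.block_ok p hb).1] at hm
        rw [blockPieces_some hq, h.block_live p hb, elapsed_zero, elapsed_singleton, hqw, hqs,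
          (h.block_ok p hb).1]
        linarith
    ybar := by
      intro i hi hlt
      refine h.ybar i hi (lt_of_le_of_lt ?_ hlt)
      rw [load_advance]
      · split_ifs <;> linarith
      · intro p hp
        exact ⟨(h.block_ok p hp).1, fun hm => lt_irrefl _ ((h.block_ok p hp).2.2.2.1 _ hm)⟩ }

theorem Shape.add_live (h : S.Shape k n c) (hb : S.block = none) {S' : State}
    {s : Multiset Piece} (ht : S'.t = S.t) (hp : S'.past = S.past) (hl : S'.live = S.live + s)
    (hs : S'.susp = S.susp) (hb' : S'.block = S.block) (hy : S'.ybar = S.ybar)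
    (hs0 : ∀ p ∈ s, 0 ≤ p.weight ∧ p.start = S.t) (hle : wt S.live + wt s ≤ 1) :
    S'.Shape k n c := by
  have hbp : S'.blockPieces = S.blockPieces := by unfold blockPieces; rw [hb']
  have hload : ∀ i, S.load i ≤ S'.load i := fun i => by
    rw [load_eq, load_eq, hp, hl, hs, hbp, ldOf_add]
    linarith [ldOf_nonneg (fun p hp => (hs0 p hp).1) i]
  refine ⟨?_, ?_, ?_, ?_, ?_, ?_, ?_, ?_⟩
  · rw [hb', hb]; simp
  · rw [hb', hb]; simp
  · rw [hb', hs]; exact h.susp_none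
  · rw [hp, ht]; exact h.past_ok
  · rw [hl, wt_add]; exact hle
  · rw [hs]; exact h.susp_le
  · rw [hp, ht, hl, hbp, elapsed_add, elapsed_eq_zero (fun p hp => (hs0 p hp).2), add_zero]
    exact h.mass
  · intro i hi hlt
    rw [hy]
    exact h.ybar i hi ((hload i).trans_lt hlt)

/-- The passed part of a piece has one item for each slot from its start up to t. -/
theorem area_passed {s : Multiset Piece} {t : ℕ}
    (hs : ∀ p ∈ s, p.start ≤ t ∧ t ≤ p.nextSlot) :
    area ((s.map (fun p => ({ p with
      items := p.items.filter (fun i => slotOf (p.items, p.start) i < t) } : Piece))).filter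
        (fun p => p.items.Nonempty)) = elapsed t s := by
  induction s using Multiset.induction with
  | empty => simp [area, elapsed]
  | cons a s ih =>
    have ih := ih (fun p hp => hs p (Multiset.mem_cons_of_mem hp))
    have ha := hs a (Multiset.mem_cons_self _ _)
    have hc := a.card_passed ha.1 ha.2
    rw [Multiset.map_cons, ← Multiset.singleton_add a s, elapsed_add, elapsed_singleton, ← ih]
    have hcr : ((a.items.filter (fun i => slotOf (a.items, a.start) i < t)).card : ℝ) =
        t - a.start := by
      rw [hc, Nat.cast_sub ha.1]
    by_cases hne : (a.items.filter (fun i => slotOf (a.items, a.start) i < t)).Nonempty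
    · rw [Multiset.filter_cons_of_pos (p := fun p : Piece => p.items.Nonempty) _ hne,
        ← Multiset.singleton_add, area_add, area_singleton, hcr]
    · rw [Multiset.filter_cons_of_neg (p := fun p : Piece => p.items.Nonempty) _ hne]
      rw [Finset.not_nonempty_iff_eq_empty] at hne
      rw [hne, Finset.card_empty, Nat.cast_zero] at hcr
      rw [← hcr]
      ring

theorem Shape.evict (h : S.Shape k n c) (hv : S.ViewInv k n c K) (hb : S.block = none) {col : ℕ}
    {A : Finset ℕ} {P : Prop} (hA : A ⊆ S.Bcol n c col) {S' : State} (ht : S'.t = S.t)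
    (hp : S'.past = (S.evict k n c col A P).past) (hl : S'.live = 0)
    (hs : S'.susp = (S.evict k n c col A P).susp)
    (hb' : S'.block = (S.evict k n c col A P).block)
    (hy : ∀ i, i ∉ A → S'.ybar i = S.ybar i) : S'.Shape k n c := by
  have hbp : S'.blockPieces = (S.evict k n c col A P).blockPieces := by
    unfold blockPieces; rw [hb']
  have hload : ∀ i, S'.load i = (S.evict k n c col A P).load i := fun i => by
    rw [load_eq, load_eq, hp, hl, hs, hbp]
    rfl
  have hload0 : ∀ i, 0 ≤ S.load i := by
    intro i
    rw [load_eq, blockPieces_none hb, h.susp_none hb, ldOf_zero]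
    have h1 := ldOf_nonneg (fun p hp => (h.past_ok p hp).2.1) i
    have h2 := ldOf_nonneg (fun p hp => (hv.live hp).2.1) i
    linarith
  refine ⟨fun _ _ => hl, ?_, ?_, ?_, ?_, ?_, ?_, ?_⟩
  · rw [hb', ht]
    intro p hp
    simp only [State.evict, Option.some.injEq] at hp
    subst hp
    refine ⟨rfl, le_rfl, Nat.le_add_right _ _, fun i hi => ?_, fun i hi => ?_⟩
    · exact (Finset.mem_filter.1 (Finset.mem_filter.1 (hA hi)).1).2.1
    · exact mem_colorItems_of_Bcol (hA hi)
  · rw [hb']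
    intro hn
    simp [State.evict] at hn
  · rw [hp, ht]
    intro p hp
    change p ∈ S.past + _ at hp
    rcases Multiset.mem_add.1 hp with hp | hp
    · exact h.past_ok p hp
    · obtain ⟨q, hq, rfl⟩ := Multiset.mem_map.1 (Multiset.mem_filter.1 hp).1
      obtain ⟨h1, h2, h3, h4⟩ := hv.live hq
      refine ⟨?_, h2, (Finset.filter_subset _ _).trans h1⟩
      have := q.card_passed h3 h4
      unfold Piece.nextSlot
      dsimp only
      omega
  · rw [hl, wt_zero]
    norm_num
  · rw [hs]
    change wt (S.live.map _) ≤ 1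
    refine (le_of_eq ?_).trans h.live_le
    refine wt_map ?_
    exact fun _ _ => rfl
  · have hm := h.mass
    rw [blockPieces_none hb, elapsed_zero] at hm
    rw [hp, ht, hl, hbp, elapsed_zero]
    have e1 : (S.evict k n c col A P).blockPieces =
        {{ color := col, items := A, start := S.t, weight := 1, regular := False, rel := ∅ }} :=
      blockPieces_some rfl
    rw [e1, elapsed_eq_zero (fun q hq => by rw [Multiset.mem_singleton.1 hq])]
    change area (S.past + _) + 0 + 0 = _
    rw [area_add, area_passed (fun p hp => (hv.live hp).2.2)]
    linarith
  · intro i hi hlt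
    rw [hload, load_evict hb (h.susp_none hb)] at hlt
    split_ifs at hlt with hiA
    · linarith [hload0 i]
    · rw [hy i hiA]
      exact h.ybar i hi hlt

end State

end

end RBM

/-! ### Total weight, total load and the rate of the dual cost -/

namespace RBM

noncomputable section

open scoped Classical

/-- Grouping the pieces by items and start shows that the primal cost is just the total weight
placed. -/
theorem finsum_wt_fiber (s : Multiset Piece) (f : Piece → Batch) :
    (Function.support (fun b => wt (s.filter (fun p => f p = b)))).Finite ∧
      ∑ᶠ b, wt (s.filter (fun p => f p = b)) = wt s := by
  induction s using Multiset.induction with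
  | empty =>
    have : (fun b => wt ((0 : Multiset Piece).filter (fun p => f p = b))) = fun _ => 0 := by
      ext b
      simp [wt]
    rw [this]
    simp [wt]
  | cons a s ih =>
    have h1 : (fun b => wt ((a ::ₘ s).filter (fun p => f p = b))) =
        fun b => (if f a = b then a.weight else 0) + wt (s.filter (fun p => f p = b)) := by
      ext b
      by_cases h : f a = b
      · rw [Multiset.filter_cons_of_pos (p := fun p => f p = b) _ h, wt_cons, if_pos h]
      · rw [Multiset.filter_cons_of_neg (p := fun p => f p = b) _ h, if_neg h, zero_add]
    have h2 : (Function.support (fun b => if f a = b then a.weight else 0)).Finite := by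
      refine (Set.finite_singleton (f a)).subset (fun b hb => ?_)
      by_contra hn
      exact hb (if_neg (fun he => hn he.symm))
    rw [h1]
    refine ⟨(h2.union ih.1).subset (Function.support_add _ _), ?_⟩
    rw [finsum_add_distrib h2 ih.1, ih.2, wt_cons,
      finsum_eq_single _ (f a) (fun b hb => if_neg (Ne.symm hb)), if_pos rfl]

namespace ColorView

variable {X : Finset ℕ} {V : ColorView} {k : ℕ} {K : ℝ}

/-- Open pieces are short. -/
theorem Inv.next_le (h : V.Inv X k K) (hK : 0 ≤ K) (hW : V.W < 1) {p : Piece} (hp : p ∈ V.op) :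
    (p.nextSlot : ℝ) ≤ V.t + 22 / 100 * K := by
  -- An integral color has no unsatisfied fractional item, so the whole rest of an open piece has
  -- load above `W` and `past` alone bounds it.
  by_cases hi : V.Int X
  · have h1 := h.past p hp
    have h2 : (p.rest V.t).filter (fun i => V.W < V.ld i) = p.rest V.t := by
      rw [Finset.filter_eq_self]
      intro i hir
      by_contra hn
      have him := p.rest_subset V.t hir
      exact h.int_frac hi ⟨i, mem_B.2 ⟨h.items_sub p hp him, h.items_lt p hp i him,
        (not_lt.1 hn).trans_lt hW⟩, h.items_st p hp i him⟩
    rw [h2] at h1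
    have h3 := p.card_rest (h.start_le p hp) (h.le_next p hp)
    rw [← h3]
    push_cast
    linarith
  · have h1 := h.rest_le hW hp
    by_cases hn : (V.act X).Nonempty
    · have := h.act_le (frac_of_nonempty hi hn)
      linarith
    · rw [Finset.not_nonempty_iff_eq_empty.1 hn, Finset.card_empty, Nat.cast_zero] at h1
      linarith

end ColorView

namespace State

variable {k n : ℕ} {c : ℕ → ℕ} {S : State} {K : ℝ}

theorem wt_placed : wt S.placed = wt S.past + wt S.live + wt S.blockPieces + wt S.susp := by
  unfold placed
  rw [wt_add, wt_add, wt_add]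
  congr 1
  exact wt_map (fun _ _ => rfl)

theorem primalCost_eq : S.primalCost = wt S.placed :=
  (finsum_wt_fiber S.placed (fun p => (p.items, p.start))).2

/-! ### The total load -/

/-- The mass of the parts of the scheduled pieces from the current slot on. -/
def excess (S : State) : ℝ :=
  area S.live + area S.blockPieces + area S.susp - elapsed S.t S.live - elapsed S.t S.blockPieces

/-- Counts the mass by items on the left and by slots on the right: before slot t it is known
exactly, and the remainder is the excess. -/
theorem Shape.sum_load (h : S.Shape k n c) (hv : S.ViewInv k n c K) :
    ∑ i ∈ Finset.Icc 1 n, S.load i = S.t - 1 - k + S.excess := by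
  simp_rw [load_eq, Finset.sum_add_distrib]
  rw [sum_ldOf (fun p hp => ((h.past_ok p hp).2.2).trans colorItems_subset),
    sum_ldOf (fun p hp => ((hv.live hp).1).trans colorItems_subset),
    sum_ldOf (s := S.susp) (fun p hp => ((hv.susp hp).1).trans colorItems_subset),
    sum_ldOf (s := S.blockPieces), ← h.mass]
  · unfold excess
    ring
  · intro p hp
    cases hb : S.block with
    | none => simp [blockPieces_none hb] at hp
    | some q =>
      rw [blockPieces_some hb, Multiset.mem_singleton] at hp
      rw [hp]
      exact (h.block_ok q hb).2.2.2.2.trans colorItems_subset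

theorem area_sub_elapsed (t : ℝ) (s : Multiset Piece) :
    area s - elapsed t s = (s.map (fun p : Piece => p.weight * (p.nextSlot - t))).sum := by
  unfold area elapsed
  rw [← Multiset.sum_map_sub]
  congr 1
  refine Multiset.map_congr rfl (fun p _ => ?_)
  unfold Piece.nextSlot
  push_cast
  ring

theorem area_sub_elapsed_nonneg {t : ℕ} {s : Multiset Piece}
    (h : ∀ p ∈ s, 0 ≤ p.weight ∧ t ≤ p.nextSlot) : 0 ≤ area s - elapsed t s := by
  rw [area_sub_elapsed]
  refine Multiset.sum_nonneg ?_
  simp only [Multiset.mem_map]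
  rintro _ ⟨p, hp, rfl⟩
  have : (t : ℝ) ≤ p.nextSlot := by exact_mod_cast (h p hp).2
  exact mul_nonneg (h p hp).1 (by linarith)

theorem area_sub_elapsed_le {t : ℕ} {s : Multiset Piece} {M : ℝ}
    (h : ∀ p ∈ s, 0 ≤ p.weight ∧ (p.nextSlot : ℝ) ≤ t + M) :
    area s - elapsed t s ≤ M * wt s := by
  rw [area_sub_elapsed]
  unfold wt
  rw [← Multiset.sum_map_mul_left]
  refine Multiset.sum_map_le_sum_map _ _ (fun p hp => ?_)
  rw [mul_comm]
  exact mul_le_mul_of_nonneg_right (by linarith [(h p hp).2]) (h p hp).1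

theorem Shape.excess_nonneg (h : S.Shape k n c) (hv : S.ViewInv k n c K) : 0 ≤ S.excess := by
  have h1 := area_sub_elapsed_nonneg (t := S.t) (s := S.live)
    (fun p hp => ⟨(hv.live hp).2.1, (hv.live hp).2.2.2⟩)
  have h2 := area_sub_elapsed_nonneg (t := S.t) (s := S.blockPieces) (fun p hp => by
    cases hb : S.block with
    | none => simp [blockPieces_none hb] at hp
    | some q =>
      rw [blockPieces_some hb, Multiset.mem_singleton] at hp
      rw [hp]
      obtain ⟨hw, -, hn, -⟩ := h.block_ok q hb
      exact ⟨by rw [hw]; norm_num, hn⟩)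
  have h3 : 0 ≤ area S.susp := by
    refine Multiset.sum_nonneg ?_
    simp only [Multiset.mem_map]
    rintro _ ⟨p, hp, rfl⟩
    exact mul_nonneg (hv.susp hp).2 (Nat.cast_nonneg _)
  unfold excess
  linarith

theorem Shape.excess_le (h : S.Shape k n c) (hv : S.ViewInv k n c K) (hb : S.block = none)
    {M : ℝ} (hM : 0 ≤ M) (hn : ∀ p ∈ S.live, (p.nextSlot : ℝ) ≤ S.t + M) : S.excess ≤ M := by
  have h1 := area_sub_elapsed_le (t := S.t) (s := S.live)
    (fun p hp => ⟨(hv.live hp).2.1, hn p hp⟩)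
  have h2 := mul_le_mul_of_nonneg_left h.live_le hM
  unfold excess
  rw [blockPieces_none hb, h.susp_none hb, area_zero, elapsed_zero]
  linarith

theorem mem_own_color {i : ℕ} (hi : i ∈ Finset.Icc 1 n) : i ∈ colorItems n c (c i) :=
  Finset.mem_filter.2 ⟨hi, rfl⟩

theorem ViewInv.load_le (hv : S.ViewInv k n c K) {i : ℕ} (hi : i ∈ Finset.Icc 1 n) :
    S.load i ≤ 1 := by
  rw [← view_ld (k := k) (mem_own_color (c := c) hi)]
  exact (hv _).ld_le i

theorem ViewInv.load_nonneg (hv : S.ViewInv k n c K) {i : ℕ} (hi : i ∈ Finset.Icc 1 n) :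
    0 ≤ S.load i := by
  rw [← view_ld (k := k) (mem_own_color (c := c) hi)]
  exact (hv _).ld_nonneg i

theorem ViewInv.load_future (hv : S.ViewInv k n c K) {i : ℕ} (hi : i ∈ Finset.Icc 1 n)
    (ht : S.t ≤ i) : S.load i = 0 := by
  rw [← view_ld (k := k) (mem_own_color (c := c) hi)]
  exact (hv _).ld_future i ht

/-- The load of the items that have arrived. -/
theorem Shape.sum_load_arrived (h : S.Shape k n c) (hv : S.ViewInv k n c K) :
    ∑ i ∈ (Finset.Icc 1 n).filter (fun i => i < S.t), S.load i = S.t - 1 - k + S.excess := by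
  rw [← h.sum_load hv, Finset.sum_filter]
  refine Finset.sum_congr rfl (fun i hi => ?_)
  split_ifs with ht
  · rfl
  · exact (hv.load_future hi (not_lt.1 ht)).symm

theorem card_arrived (n t : ℕ) :
    ((Finset.Icc 1 n).filter (fun i => i < t)).card = min n (t - 1) := by
  have : (Finset.Icc 1 n).filter (fun i => i < t) = Finset.Icc 1 (min n (t - 1)) := by
    ext i
    simp only [Finset.mem_filter, Finset.mem_Icc, le_min_iff]
    omega
  rw [this, Nat.card_Icc]
  omega

/-- A set of arrived items that contains all unsatisfied ones. -/
theorem Shape.card_eq (h : S.Shape k n c) (hv : S.ViewInv k n c K) {A : Finset ℕ}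
    (hA : A ⊆ (Finset.Icc 1 n).filter (fun i => i < S.t))
    (hsat : ∀ i ∈ Finset.Icc 1 n, i < S.t → i ∉ A → S.load i = 1) :
    (A.card : ℝ) = (min n (S.t - 1) : ℕ) - (S.t - 1 - k + S.excess) + ∑ i ∈ A, S.load i := by
  rw [← h.sum_load_arrived hv, ← Finset.sum_sdiff hA, ← card_arrived n S.t]
  have h1 : ∑ i ∈ (Finset.Icc 1 n).filter (fun i => i < S.t) \ A, S.load i =
      (((Finset.Icc 1 n).filter (fun i => i < S.t) \ A).card : ℝ) := by
    rw [Finset.card_eq_sum_ones, Nat.cast_sum]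
    refine Finset.sum_congr rfl (fun i hi => ?_)
    rw [Finset.mem_sdiff, Finset.mem_filter] at hi
    rw [hsat i hi.1.1 hi.1.2 hi.2, Nat.cast_one]
  have h2 := Finset.card_sdiff_add_card_eq_card hA
  rw [h1, ← h2]
  push_cast
  ring

/-! ### The dual cost of regular execution -/

theorem dualCost_regular (δ : ℝ) : (S.regular k n c δ).dualCost k n = S.dualCost k n +
    δ * (((Finset.Icc 1 n).filter (fun i => S.load i < 1)).card -
      ((Finset.Icc (smallBuffer k + 1) (smallBuffer k + n)).filter (fun j => S.t ≤ j)).card) := by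
  have h1 : ∑ i ∈ Finset.Icc 1 n, (S.regular k n c δ).yhat i = ∑ i ∈ Finset.Icc 1 n, S.yhat i +
      δ * ((Finset.Icc 1 n).filter (fun i => S.load i < 1)).card := by
    rw [mul_comm δ, ← nsmul_eq_mul, ← Finset.sum_const, Finset.sum_filter,
      ← Finset.sum_add_distrib]
    refine Finset.sum_congr rfl (fun i _ => ?_)
    change (if _ then _ else _) = _
    split_ifs <;> simp
  have h2 : ∑ j ∈ Finset.Icc (smallBuffer k + 1) (smallBuffer k + n),
      (S.regular k n c δ).zhat j =
      ∑ j ∈ Finset.Icc (smallBuffer k + 1) (smallBuffer k + n), S.zhat j +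
      δ * ((Finset.Icc (smallBuffer k + 1) (smallBuffer k + n)).filter
        (fun j => S.t ≤ j)).card := by
    rw [mul_comm δ, ← nsmul_eq_mul, ← Finset.sum_const, Finset.sum_filter,
      ← Finset.sum_add_distrib]
    refine Finset.sum_congr rfl (fun i _ => ?_)
    change (if _ then _ else _) = _
    split_ifs <;> simp
  have h3 : ∑ i ∈ Finset.Icc 1 n, (S.regular k n c δ).ybar i =
      ∑ i ∈ Finset.Icc 1 n, S.ybar i := rfl
  unfold dualCost
  rw [h1, h2, h3]
  ring

theorem card_unsatisfied (hv : S.ViewInv k n c K) :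
    ((Finset.Icc 1 n).filter (fun i => S.load i < 1)).card =
      (S.B n).card + (n - min n (S.t - 1)) := by
  have h1 := Finset.card_filter_add_card_filter_not
    (s := (Finset.Icc 1 n).filter (fun i => S.load i < 1)) (fun i => i < S.t)
  rw [Finset.filter_filter, Finset.filter_filter] at h1
  have h2 : (Finset.Icc 1 n).filter (fun i => S.load i < 1 ∧ i < S.t) = S.B n :=
    Finset.filter_congr (fun i _ => and_comm)
  have h3 : (Finset.Icc 1 n).filter (fun i => S.load i < 1 ∧ ¬ i < S.t) =
      (Finset.Icc 1 n).filter (fun i => ¬ i < S.t) := by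
    refine Finset.filter_congr (fun i hi => ⟨fun h => h.2, fun h => ⟨?_, h⟩⟩)
    rw [hv.load_future hi (not_lt.1 h)]
    norm_num
  have h4 := Finset.card_filter_add_card_filter_not (s := Finset.Icc 1 n) (fun i => i < S.t)
  rw [card_arrived, Nat.card_Icc] at h4
  rw [h2, h3] at h1
  omega

theorem card_slots {κ n t : ℕ} (h1 : κ + 1 ≤ t) :
    ((Finset.Icc (κ + 1) (κ + n)).filter (fun j => t ≤ j)).card = κ + n + 1 - t := by
  have : (Finset.Icc (κ + 1) (κ + n)).filter (fun j => t ≤ j) = Finset.Icc t (κ + n) := by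
    ext i
    simp only [Finset.mem_filter, Finset.mem_Icc]
    omega
  rw [this, Nat.card_Icc]

/-- The rate of the dual cost, by the loads of a later state with the same slot. -/
theorem Shape.dual_rate {S' : State} (hv : S.ViewInv k n c K)
    (h' : S'.Shape k n c) (hv' : S'.ViewInv k n c K) (ht : S'.t = S.t)
    (hld : ∀ i ∈ Finset.Icc 1 n, S.load i ≤ S'.load i) (hk : smallBuffer k ≤ k)
    (htn : S.t ≤ smallBuffer k + n) :
    (((Finset.Icc 1 n).filter (fun i => S.load i < 1)).card : ℝ) -
      ((Finset.Icc (smallBuffer k + 1) (smallBuffer k + n)).filter (fun j => S.t ≤ j)).card =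
      k - smallBuffer k - S'.excess + ∑ i ∈ S.B n, S'.load i ∧
    ((S.B n).card : ℝ) ≤ k - S'.excess + ∑ i ∈ S.B n, S'.load i := by
  have htk : k + 1 ≤ S.t := (hv 0).t_ge
  -- The set B of the earlier state is measured with the loads of the later one, because the credit
  -- counts the loads including the new weight.
  have h1 := h'.card_eq hv' (A := S.B n) (fun i hi => by
    rw [B, Finset.mem_filter] at hi
    rw [ht]
    exact Finset.mem_filter.2 ⟨hi.1, hi.2.1⟩) (fun i hi hit hiB => by
      rw [ht] at hit
      refine le_antisymm (hv'.load_le hi) (le_trans ?_ (hld i hi))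
      by_contra hn
      exact hiB (Finset.mem_filter.2 ⟨hi, hit, not_le.1 hn⟩))
  rw [ht] at h1
  -- The term min(n, t - 1) cancels between |B| and the number of items still to come, so the end of
  -- the input needs no separate treatment.
  rw [card_unsatisfied hv, card_slots (by omega), Nat.cast_add, h1,
    Nat.cast_sub (min_le_left _ _), Nat.cast_sub (by omega)]
  constructor
  · push_cast
    ring
  · have : ((min n (S.t - 1) : ℕ) : ℝ) ≤ S.t - 1 := by
      have h2 : min n (S.t - 1) ≤ S.t - 1 := min_le_right _ _
      have h3 : ((min n (S.t - 1) : ℕ) : ℝ) ≤ ((S.t - 1 : ℕ) : ℝ) := by exact_mod_cast h2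
      rwa [Nat.cast_sub (by omega), Nat.cast_one] at h3
    linarith

end State

end

end RBM

/-! ### All invariants together, and the steps other than regular execution -/

namespace RBM

noncomputable section

open scoped Classical

open ColorView (Ledger)

/-- The assumptions on the buffer size. -/
structure Large (k : ℕ) (K : ℝ) : Prop where
  K_eq : K = k / Real.log k
  log_ge : 2 ≤ Real.log k

namespace Large

variable {k : ℕ} {K : ℝ}

theorem log_pos (h : Large k K) : 0 < Real.log k := by linarith [h.log_ge]

theorem k_pos (h : Large k K) : 0 < (k : ℝ) := by
  rcases Nat.eq_zero_or_pos k with rfl | hk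
  · have := h.log_ge
    simp at this
    norm_num at this
  · exact_mod_cast hk

theorem K_pos (h : Large k K) : 0 < K := by
  rw [h.K_eq]
  exact div_pos h.k_pos h.log_pos

theorem one_le (h : Large k K) : 1 ≤ K := by
  rw [h.K_eq, le_div_iff₀ h.log_pos, one_mul]
  have := Real.log_le_sub_one_of_pos h.k_pos
  linarith

theorem frozenBound_eq (h : Large k K) : frozenBound k = K / 100 := by
  rw [RBM.frozenBound_eq, h.K_eq]

theorem activeBound_eq (h : Large k K) : activeBound k = K / 10 := by
  rw [RBM.activeBound_eq, h.K_eq]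

end Large

namespace State

variable {k n : ℕ} {c : ℕ → ℕ} {S : State} {K : ℝ} {led : ℕ → Ledger}

/-- All invariants. -/
structure Good (k n : ℕ) (c : ℕ → ℕ) (K : ℝ) (S : State) (led : ℕ → Ledger) : Prop where
  colors : ∀ col, (S.view k n c col).ColorInv k K (colorItems n c col)
    {b | IsBatch (smallBuffer k) n c col b} (led col)
  shape : S.Shape k n c
  cost : wt S.placed ≤ ∑ col ∈ (Finset.Icc 1 n).image c, (led col).cost
  dual : (∑ col ∈ (Finset.Icc 1 n).image c, ((led col).credit + (led col).n5)) / 2 ≤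
    S.dualCost k n
  -- After the first slot the dual cost is bounded away from 0; this absorbs the additive constant
  -- in the final estimate.
  start : S.t = k + 1 ∨
    1 ≤ ∑ col ∈ (Finset.Icc 1 n).image c, (3612 * (led col).credit + 2 * (led col).n5)
  nonneg : ∀ col ∈ (Finset.Icc 1 n).image c, 0 ≤ (led col).credit ∧ 0 ≤ (led col).n5

theorem Good.views (h : S.Good k n c K led) : S.ViewInv k n c K := fun col => (h.colors col).inv

theorem Good.step (h : S.Good k n c K led) {S' : State} (hshape : S'.Shape k n c)
    {dc dr d5 : ℕ → ℝ}
    (hcol : ∀ col, ∃ l', (S'.view k n c col).ColorInv k K (colorItems n c col)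
      {b | IsBatch (smallBuffer k) n c col b} l' ∧ (led col).Moves l' (dc col) (dr col) (d5 col))
    (hr : ∀ col ∈ (Finset.Icc 1 n).image c, 0 ≤ dr col)
    (h5 : ∀ col ∈ (Finset.Icc 1 n).image c, 0 ≤ d5 col)
    (hcost : wt S'.placed ≤ wt S.placed + ∑ col ∈ (Finset.Icc 1 n).image c, dc col)
    (hdual : S.dualCost k n + (∑ col ∈ (Finset.Icc 1 n).image c, (dr col + d5 col)) / 2 ≤
      S'.dualCost k n)
    (hstart : S'.t = S.t ∨
      1 ≤ ∑ col ∈ (Finset.Icc 1 n).image c, (3612 * (led col).credit + 2 * (led col).n5)) :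
    ∃ led', S'.Good k n c K led' := by
  choose led' hled' using hcol
  have e1 : ∀ col, (led' col).cost = (led col).cost + dc col := fun col => (hled' col).2.1
  have e2 : ∀ col, (led' col).credit = (led col).credit + dr col := fun col => (hled' col).2.2.1
  have e3 : ∀ col, (led' col).n5 = (led col).n5 + d5 col := fun col => (hled' col).2.2.2
  refine ⟨led', fun col => (hled' col).1, hshape, ?_, ?_, ?_, fun col hcol => ?_⟩
  · simp_rw [e1]
    rw [Finset.sum_add_distrib]
    linarith [h.cost]
  · simp_rw [e2, e3]
    have : ∑ col ∈ (Finset.Icc 1 n).image c,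
        ((led col).credit + dr col + ((led col).n5 + d5 col)) =
        ∑ col ∈ (Finset.Icc 1 n).image c, ((led col).credit + (led col).n5) +
        ∑ col ∈ (Finset.Icc 1 n).image c, (dr col + d5 col) := by
      rw [← Finset.sum_add_distrib]
      exact Finset.sum_congr rfl (fun _ _ => by ring)
    rw [this]
    linarith [h.dual]
  · have hm : ∑ col ∈ (Finset.Icc 1 n).image c, (3612 * (led col).credit + 2 * (led col).n5) ≤
        ∑ col ∈ (Finset.Icc 1 n).image c, (3612 * (led' col).credit + 2 * (led' col).n5) := by
      refine Finset.sum_le_sum (fun col hcol => ?_)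
      rw [e2, e3]
      linarith [hr col hcol, h5 col hcol]
    rcases hstart with hs | hs
    · rw [hs]
      exact h.start.imp id (fun h1 => h1.trans hm)
    · exact Or.inr (hs.trans hm)
  · rw [e2, e3]
    exact ⟨add_nonneg (h.nonneg col hcol).1 (hr col hcol),
      add_nonneg (h.nonneg col hcol).2 (h5 col hcol)⟩

/-- A step that costs nothing. -/
theorem Good.free (h : S.Good k n c K led) {S' : State} (hshape : S'.Shape k n c)
    (hcol : ∀ col, ∃ l', (S'.view k n c col).ColorInv k K (colorItems n c col)
      {b | IsBatch (smallBuffer k) n c col b} l' ∧ (led col).Moves l' 0 0 0)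
    (hcost : wt S'.placed = wt S.placed) (hdual : S'.dualCost k n = S.dualCost k n)
    (hstart : S'.t = S.t ∨
      1 ≤ ∑ col ∈ (Finset.Icc 1 n).image c, (3612 * (led col).credit + 2 * (led col).n5)) :
    ∃ led', S'.Good k n c K led' :=
  h.step hshape (dc := fun _ => 0) (dr := fun _ => 0) (d5 := fun _ => 0) hcol (by simp) (by simp)
    (by simp [hcost]) (by simp [hdual]) hstart

theorem Good.same (h : S.Good k n c K led) {S' : State} {col : ℕ}
    (he : S'.view k n c col = S.view k n c col) :
    ∃ l', (S'.view k n c col).ColorInv k K (colorItems n c col)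
      {b | IsBatch (smallBuffer k) n c col b} l' ∧ (led col).Moves l' 0 0 0 :=
  ⟨led col, he ▸ h.colors col, Ledger.moves_zero rfl rfl rfl rfl rfl⟩

theorem W_le_wt (hv : S.ViewInv k n c K) (col : ℕ) :
    (S.view k n c col).W ≤ wt S.live + wt S.susp := by
  rw [view_op_W]
  have h1 := wt_filter_le (fun p hp => (hv.live hp).2.1) (fun p : Piece => p.color = col)
  have h2 := wt_filter_le (fun p hp => (hv.susp hp).2) (fun p : Piece => p.color = col)
  linarith

theorem Shape.wt_le (h : S.Shape k n c) : wt S.live + wt S.susp ≤ 1 := by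
  cases hb : S.block with
  | none =>
    rw [h.susp_none hb, wt_zero, add_zero]
    exact h.live_le
  | some p =>
    rw [h.block_live p hb, wt_zero, zero_add]
    exact h.susp_le

theorem Good.makeIntegral (h : S.Good k n c K led) (hk : Large k K) {col : ℕ}
    (hfull : S.FrozenFull k n c col) (hact : S.act n c col = ∅) :
    ∃ led', (S.makeIntegral k n c col).Good k n c K led' := by
  refine h.free (h.shape.of_eq rfl rfl rfl rfl rfl rfl) (fun col' => ?_) rfl rfl (Or.inl rfl)
  by_cases hc : col' = col
  · subst hc
    rw [view_makeIntegral]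
    refine (h.colors col').mkInt hk.K_pos ?_ ?_
    · rw [view_frz, ← hk.frozenBound_eq]
      exact hfull
    · rw [view_act]
      exact hact
  · exact h.same (view_makeIntegral_of_ne hc)

theorem Good.replenish (h : S.Good k n c K led) (hk : Large k K) {col : ℕ}
    (hr : S.Replenishable k n c col) : ∃ led', (S.replenish n c col).Good k n c K led' := by
  refine h.free (h.shape.replenish h.views col) (fun col' => ?_) ?_ rfl (Or.inl rfl)
  · by_cases hc : col' = col
    · subst hc
      rw [view_replenish col' (fun p hp hc i hi => h.views.not_mem_items hp hc hi)]
      obtain ⟨h1, h2, h3, h4⟩ := hr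
      refine (h.colors col').repl hk.K_pos ?_ ?_ ?_ ?_ ?_
      · rwa [view_int]
      · rwa [view_act, ← hk.activeBound_eq]
      · rw [view_frz, ← hk.frozenBound_eq]
        exact not_lt.1 h4
      · rwa [view_frz]
      · exact (W_le_wt h.views col').trans h.shape.wt_le
    · exact h.same (view_replenish_of_ne hc)
  · rw [wt_placed, wt_placed]
    have hw : ∀ p : Piece, (if p.color = col then
        ({ p with items := p.items ∪ S.frz n c col } : Piece) else p).weight = p.weight := by
      intro p
      split_ifs <;> rfl
    change wt S.past + wt (S.live.map _) + wt S.blockPieces + wt (S.susp.map _) = _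
    rw [wt_map (fun p _ => hw p), wt_map (fun p _ => hw p)]

theorem Good.closeEnded (h : S.Good k n c K led) (hk : Large k K) (hset : S.Settled k n c)
    (he : S.SomeEnded) : ∃ led', (S.closeEnded n c).Good k n c K led' := by
  cases hb : S.block with
  | none =>
    have hs := h.shape.susp_none hb
    refine h.free (h.shape.closeEnded_none h.views hb) (fun col => ?_) ?_ rfl (Or.inl rfl)
    · rw [view_closeEnded_none hb hs]
      refine (h.colors col).close ?_ (fun b hb => IsBatch.lt_slotOf hb)
      rw [view_int, view_frz, view_act, ← hk.frozenBound_eq, ← hk.activeBound_eq]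
      intro h1 h2 h3
      by_contra h4
      exact (hset col).2 ⟨h1, not_le.1 h4, h2, h3⟩
    · obtain ⟨h1, h2, h3, h4⟩ := closeEnded_none (n := n) (c := c) hb hs
      rw [wt_placed, wt_placed, h1, h2, h3, hs, blockPieces_none h4, blockPieces_none hb, wt_add]
      have e2 : S.live.filter (fun p => S.t < p.nextSlot) =
          S.live.filter (fun p => ¬ p.nextSlot ≤ S.t) :=
        Multiset.filter_congr (fun p _ => not_le.symm)
      rw [e2, add_assoc (wt S.past), wt_filter_add_not]
  | some p =>
    have hl := h.shape.block_live p hb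
    rw [h.shape.someEnded_some hb] at he
    refine h.free (h.shape.closeEnded_some hb he) (fun col => ?_) ?_ rfl (Or.inl rfl)
    · rw [view_closeEnded_some hb hl he]
      exact (h.colors col).unblock
    · obtain ⟨h1, h2, h3, h4⟩ := closeEnded_some (n := n) (c := c) hb hl he
      rw [wt_placed, wt_placed, h1, h2, h3, hl, blockPieces_none h4, blockPieces_some hb, wt_add,
        wt_shift, wt_zero]
      ring

theorem Shape.weight_nonneg (h : S.Shape k n c) (hv : S.ViewInv k n c K) :
    ∀ p ∈ S.placed, 0 ≤ p.weight := by
  intro p hp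
  unfold placed at hp
  simp only [Multiset.mem_add] at hp
  rcases hp with ((hp | hp) | hp) | hp
  · exact (h.past_ok p hp).2.1
  · exact (hv.live hp).2.1
  · cases hb : S.block with
    | none => simp [blockPieces_none hb] at hp
    | some q =>
      rw [blockPieces_some hb, Multiset.mem_singleton] at hp
      rw [hp, (h.block_ok q hb).1]
      norm_num
  · obtain ⟨q, hq, rfl⟩ := Multiset.mem_map.1 hp
    exact (hv.susp hq).2

theorem Good.advance (h : S.Good k n c K led) (hk : Large k K) (he : ¬ S.SomeEnded)
    (ht : S.Tight) : ∃ led', (S.advance n c).Good k n c K led' := by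
  refine h.free (h.shape.advance h.views he ht) (fun col => ?_) ?_ rfl ?_
  · rw [view_advance (fun p hp => ⟨(h.shape.block_ok p hp).1,
      fun hm => lt_irrefl _ ((h.shape.block_ok p hp).2.2.2.1 _ hm)⟩) h.shape.block_live
      h.shape.susp_none]
    refine (h.colors col).adv hk.K_pos ?_ ?_ (fun b hb => IsBatch.subset hb)
    · intro hsus p hp
      have hb : S.block = none := not_not.1 hsus
      rw [view_op_of_none (h.shape.susp_none hb)] at hp
      rw [Shape.someEnded_none hb] at he
      by_contra hn
      exact he ⟨p, (Multiset.mem_filter.1 hp).1, not_lt.1 hn⟩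
    · intro hsus p hp
      obtain ⟨q, hq⟩ := Option.ne_none_iff_exists'.1 hsus
      have hm := (Multiset.mem_filter.1 hp).1
      rw [h.shape.block_live q hq, zero_add] at hm
      obtain ⟨r, -, rfl⟩ := Multiset.mem_map.1 hm
      rfl
  · rw [wt_placed, wt_placed]
    change wt S.past + wt S.live + wt (S.advance n c).blockPieces + wt S.susp = _
    cases hb : S.block with
    | none =>
      have hb' : (S.advance n c).block = none := by
        change S.block.map _ = none
        rw [hb]
        rfl
      rw [blockPieces_none hb, blockPieces_none hb']
    | some p =>
      have hb' : ∃ q, (S.advance n c).block = some q ∧ q.weight = p.weight := by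
        refine ⟨_, show S.block.map _ = _ by rw [hb]; rfl, ?_⟩
        dsimp only
        split_ifs <;> rfl
      obtain ⟨q, hq, hqw⟩ := hb'
      rw [blockPieces_some hb, blockPieces_some hq, wt_singleton, wt_singleton, hqw]
  · right
    -- When the first slot is full, weight at least 1 has been scheduled, none of it by Case 3; so
    -- the credit and n5 must account for it.
    rcases h.start with hs | hs
    · have h1 : 1 ≤ wt S.placed :=
        le_trans ht (wt_filter_le (h.shape.weight_nonneg h.views) _)
      refine h1.trans (h.cost.trans (Finset.sum_le_sum (fun col _ => ?_)))
      have h2 := (h.colors col).cost_le hk.K_pos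
      rw [(h.colors col).fl_first hs] at h2
      linarith
    · exact hs

/-- No piece has ended, and the current slot is not full. -/
theorem Good.wt_live_lt (h : S.Good k n c K led) (he : ¬ S.SomeEnded) (ht : ¬ S.Tight) :
    S.block = none ∧ S.susp = 0 ∧ wt S.live = S.slotLoad S.t ∧ wt S.live < 1 := by
  have hb := h.shape.block_none h.views he ht
  have h1 := h.shape.slotLoad_eq h.views hb he
  refine ⟨hb, h.shape.susp_none hb, h1.symm, ?_⟩
  rw [← h1]
  exact not_le.1 ht

theorem Good.W_lt (h : S.Good k n c K led) (he : ¬ S.SomeEnded) (ht : ¬ S.Tight) (col : ℕ) :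
    (S.view k n c col).W < 1 := by
  obtain ⟨-, hs, -, hl⟩ := h.wt_live_lt he ht
  have := W_le_wt h.views col
  rw [hs, wt_zero, add_zero] at this
  exact this.trans_lt hl

theorem mem_image_of_colorItems {col i : ℕ} (hi : i ∈ colorItems n c col) :
    col ∈ (Finset.Icc 1 n).image c :=
  Finset.mem_image.2 ⟨i, colorItems_subset hi, (mem_colorItems.1 hi).2⟩

theorem Good.flush (h : S.Good k n c K led) (hk : Large k K) {col : ℕ} (hat : S.AtSlot k n c)
    (hfull : S.FrozenFull k n c col) (hact : (S.act n c col).Nonempty) :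
    ∃ led', (S.flush n c col hact).Good k n c K led' := by
  obtain ⟨-, he, ht⟩ := hat
  obtain ⟨hb, hs, hwl, hlt⟩ := h.wt_live_lt he ht
  set i₀ := (S.act n c col).min' hact with hi₀
  have hi₀m : i₀ ∈ S.act n c col := Finset.min'_mem _ _
  have hload₀ : S.load i₀ < 1 := (Finset.mem_filter.1 (Finset.mem_filter.1
    (Finset.mem_filter.1 hi₀m).1).1).2.2
  set w := min (1 - S.slotLoad S.t) (1 - S.load i₀) with hw
  have hw0 : 0 ≤ w := le_min (by linarith) (by linarith)
  set p : Piece := { color := col, items := S.act n c col, start := S.t, weight := w,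
                     regular := False, rel := ∅ } with hp
  have hflush : (S.flush n c col hact).live = S.live + {p} := rfl
  have hview := fun col' => view_add_live (k := k) (n := n) (c := c) (S := S)
    (S' := S.flush n c col hact) (col := col') (s := {p}) rfl rfl rfl rfl rfl rfl rfl rfl (by
      intro q hq
      rw [Multiset.mem_singleton.1 hq]
      exact fun i hi => mem_colorItems_of_act hi)
  have hcolm := mem_image_of_colorItems (mem_colorItems_of_act hi₀m)
  refine h.step (h.shape.add_live hb (s := {p}) rfl rfl rfl rfl rfl rfl ?_ ?_)
    (dc := fun col' => if col' = col then w else 0) (dr := fun _ => 0) (d5 := fun _ => 0)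
    (fun col' => ?_) (by simp) (by simp) ?_ ?_ (Or.inl rfl)
  · intro q hq
    rw [Multiset.mem_singleton.1 hq]
    exact ⟨hw0, rfl⟩
  · rw [wt_singleton]
    have : w ≤ 1 - S.slotLoad S.t := min_le_left _ _
    change wt S.live + w ≤ 1
    linarith
  · by_cases hc : col' = col
    · subst hc
      rw [(hview col').1 p (by simp [hp]), if_pos rfl]
      have hsg : ((S.flush n c col' hact).view k n c col').sg =
        ((S.view k n c col').addPiece p).sg := rfl
      rw [hsg]
      refine (h.colors col').flush hk.K_pos (by rw [view_act]) rfl hw0 (by simp [hp]) ?_ ?_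
        (h.W_lt he ht col') ?_
      · rwa [view_act]
      · rw [view_frz, ← hk.frozenBound_eq]
        exact hfull
      · intro i hi
        have hi' := hi
        rw [view_act] at hi'
        -- The first active item has the largest load, so its slack is a valid bound for the whole
        -- block.
        have h1 : (S.view k n c col').ld i ≤ S.load i₀ := by
          rw [← view_ld (k := k) (mem_colorItems_of_act hi₀m)]
          rcases (Finset.min'_le _ i hi').eq_or_lt with heq | hlt
          · rw [hi₀, heq]
          · exact (h.colors col').inv.anti i₀ (by rwa [view_act]) i hi hlt
        have h2 : w ≤ 1 - S.load i₀ := min_le_right _ _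
        change _ + w ≤ 1
        linarith
    · rw [if_neg hc, (hview col').2 (by simp [hp, Ne.symm hc])]
      exact h.same (S' := S) rfl
  · rw [Finset.sum_ite_eq' , if_pos hcolm, wt_placed, wt_placed, hflush, wt_add, wt_singleton]
    change wt S.past + (wt S.live + w) + wt S.blockPieces + wt S.susp ≤ _
    linarith
  · simp only [add_zero, Finset.sum_const_zero, zero_div]
    exact le_rfl

/-- One unit is the new block; the other covers the open pieces, of total weight at most 1, each of
which is now counted twice. -/
theorem Shape.wt_evict (h : S.Shape k n c) (hv : S.ViewInv k n c K) (hb : S.block = none)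
    {col : ℕ} {A : Finset ℕ} {P : Prop} {S' : State}
    (hp : S'.past = (S.evict k n c col A P).past) (hl : S'.live = 0)
    (hs : S'.susp = (S.evict k n c col A P).susp)
    (hb' : S'.block = (S.evict k n c col A P).block) : wt S'.placed ≤ wt S.placed + 2 := by
  rw [wt_placed, wt_placed, hp, hl, hs, blockPieces_some hb', wt_singleton, blockPieces_none hb,
    h.susp_none hb]
  change wt (S.past + _) + wt 0 + 1 + wt (S.live.map _) ≤ _
  have hL := h.live_le
  have e1 : wt (S.live.map (fun p => ({ p with
      items := p.items.filter (fun i => S.t ≤ slotOf (p.items, p.start) i) } : Piece))) =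
      wt S.live := wt_map (fun _ _ => rfl)
  have e2 : wt ((S.live.map (fun p => ({ p with
      items := p.items.filter (fun i => slotOf (p.items, p.start) i < S.t) } : Piece))).filter
      (fun p => p.items.Nonempty)) ≤ wt S.live := by
    refine (wt_filter_le ?_ _).trans (le_of_eq (wt_map (fun _ _ => rfl)))
    intro q hq
    obtain ⟨r, hr, rfl⟩ := Multiset.mem_map.1 hq
    exact (hv.live hr).2.1
  rw [wt_add, wt_zero]
  linarith

theorem Good.evictIntegral (h : S.Good k n c K led) (hk : Large k K) {col : ℕ}
    (hready : S.Ready k n c) (h5 : S.Case5 k n c col) :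
    ∃ led', (S.evictIntegral k n c col).Good k n c K led' := by
  obtain ⟨⟨-, he, ht⟩, -⟩ := hready
  obtain ⟨hb, hs, -, -⟩ := h.wt_live_lt he ht
  have hint := h5.1
  have hact : (S.act n c col).Nonempty := by
    obtain ⟨i, hi, hst⟩ := hint
    exact ⟨i, Finset.mem_filter.2 ⟨hi, by rw [hst]; simp⟩⟩
  obtain ⟨i₀, hi₀⟩ := hact
  have hcolm := mem_image_of_colorItems (mem_colorItems_of_act hi₀)
  refine h.step (h.shape.evict h.views hb (col := col) (A := S.act n c col) (P := True)
      (Finset.filter_subset _ _) rfl rfl rfl rfl rfl (fun i hi => if_neg hi))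
    (dc := fun col' => if col' = col then 2 else 0) (dr := fun _ => 0)
    (d5 := fun col' => if col' = col then 1 else 0)
    (fun col' => ?_) (by simp) (fun col' _ => by split_ifs <;> norm_num) ?_ ?_
    (Or.inl rfl)
  · by_cases hc : col' = col
    · subst hc
      rw [if_pos rfl, if_pos rfl, view_evictIntegral_self hb hs]
      exact (h.colors col').evInt hk.K_pos (view_int _ |>.2 hint)
    · rw [if_neg hc, if_neg hc, view_evictIntegral_of_ne hb hs hc]
      exact (h.colors col').cut
  · rw [Finset.sum_ite_eq', if_pos hcolm]
    exact h.shape.wt_evict h.views hb (col := col) (A := S.act n c col) (P := True) rfl rfl rfl rfl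
  · simp only [zero_add]
    rw [Finset.sum_ite_eq', if_pos hcolm]
    have hsub : S.act n c col ⊆ Finset.Icc 1 n := fun i hi =>
      colorItems_subset (mem_colorItems_of_act hi)
    -- The gain is |act| · 1/(2|act|), since unsatisfied items had ȳ = 0.
    have hy : ∑ i ∈ Finset.Icc 1 n, (S.evictIntegral k n c col).ybar i =
        ∑ i ∈ Finset.Icc 1 n, S.ybar i + 1 / 2 := by
      have h1 : ∀ i ∈ Finset.Icc 1 n, (S.evictIntegral k n c col).ybar i = S.ybar i +
          if i ∈ S.act n c col then 1 / (2 * ((S.act n c col).card : ℝ)) else 0 := by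
        intro i hi
        change (if i ∈ S.act n c col then _ else _) = _
        split_ifs with hia
        · rw [h.shape.ybar i hi, zero_add]
          exact (Finset.mem_filter.1 (Finset.mem_filter.1 (Finset.mem_filter.1 hia).1).1).2.2
        · rw [add_zero]
      have hc0 : ((S.act n c col).card : ℝ) ≠ 0 := by
        exact_mod_cast (Finset.card_pos.2 ⟨i₀, hi₀⟩).ne'
      rw [Finset.sum_congr rfl h1, Finset.sum_add_distrib, ← Finset.sum_filter,
        Finset.filter_mem_eq_inter, Finset.inter_eq_right.2 hsub, Finset.sum_const, nsmul_eq_mul]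
      field_simp
    unfold dualCost
    rw [hy]
    change _ ≤ ∑ i ∈ Finset.Icc 1 n, S.yhat i + _ - ∑ j ∈ _, S.zhat j
    linarith

theorem Good.evictFrozen (h : S.Good k n c K led) (hk : Large k K) {col : ℕ}
    (hready : S.Ready k n c) (h6 : S.Case6 col) :
    ∃ led', (S.evictFrozen k n c col).Good k n c K led' := by
  obtain ⟨⟨hset, he, ht⟩, hfull⟩ := hready
  obtain ⟨hb, hs, -, -⟩ := h.wt_live_lt he ht
  by_cases hne : (S.frz n c col).Nonempty
  · obtain ⟨i₀, hi₀⟩ := id hne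
    have hcolm := mem_image_of_colorItems (mem_colorItems_of_frz hi₀)
    have heq : S.evictFrozen k n c col = { S.evict k n c col (S.frz n c col) False with
        ended := Function.update S.ended col 0 } := if_pos hne
    refine h.step (h.shape.evict h.views hb (col := col) (A := S.frz n c col) (P := False)
        (Finset.filter_subset _ _) (by rw [heq]; rfl) (by rw [heq]) (by rw [heq]; rfl)
        (by rw [heq]) (by rw [heq]) (fun i _ => by rw [heq]; rfl))
      (dc := fun col' => if col' = col then 2 else 0) (dr := fun _ => 0) (d5 := fun _ => 0)
      (fun col' => ?_) (by simp) (by simp) ?_ (by simp [heq]; exact le_rfl)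
      (Or.inl (by rw [heq]; rfl))
    · by_cases hc : col' = col
      · subst hc
        rw [if_pos rfl, view_evictFrozen_self hb hs hne]
        refine (h.colors col').evFrz hk.K_pos (by rwa [view_frz]) ?_ ?_ h6
        · rw [view_frz, ← hk.frozenBound_eq]
          exact hfull col'
        · rw [view_act, ← hk.activeBound_eq]
          -- With fewer than K/10 active items Case 4 would apply first; this is what makes the new
          -- reference set large.
          by_contra hlt
          refine (hset col').2 ⟨?_, not_le.1 hlt, hne, hfull col'⟩
          intro hi
          have := (h.colors col').inv.int_frz ((view_int _).2 hi)
          rw [view_frz] at this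
          simp [this] at hne
      · rw [if_neg hc, view_evictFrozen_of_ne hb hs hc hne]
        exact (h.colors col').cut
    · rw [Finset.sum_ite_eq', if_pos hcolm]
      exact h.shape.wt_evict h.views hb (col := col) (A := S.frz n c col) (P := False)
        (by rw [heq]) (by rw [heq]; rfl) (by rw [heq]) (by rw [heq])
  · have heq : S.evictFrozen k n c col = { S with
        sigma := S.resetColor k n c col
        ended := Function.update S.ended col 0 } := if_neg hne
    refine h.free (h.shape.of_eq (by rw [heq]) (by rw [heq]) (by rw [heq]) (by rw [heq])
      (by rw [heq]) (by rw [heq])) (fun col' => ?_) (by rw [heq]; rfl) (by rw [heq]; rfl)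
      (Or.inl (by rw [heq]))
    by_cases hc : col' = col
    · subst hc
      rw [view_evictFrozen_self_empty hne]
      exact (h.colors col').resetEnded
    · exact h.same (view_evictFrozen_of_ne_empty hc hne)

theorem Good.regularReset (h : S.Good k n c K led) (hk : Large k K) (b : Batch) :
    ∃ led', (S.regularReset b).Good k n c K led' := by
  refine h.free (h.shape.of_eq rfl rfl rfl rfl rfl rfl) (fun col => ?_) rfl rfl (Or.inl rfl)
  have h0 := (h.colors col).inv.sg_nonneg
  have hle : ∀ b', ((S.regularReset b).view k n c col).sg b' ≤ (S.view k n c col).sg b' ∧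
      0 ≤ ((S.regularReset b).view k n c col).sg b' := by
    intro b'
    have h1 : ((S.regularReset b).view k n c col).sg b' =
        if IsBatch (smallBuffer k) n c col b' then Function.update S.sigma b 0 b' else 0 := rfl
    have h2 : (S.view k n c col).sg b' =
        if IsBatch (smallBuffer k) n c col b' then S.sigma b' else 0 := rfl
    have h3 := h0 b'
    rw [h2] at h3
    rw [h1, h2]
    by_cases hbb : b' = b
    · subst hbb
      rw [Function.update_self]
      simp only [ite_self]
      exact ⟨h3, le_rfl⟩
    · rw [Function.update_of_ne hbb]
      exact ⟨le_rfl, h3⟩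
  exact (h.colors col).withCosts (fun b' => (hle b').2)
    (fun _ b' _ => xhat_mono hk.log_pos (hle b').1)

end State

end

end RBM

/-! ### Regular execution of all colors -/

namespace RBM

noncomputable section

open scoped Classical

namespace State

variable {k n : ℕ} {c : ℕ → ℕ} {S : State} {K : ℝ} {led : ℕ → ColorView.Ledger}

/-! ### Regular execution -/

/-- The colors that are scheduled by regular execution. -/
def regularColors (k n : ℕ) (c : ℕ → ℕ) (S : State) (δ : ℝ) : Finset ℕ :=
  ((Finset.Icc 1 n).image c).filter
    (fun col => S.IsFractional n c col ∧ 0 < S.colorWeight k n c col δ)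

/-- What regular execution schedules for a color. -/
def regularPiece (k n : ℕ) (c : ℕ → ℕ) (S : State) (δ : ℝ) (col : ℕ) : Piece where
  color := col
  items := S.act n c col
  start := S.t
  weight := S.colorWeight k n c col δ
  regular := True
  rel := S.relevantTo k n c col

def regularPieces (k n : ℕ) (c : ℕ → ℕ) (S : State) (δ : ℝ) : Multiset Piece :=
  (S.regularColors k n c δ).val.map (S.regularPiece k n c δ)

theorem live_regular (δ : ℝ) :
    (S.regular k n c δ).live = S.live + S.regularPieces k n c δ := rfl

/-- Lets the assumption on all times ε < δ be used at ε = 0, where it speaks of the present state.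
-/
theorem regular_zero : S.regular k n c 0 = S := by
  have h : S.regularPieces k n c 0 = 0 := by
    unfold regularPieces regularColors
    simp [colorWeight_zero]
  have h1 : S.regular k n c 0 = { S.regular k n c 0 with
      live := S.live + S.regularPieces k n c 0 } := rfl
  rw [h1, h]
  unfold regular
  simp

theorem mem_regularPieces {δ : ℝ} {p : Piece} (h : p ∈ S.regularPieces k n c δ) :
    ∃ col ∈ S.regularColors k n c δ, p = S.regularPiece k n c δ col := by
  obtain ⟨col, hcol, rfl⟩ := Multiset.mem_map.1 h
  exact ⟨col, hcol, rfl⟩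

theorem regularPieces_items {δ : ℝ} {p : Piece} (h : p ∈ S.regularPieces k n c δ) :
    p.items ⊆ colorItems n c p.color := by
  obtain ⟨col, -, rfl⟩ := mem_regularPieces h
  exact fun i hi => mem_colorItems_of_act hi

theorem regularPieces_weight {δ : ℝ} {p : Piece} (h : p ∈ S.regularPieces k n c δ) :
    0 ≤ p.weight := by
  obtain ⟨col, hcol, rfl⟩ := mem_regularPieces h
  exact (Finset.mem_filter.1 hcol).2.2.le

theorem filter_regularPieces (δ : ℝ) (col : ℕ) :
    (S.regularPieces k n c δ).filter (fun p => p.color = col) =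
      if col ∈ S.regularColors k n c δ then {S.regularPiece k n c δ col} else 0 :=
  filter_map_of_color _ (fun _ => rfl) col

theorem wt_regularPieces (δ : ℝ) : wt (S.regularPieces k n c δ) =
    ∑ col ∈ S.regularColors k n c δ, S.colorWeight k n c col δ := by
  unfold wt regularPieces
  rw [Multiset.map_map]
  rfl

theorem wt_regularPieces_eq (hL : 0 < Real.log k) {δ : ℝ} (hδ : 0 ≤ δ) :
    wt (S.regularPieces k n c δ) =
      ∑ col ∈ ((Finset.Icc 1 n).image c).filter (fun col => S.IsFractional n c col),
        S.colorWeight k n c col δ := by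
  rw [wt_regularPieces]
  refine Finset.sum_subset (fun col h => ?_) (fun col h h' => ?_)
  · rw [regularColors, Finset.mem_filter] at h
    exact Finset.mem_filter.2 ⟨h.1, h.2.1⟩
  · rw [Finset.mem_filter] at h
    refine le_antisymm (not_lt.1 fun hlt => h' ?_) (colorWeight_nonneg hL col hδ)
    exact Finset.mem_filter.2 ⟨h.1, h.2, hlt⟩

theorem load_regular (δ : ℝ) (i : ℕ) :
    (S.regular k n c δ).load i = S.load i + ldOf (S.regularPieces k n c δ) i := by
  rw [load_eq, load_eq, live_regular, ldOf_add]
  change ldOf S.past i + _ + ldOf S.blockPieces i + ldOf S.susp i = _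
  ring

theorem ldOf_regularPieces {δ : ℝ} {col i : ℕ} (hi : i ∈ S.act n c col)
    (hc : col ∈ S.regularColors k n c δ) :
    ldOf (S.regularPieces k n c δ) i = S.colorWeight k n c col δ := by
  rw [filter_items_of_color (fun p hp => regularPieces_items hp) (mem_colorItems_of_act hi),
    filter_regularPieces, if_pos hc, ldOf_singleton]
  exact if_pos hi

/-- Regular execution ends at the latest when the slot is full. -/
theorem Good.wt_regular_le (h : S.Good k n c K led) (hk : Large k K) {δ : ℝ} (hδ : 0 < δ)
    (hcalm : ∀ ε, 0 ≤ ε → ε < δ → (S.regular k n c ε).AtSlot k n c) :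
    wt S.live + wt (S.regularPieces k n c δ) ≤ 1 := by
  have h0 := hcalm 0 le_rfl hδ
  rw [regular_zero] at h0
  obtain ⟨hb, hs, -, -⟩ := h.wt_live_lt h0.2.1 h0.2.2
  have hlt : ∀ ε ∈ Set.Ico 0 δ, wt S.live +
      ∑ col ∈ ((Finset.Icc 1 n).image c).filter (fun col => S.IsFractional n c col),
        S.colorWeight k n c col ε ≤ 1 := by
    intro ε hε
    obtain ⟨-, he, ht⟩ := hcalm ε hε.1 hε.2
    rw [← wt_regularPieces_eq hk.log_pos hε.1, ← wt_add, ← live_regular]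
    refine le_trans ?_ (not_le.1 ht).le
    have hlive : (S.regular k n c ε).live.filter (fun p => p.start ≤ S.t ∧ S.t < p.nextSlot) =
        (S.regular k n c ε).live := by
      rw [Multiset.filter_eq_self]
      intro p hp
      refine ⟨?_, ?_⟩
      · rw [live_regular, Multiset.mem_add] at hp
        rcases hp with hp | hp
        · exact (h.views p.color).start_le p (mem_view_op_of_live hp)
        · obtain ⟨col, -, rfl⟩ := mem_regularPieces hp
          exact le_rfl
      · by_contra hn
        exact he ⟨p, Multiset.mem_add.2 (Or.inl hp), not_lt.1 hn⟩
    have hpl : (S.regular k n c ε).placed = S.past + (S.regular k n c ε).live := by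
      unfold placed
      change S.past + _ + S.blockPieces + S.susp.map _ = _
      rw [blockPieces_none hb, hs]
      simp
    change _ ≤ wt ((S.regular k n c ε).placed.filter (fun p => p.start ≤ S.t ∧ S.t < p.nextSlot))
    rw [hpl, Multiset.filter_add, wt_add, hlive]
    have : 0 ≤ wt (S.past.filter (fun p => p.start ≤ S.t ∧ S.t < p.nextSlot)) :=
      wt_nonneg (fun p hp => (h.shape.past_ok p (Multiset.mem_filter.1 hp).1).2.1)
    linarith
  have hcont : Continuous (fun ε => wt S.live +
      ∑ col ∈ ((Finset.Icc 1 n).image c).filter (fun col => S.IsFractional n c col),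
        S.colorWeight k n c col ε) :=
    continuous_const.add (continuous_finsetSum _
      (fun col _ => continuous_colorWeight hk.log_pos col))
  rw [wt_regularPieces_eq hk.log_pos hδ.le]
  -- The slot is not full at any time before δ, and the weights are continuous in time; so the
  -- closed inequality holds at δ itself.
  have hmem : δ ∈ closure (Set.Ico 0 δ) := by
    rw [closure_Ico hδ.ne]
    exact ⟨hδ.le, le_rfl⟩
  exact closure_minimal hlt (isClosed_le hcont continuous_const) hmem

/-- Regular execution ends at the latest when an item becomes satisfied. -/
theorem Good.load_regular_le (hk : Large k K) {δ : ℝ} (hδ : 0 < δ)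
    (hB : ∀ ε, 0 ≤ ε → ε < δ → (S.regular k n c ε).B n = S.B n) {col i : ℕ}
    (hcol : col ∈ (Finset.Icc 1 n).image c) (hfrac : S.IsFractional n c col)
    (hi : i ∈ S.act n c col) : S.load i + S.colorWeight k n c col δ ≤ 1 := by
  have hiB : i ∈ S.B n := (Finset.mem_filter.1 (Finset.mem_filter.1 hi).1).1
  have hlt : ∀ ε ∈ Set.Ico 0 δ, S.load i + S.colorWeight k n c col ε ≤ 1 := by
    intro ε hε
    have h1 := hiB
    rw [← hB ε hε.1 hε.2] at h1
    have h2 := (Finset.mem_filter.1 h1).2.2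
    rw [load_regular] at h2
    by_cases hw : 0 < S.colorWeight k n c col ε
    · rw [ldOf_regularPieces hi (Finset.mem_filter.2 ⟨hcol, hfrac, hw⟩)] at h2
      exact h2.le
    · have h3 := (Finset.mem_filter.1 hiB).2.2
      linarith
  have hmem : δ ∈ closure (Set.Ico 0 δ) := by
    rw [closure_Ico hδ.ne]
    exact ⟨hδ.le, le_rfl⟩
  exact closure_minimal hlt (isClosed_le (continuous_const.add
    (continuous_colorWeight hk.log_pos col)) continuous_const) hmem

/-- The effect of regular execution on the color `col`. -/
theorem Good.color_regular (h : S.Good k n c K led) (hk : Large k K) {δ : ℝ} (hδ : 0 < δ)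
    (hat : S.AtSlot k n c) (hfull : ∀ col, ¬ S.FrozenFull k n c col) (h6 : ∀ col, ¬ S.Case6 col)
    (hW : wt S.live + wt (S.regularPieces k n c δ) ≤ 1)
    (hB : ∀ ε, 0 ≤ ε → ε < δ → (S.regular k n c ε).B n = S.B n) (col : ℕ) :
    ∃ l', ((S.regular k n c δ).view k n c col).ColorInv k K (colorItems n c col)
      {b | IsBatch (smallBuffer k) n c col b} l' ∧ (led col).Moves l'
        (if col ∈ S.regularColors k n c δ then S.colorWeight k n c col δ else 0)
        (if col ∈ S.regularColors k n c δ then (S.view k n c col).credit (colorItems n c col)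
          (Real.log k) δ (S.colorWeight k n c col δ) else 0) 0 := by
  obtain ⟨-, he, ht⟩ := hat
  obtain ⟨hb, hs, -, hlt⟩ := h.wt_live_lt he ht
  have hinv := (h.colors col).inv
  have hview := view_add_live (k := k) (n := n) (c := c) (S := S)
    (S' := S.regular k n c δ) (col := col) (s := S.regularPieces k n c δ) rfl rfl rfl rfl rfl rfl
    rfl rfl (fun p hp => regularPieces_items hp)
  have hsg : ∀ b, ((S.regular k n c δ).view k n c col).sg b =
      if IsBatch (smallBuffer k) n c col b then S.sigma b + S.rate n b * δ else 0 := fun _ => rfl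
  have hsg0 : ∀ b, (S.view k n c col).sg b =
      if IsBatch (smallBuffer k) n c col b then S.sigma b else 0 := fun _ => rfl
  have hnn : ∀ b, 0 ≤ ((S.regular k n c δ).view k n c col).sg b := by
    intro b
    have h1 := hinv.sg_nonneg b
    rw [hsg0] at h1
    rw [hsg]
    split_ifs with hbt
    · rw [if_pos hbt] at h1
      positivity
    · exact le_rfl
  have hrate : ∀ b, IsBatch (smallBuffer k) n c col b →
      b.1.filter (fun i => i ∈ S.B n ∧ S.status i ≠ .frozen ∧ slotOf b i < S.t) ⊆
        S.act n c col := by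
    intro b hbt i hi
    obtain ⟨hib, hiB, hst, -⟩ := Finset.mem_filter.1 hi
    exact Finset.mem_filter.2 ⟨Finset.mem_filter.2 ⟨hiB, hbt.2.2.1 i hib⟩, hst⟩
  have hx : ∀ b, IsBatch (smallBuffer k) n c col b →
      xhat k (((S.regular k n c δ).view k n c col).sg b) ≤
        xhat k ((S.view k n c col).sg b) + S.colorWeight k n c col δ := by
    intro b hbt
    rw [hsg, hsg0, if_pos hbt, if_pos hbt]
    exact xhat_le_add_colorWeight hk.log_pos hbt hδ.le
  have hJ : ∀ b, IsBatch (smallBuffer k) n c col b →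
      (∀ i ∈ b.1, i ∈ S.act n c col → ¬ slotOf b i < S.t) →
      xhat k (((S.regular k n c δ).view k n c col).sg b) ≤ xhat k ((S.view k n c col).sg b) := by
    intro b hbt hno
    have h0 : S.rate n b = 0 := by
      refine Finset.card_eq_zero.2 (Finset.eq_empty_of_forall_notMem fun i hi => ?_)
      exact hno i (Finset.mem_filter.1 hi).1 (hrate b hbt hi) (Finset.mem_filter.1 hi).2.2.2
    rw [hsg, hsg0, if_pos hbt, if_pos hbt, h0, Nat.cast_zero, zero_mul, add_zero]
  by_cases hT : col ∈ S.regularColors k n c δ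
  · have hv := hview.1 (S.regularPiece k n c δ col) (by rw [filter_regularPieces, if_pos hT])
    obtain ⟨hcol, hfrac, hpos⟩ := Finset.mem_filter.1 hT
    rw [if_pos hT, if_pos hT, hv]
    have hfrac' := (view_frac (k := k) col).2 hfrac
    have hWw : (S.view k n c col).W + S.colorWeight k n c col δ ≤ 1 := by
      have h1 := W_le_wt h.views col
      rw [hs, wt_zero, add_zero] at h1
      have h2 : S.colorWeight k n c col δ ≤ wt (S.regularPieces k n c δ) := by
        rw [wt_regularPieces]
        exact Finset.single_le_sum (f := fun col => S.colorWeight k n c col δ)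
          (fun x hx => (Finset.mem_filter.1 hx).2.2.le) hT
      linarith
    refine (h.colors col).regular hk.K_pos hk.log_ge hδ (p := S.regularPiece k n c δ col)
      (by rw [view_act]; rfl) rfl hpos.le trivial (fun hi => hinv.int_frac hi hfrac') ?_ ?_
      (not_le.1 (h6 col)) (h.W_lt he ht col) hWw ?_ (fun b hbt => IsBatch.subset hbt) hnn hx ?_ ?_
    · obtain ⟨i, hi, hst⟩ := hfrac'
      exact ⟨i, Finset.mem_filter.2 ⟨hi, by rw [hst]; simp⟩⟩
    · rw [view_frz, ← hk.frozenBound_eq]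
      exact hfull col
    · intro i hi
      rw [view_act] at hi
      rw [view_ld (k := k) (mem_colorItems_of_act hi)]
      exact Good.load_regular_le hk hδ hB hcol hfrac hi
    · intro b hbt hno
      rw [view_act] at hno
      exact hJ b hbt hno
    -- The set J consists of the active items that the batch matches before slot t; its size is the
    -- rate of σ̂.
    · intro D hD hDb
      refine colorWeight_le hk.log_pos hδ.le hD (fun b hbt => ?_)
      have h1 := hDb b hbt _ (by rw [view_act]; exact hrate b hbt)
        (fun i hi => (Finset.mem_filter.1 hi).1)
      have h2 := hnn b
      rw [hsg, if_pos hbt] at h1 h2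
      refine le_trans ?_ h1
      rw [mul_comm]
      exact mul_le_mul_of_nonneg_left (xhatDeriv_le hk.log_pos h2) (Nat.cast_nonneg _)
  · have hv := hview.2 (by rw [filter_regularPieces, if_neg hT])
    rw [if_neg hT, if_neg hT, hv]
    refine (h.colors col).withCosts hnn (fun hint b hbt => ?_)
    -- A nonintegral color without a new piece either has weight 0 or no active items; in both cases
    -- its x̂ do not grow.
    by_cases hne : ((S.view k n c col).act (colorItems n c col)).Nonempty
    · have hfrac := (view_frac (k := k) col).1 (ColorView.frac_of_nonempty hint hne)
      have h1 : S.colorWeight k n c col δ ≤ 0 := by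
        by_contra hpos
        obtain ⟨i, hi⟩ := hne
        rw [view_act] at hi
        exact hT (Finset.mem_filter.2 ⟨mem_image_of_colorItems (mem_colorItems_of_act hi), hfrac,
          not_le.1 hpos⟩)
      linarith [hx b hbt]
    · refine hJ b hbt (fun i _ hi => ?_)
      rw [view_act] at hne
      exact absurd ⟨i, hi⟩ hne

/-- The credit of all colors. -/
theorem sum_credit_le (hk : Large k K) {δ : ℝ} (hδ : 0 < δ)
    (hnn : ∀ i ∈ Finset.Icc 1 n, 0 ≤ (S.regular k n c δ).load i) :
    ∑ col ∈ S.regularColors k n c δ, (S.view k n c col).credit (colorItems n c col)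
      (Real.log k) δ (S.colorWeight k n c col δ) ≤
    δ * ((S.B n).card / Real.log k + ∑ i ∈ S.B n, (S.regular k n c δ).load i) := by
  set g : ℕ → ℝ := fun i => 1 / Real.log k + (S.regular k n c δ).load i with hg
  have hL := hk.log_pos
  have hg0 : ∀ i ∈ S.B n, 0 ≤ g i := fun i hi =>
    add_nonneg (by positivity) (hnn i (Finset.mem_filter.1 hi).1)
  have hgs : ∀ A : Finset ℕ, ∑ i ∈ A, g i =
      A.card / Real.log k + ∑ i ∈ A, (S.regular k n c δ).load i := fun A => by
    rw [hg, Finset.sum_add_distrib, Finset.sum_const, nsmul_eq_mul, mul_one_div]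
  have h1 : ∀ col ∈ S.regularColors k n c δ, (S.view k n c col).credit (colorItems n c col)
      (Real.log k) δ (S.colorWeight k n c col δ) = δ * ∑ i ∈ S.act n c col, g i := by
    intro col hcol
    unfold ColorView.credit
    rw [view_act, hgs]
    congr 2
    refine Finset.sum_congr rfl (fun i hi => ?_)
    rw [load_regular, ldOf_regularPieces hi hcol, view_ld (mem_colorItems_of_act hi)]
  rw [Finset.sum_congr rfl h1, ← hgs, ← Finset.mul_sum]
  refine mul_le_mul_of_nonneg_left ?_ hδ.le
  rw [← Finset.sum_fiberwise_of_maps_to (s := S.B n) (t := (Finset.Icc 1 n).image c) (g := c)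
    (fun i hi => Finset.mem_image_of_mem c (Finset.mem_filter.1 hi).1) g]
  refine (Finset.sum_le_sum fun col _ => ?_).trans
    (Finset.sum_le_sum_of_subset_of_nonneg (Finset.filter_subset _ _) fun col _ _ => ?_)
  · exact Finset.sum_le_sum_of_subset_of_nonneg (Finset.filter_subset _ _)
      (fun i hi _ => hg0 i (Finset.mem_filter.1 hi).1)
  · exact Finset.sum_nonneg (fun i hi => hg0 i (Finset.mem_filter.1 hi).1)

/-- The reduction of the buffer to k' is what pays here: k - k' ≥ 2K exceeds the excess 22/100 K by
enough to cover the share |B| / ln k of the credit. -/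
theorem Good.regular (h : S.Good k n c K led) (hk : Large k K) (hκ : smallBuffer k ≤ k)
    (hκ2 : 2 * K ≤ k - smallBuffer k) {δ : ℝ} (hδ : 0 < δ) (htn : S.t ≤ smallBuffer k + n)
    (hcalm : ∀ ε, 0 ≤ ε → ε < δ →
      (S.regular k n c ε).Calm k n c ∧ (S.regular k n c ε).B n = S.B n) :
    ∃ led', (S.regular k n c δ).Good k n c K led' := by
  have h0 := (hcalm 0 le_rfl hδ).1
  rw [regular_zero] at h0
  obtain ⟨⟨hat, hfull⟩, -, h6, -⟩ := h0
  obtain ⟨hb, hs, -, hlt⟩ := h.wt_live_lt hat.2.1 hat.2.2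
  have hW := h.wt_regular_le hk hδ (fun ε h1 h2 => (hcalm ε h1 h2).1.1.1)
  have hcolor := h.color_regular hk hδ hat hfull h6 hW (fun ε h1 h2 => (hcalm ε h1 h2).2)
  have hshape : (S.regular k n c δ).Shape k n c := by
    refine h.shape.add_live hb rfl rfl (live_regular δ) rfl rfl rfl ?_ hW
    intro p hp
    refine ⟨regularPieces_weight hp, ?_⟩
    obtain ⟨col, -, rfl⟩ := mem_regularPieces hp
    rfl
  have hviews : (S.regular k n c δ).ViewInv k n c K := fun col => by
    obtain ⟨l', hl', -⟩ := hcolor col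
    exact hl'.inv
  have hsub : S.regularColors k n c δ ⊆ (Finset.Icc 1 n).image c := Finset.filter_subset _ _
  have hcr : ∀ col ∈ S.regularColors k n c δ, 0 ≤ (S.view k n c col).credit (colorItems n c col)
      (Real.log k) δ (S.colorWeight k n c col δ) := by
    intro col hcol
    have h1 := hk.log_pos
    refine mul_nonneg hδ.le (add_nonneg (by positivity) (Finset.sum_nonneg fun i _ => ?_))
    exact add_nonneg ((h.views col).ld_nonneg i) (Finset.mem_filter.1 hcol).2.2.le
  refine h.step hshape hcolor (fun col _ => ?_) (fun _ _ => le_rfl) ?_ ?_ (Or.inl rfl)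
  · split_ifs with hc
    · exact hcr col hc
    · exact le_rfl
  · rw [Finset.sum_ite_mem, Finset.inter_eq_right.2 hsub, ← wt_regularPieces, wt_placed,
      wt_placed, live_regular, wt_add]
    change wt S.past + _ + wt S.blockPieces + wt S.susp ≤ _
    linarith
  · simp only [add_zero]
    rw [Finset.sum_ite_mem, Finset.inter_eq_right.2 hsub, dualCost_regular]
    obtain ⟨hD, hcard⟩ := Shape.dual_rate h.views hshape hviews rfl (fun i _ => by
      rw [load_regular]
      linarith [ldOf_nonneg (s := S.regularPieces k n c δ) (fun p hp => regularPieces_weight hp) i]) hκ htn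
    -- Old pieces reach at most 22/100 K slots ahead, new ones at most 11/100 K, and the total
    -- weight of the open pieces is at most 1.
    have hE : (S.regular k n c δ).excess ≤ 22 / 100 * K := by
      refine hshape.excess_le hviews hb (by linarith [hk.K_pos]) (fun p hp => ?_)
      rw [live_regular, Multiset.mem_add] at hp
      rcases hp with hp | hp
      · exact (h.views p.color).next_le hk.K_pos.le (h.W_lt hat.2.1 hat.2.2 p.color)
          (mem_view_op_of_live hp)
      · obtain ⟨col, hcol, rfl⟩ := mem_regularPieces hp
        have h1 := (h.views col).act_le ((view_frac col).2 (Finset.mem_filter.1 hcol).2.1)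
        rw [view_act] at h1
        have h2 : (S.regularPiece k n c δ col).nextSlot = S.t + (S.act n c col).card := rfl
        rw [h2]
        push_cast
        change (S.t : ℝ) + _ ≤ S.t + _
        linarith [hk.K_pos]
    have hsum := sum_credit_le hk hδ (fun i hi => hviews.load_nonneg hi)
    have hE0 := hshape.excess_nonneg hviews
    set Λ := ∑ i ∈ S.B n, (S.regular k n c δ).load i with hΛ
    have hΛ0 : 0 ≤ Λ := Finset.sum_nonneg
      (fun i hi => hviews.load_nonneg (Finset.mem_filter.1 hi).1)
    -- |B| ≤ k + Λ, since the excess is nonnegative; dividing by ln k ≥ 2 gives the bound.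
    have hBL : ((S.B n).card : ℝ) / Real.log k ≤ K + Λ / 2 := by
      have h1 := hk.log_pos
      have h2 : ((S.B n).card : ℝ) / Real.log k ≤ (k + Λ) / Real.log k := by
        gcongr
        linarith
      have h3 : Λ / Real.log k ≤ Λ / 2 := by
        have := hk.log_ge
        gcongr
      rw [add_div, ← hk.K_eq] at h2
      linarith
    rw [hD]
    -- Credit rate at most K + 3Λ/2, against twice the dual rate, which is at least 3.56 K + 2Λ.
    have h1 : δ * ((S.B n).card / Real.log k + Λ) ≤ δ * (2 * (k - smallBuffer k -
        (S.regular k n c δ).excess + Λ)) := by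
      refine mul_le_mul_of_nonneg_left ?_ hδ.le
      linarith [hk.K_pos]
    linarith

end State

end

end RBM

/-! ### The initial state, the final state and the conclusion -/

namespace RBM

noncomputable section

open scoped Classical

open ColorView (Ledger)

namespace State

variable {k n : ℕ} {c : ℕ → ℕ} {S : State} {K : ℝ} {led : ℕ → Ledger}

theorem load_init (i : ℕ) : (State.init k).load i = 0 := by
  simp [load, placed, State.init, blockPieces]

/-- The ledger before anything has happened. -/
def emptyLedger : Ledger where
  g := { phase := .clean, F := ∅, ξ := 0, m := 0, R := 0, Cr := 0 }
  fl := 0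
  n5 := 0
  n6 := 0

def initView (k : ℕ) : ColorView where
  t := k + 1
  st := fun _ => .frozen
  ld := fun _ => 0
  op := 0
  en := 0
  sg := fun _ => 0
  sus := False
  blk := False
  blkInt := False

theorem view_init (col : ℕ) : (State.init k).view k n c col = initView k := by
  refine ColorView.eq_of rfl (fun i => ?_) (fun i => ?_) rfl rfl (fun b => ?_) ?_ ?_ ?_
  · exact ite_self _
  · exact (if_congr Iff.rfl (load_init i) rfl).trans (ite_self _)
  · exact ite_self _
  · simp [view, State.init, initView]
  · simp [view, State.init, initView]
  · simp [view, State.init, initView]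

theorem colorInv_init (hK : 0 < K) (col : ℕ) : ((State.init k).view k n c col).ColorInv k K
    (colorItems n c col) {b | IsBatch (smallBuffer k) n c col b} emptyLedger := by
  rw [view_init]
  have hact : (initView k).act (colorItems n c col) = ∅ := by simp [ColorView.act, initView]
  have hfrac : ¬ (initView k).Frac (colorItems n c col) := by simp [ColorView.Frac, initView]
  have hint : ¬ (initView k).Int (colorItems n c col) := by simp [ColorView.Int, initView]
  have hW : (initView k).W = 0 := by simp [ColorView.W, initView]
  have hWr : (initView k).Wr = 0 := by simp [ColorView.Wr, initView]
  have hx : xhat k 0 = 0 := by simp [xhat]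
  have hinv : (initView k).Inv (colorItems n c col) k K :=
    { t_ge := le_rfl
      items_sub := by simp [initView]
      items_lt := by simp [initView]
      items_st := by simp [initView]
      weight_nonneg := by simp [initView]
      start_le := by simp [initView]
      le_next := by simp [initView]
      ld_nonneg := by simp [initView]
      ld_le := by simp [initView]
      ld_future := by simp [initView]
      ld_zero := by simp [initView]
      suffix := by
        intro f _ i hi hit hif
        exact absurd (by simpa [ColorView.frz, ColorView.B, initView, hi] using hit) hif
      int_frz := fun h => absurd h hint
      int_frac := fun h => absurd h hint
      blk_frz := by simp [initView]
      blk_sus := by simp [initView]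
      blkInt_blk := by simp [initView]
      anti := by simp [hact]
      W_le := by simp [initView]
      act_le := fun h => absurd h hfrac
      int_size := fun h => absurd h hint
      lag := by simp [initView]
      past := by simp [initView]
      first := fun _ => Or.inr hact
      sg_nonneg := by simp [initView]
      en_nonneg := le_rfl }
  have hbeta : ColorView.beta 0 = 0 := ColorView.beta_eq_zero (by norm_num)
  refine .of_le hinv ?_ ?_ le_rfl (fun _ => rfl)
  swap
  · rw [hWr]
    simp [emptyLedger, initView]
  exact
    { F_mem := by simp [emptyLedger]
      F_card := by simp [emptyLedger]; positivity
      pf := by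
        intro i _ i' _ _ _ h
        exact absurd h (by simp [initView])
      bf := by simp [initView]
      beta_le := by simp [hW, hbeta, emptyLedger]
      hold_le := by simp [hact, ColorView.hold, ColorView.Ghost.held, emptyLedger]
      R_le := by simp [ColorView.Ghost.allowance, emptyLedger]
      x_le := by
        intro _ b _
        rw [hWr]
        simp [initView, hx]
      phase := by
        refine ⟨rfl, fun _ _ b _ => ⟨fun i _ hi => ?_, fun i _ _ => ?_⟩⟩
        · simp [hact] at hi
        · have h1 : (initView k).eff (colorItems n c col) b = 0 := by
            unfold ColorView.eff
            rw [show (initView k).op = 0 from rfl, Multiset.filter_zero]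
            simp
          rw [h1]
          exact hx.le }

theorem good_init (hk : Large k K) : (State.init k).Good k n c K (fun _ => emptyLedger) where
  colors := colorInv_init hk.K_pos
  shape := shape_init
  cost := by
    rw [wt_placed]
    simp [State.init, blockPieces, wt_zero, Ledger.cost, emptyLedger]
  dual := by simp [Ledger.credit, emptyLedger, dualCost, State.init]
  start := Or.inl rfl
  nonneg := by simp [Ledger.credit, emptyLedger]

theorem Good.of_step (h : S.Good k n c K led) (hk : Large k K) (hκ : smallBuffer k ≤ k)
    (hκ2 : 2 * K ≤ k - smallBuffer k) (htn : S.t ≤ smallBuffer k + n) {S' : State}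
    (hs : Step k n c S S') : ∃ led', S'.Good k n c K led' := by
  cases hs with
  | makeIntegral col hfull hact => exact h.makeIntegral hk hfull hact
  | replenish col hr => exact h.replenish hk hr
  | closeEnded hset he => exact h.closeEnded hk hset he
  | advance hset he ht => exact h.advance hk he ht
  | flush col hat hfull hact => exact h.flush hk hat hfull hact
  | evictIntegral col hready h5 => exact h.evictIntegral hk hready h5
  | evictFrozen col hready h6 => exact h.evictFrozen hk hready h6
  | regularReset b hready hd => exact h.regularReset hk b
  | regular δ hδ hcalm => exact h.regular hk hκ hκ2 hδ htn hcalm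

theorem good_of_reaches (hk : Large k K) (hκ : smallBuffer k ≤ k)
    (hκ2 : 2 * K ≤ k - smallBuffer k) (h : Reaches k n c S) : ∃ led, S.Good k n c K led := by
  induction h with
  | refl => exact ⟨_, good_init hk⟩
  | tail _ hs ih =>
    obtain ⟨led, hled⟩ := ih
    exact hled.of_step hk hκ hκ2 hs.1 hs.2

theorem _root_.RBM.Step.t_le {S' : State} (h : Step k n c S S') : S'.t ≤ S.t + 1 := by
  cases h with
  | advance => exact le_rfl
  | evictFrozen col =>
    unfold evictFrozen
    split_ifs <;> exact Nat.le_succ _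
  | _ => exact Nat.le_succ _

/-- If k' + n ≤ k the process ends before it starts. Otherwise the last step begins at a slot
between k + 1 and k' + n and advances by at most one. -/
theorem final_cases (hk : Large k K) (hκ : smallBuffer k ≤ k) (hκ2 : 2 * K ≤ k - smallBuffer k)
    (h : Final k n c S) : S = State.init k ∨ (S.t = smallBuffer k + n + 1 ∧ k + 2 ≤ S.t) := by
  obtain ⟨hr, ht⟩ := h
  rcases Relation.ReflTransGen.cases_tail hr with h0 | ⟨S₁, h1, h2, h3⟩
  · exact Or.inl h0
  · obtain ⟨led, hled⟩ := good_of_reaches hk hκ hκ2 h1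
    have h4 := (hled.views 0).t_ge
    change k + 1 ≤ S₁.t at h4
    have h5 := h3.t_le
    exact Or.inr (by omega)

/-- The colors with many items on which nothing has been scheduled. -/
def heavyColors (k n : ℕ) (c : ℕ → ℕ) (S : State) : Finset ℕ :=
  ((Finset.Icc 1 n).image c).filter (fun col => S.IsIntegral n c col ∨ S.FrozenFull k n c col)

/-- A heavy color has more than K/100 unsatisfied items of load 0. At the end the arrived items miss
at most k - k' ≤ 2K + 1 ≤ 3K = 300 · K/100 units of load altogether. -/
theorem Good.card_heavyColors (h : S.Good k n c K led) (hk : Large k K)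
    (hκ : (k : ℝ) - smallBuffer k ≤ 2 * K + 1) (ht : S.t = smallBuffer k + n + 1) :
    ((S.heavyColors k n c).card : ℝ) ≤ 300 := by
  set Z := (S.B n).filter (fun i => S.status i ≠ .fractional) with hZ
  have hK := hk.K_pos
  have hload : ∀ i ∈ Z, S.load i = 0 := by
    intro i hi
    obtain ⟨hiB, hst⟩ := Finset.mem_filter.1 hi
    obtain ⟨hin, -, hlt⟩ := Finset.mem_filter.1 hiB
    have hic := mem_own_color (c := c) hin
    rw [← view_ld (k := k) hic] at hlt ⊢
    refine (h.views (c i)).ld_zero i ?_ hlt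
    rwa [view_st hic]
  have hcol : ∀ col ∈ S.heavyColors k n c, K / 100 ≤ ((Z.filter (fun i => c i = col)).card : ℝ) := by
    intro col hcol
    have hsub : ∀ A ⊆ S.Bcol n c col, (∀ i ∈ A, S.status i ≠ .fractional) →
        A ⊆ Z.filter (fun i => c i = col) := by
      intro A hA hst i hi
      obtain ⟨h1, h2⟩ := Finset.mem_filter.1 (hA hi)
      exact Finset.mem_filter.2 ⟨Finset.mem_filter.2 ⟨h1, hst i hi⟩, h2⟩
    rcases (Finset.mem_filter.1 hcol).2 with hi | hf
    · have hi' := (view_int (k := k) col).2 hi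
      have h1 := (h.views col).int_size hi'
      rw [view_act] at h1
      refine h1.le.trans (Nat.cast_le.2 (Finset.card_le_card (hsub _ (Finset.filter_subset _ _) ?_)))
      intro i hia hst
      exact (h.views col).int_frac hi' ((view_frac col).2 ⟨i, (Finset.mem_filter.1 hia).1, hst⟩)
    · have h1 : K / 100 < ((S.frz n c col).card : ℝ) := by
        rw [← hk.frozenBound_eq]
        exact hf
      refine h1.le.trans (Nat.cast_le.2 (Finset.card_le_card (hsub _ (Finset.filter_subset _ _) ?_)))
      intro i hif
      rw [(Finset.mem_filter.1 hif).2]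
      simp
  have h1 : ((S.heavyColors k n c).card : ℝ) * (K / 100) ≤ Z.card := by
    rw [← nsmul_eq_mul]
    refine (Finset.card_nsmul_le_sum _ _ _ hcol).trans ?_
    rw [← Nat.cast_sum, Nat.cast_le, Finset.card_eq_sum_card_fiberwise (f := c) (s := Z)
      (t := (Finset.Icc 1 n).image c) (fun i hi => Finset.mem_coe.2 (Finset.mem_image_of_mem c
        (Finset.mem_filter.1 (Finset.mem_filter.1 hi).1).1))]
    exact Finset.sum_le_sum_of_subset (Finset.filter_subset _ _)
  -- Each item of Z misses a full unit of load, and no arrived item has load above 1.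
  have h2 : (Z.card : ℝ) ≤ ∑ i ∈ (Finset.Icc 1 n).filter (fun i => i < S.t), (1 - S.load i) := by
    have hsub : Z ⊆ (Finset.Icc 1 n).filter (fun i => i < S.t) := by
      intro i hi
      obtain ⟨hin, hit, -⟩ := Finset.mem_filter.1 (Finset.mem_filter.1 hi).1
      exact Finset.mem_filter.2 ⟨hin, hit⟩
    rw [Finset.cast_card]
    refine (Finset.sum_le_sum fun i hi => ?_).trans
      (Finset.sum_le_sum_of_subset_of_nonneg hsub fun i hi _ => ?_)
    · rw [hload i hi, sub_zero]
    · linarith [h.views.load_le (Finset.mem_filter.1 hi).1]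
  rw [Finset.sum_sub_distrib, h.shape.sum_load_arrived h.views, ← Finset.cast_card, card_arrived,
    ht] at h2
  have h3 : ((min n (smallBuffer k + n + 1 - 1) : ℕ) : ℝ) ≤ n := by
    exact_mod_cast min_le_left _ _
  have h4 := h.shape.excess_nonneg h.views
  have h5 := hk.one_le
  push_cast at h2 h3
  have h6 : ((S.heavyColors k n c).card : ℝ) * (K / 100) ≤ 300 * (K / 100) := by linarith
  exact le_of_mul_le_mul_right h6 (by positivity)

/-- The costs of the final state. -/
theorem Good.primalCost_le (h : S.Good k n c K led) (hk : Large k K)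
    (hκ : (k : ℝ) - smallBuffer k ≤ 2 * K + 1) (ht : S.t = smallBuffer k + n + 1)
    (htk : k + 2 ≤ S.t) : S.primalCost ≤ 10 ^ 10 * S.dualCost k n := by
  have hheavy := h.card_heavyColors hk hκ ht
  have hcost : ∀ col ∈ (Finset.Icc 1 n).image c, (led col).cost ≤
      3612 * (led col).credit + 3615 * (led col).n5 +
        3613 * (if S.IsIntegral n c col ∨ S.FrozenFull k n c col then 1 else 0) := by
    intro col _
    have h1 := (h.colors col).cost_le hk.K_pos
    split_ifs with hh
    · linarith [(h.colors col).fl_le_add_one]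
    · rw [not_or] at hh
      have h2 := (h.colors col).fl_le (fun hi => hh.1 ((view_int col).1 hi)) (by
        rw [view_frz, ← hk.frozenBound_eq]
        exact hh.2)
      linarith
  have hsum := h.cost.trans (Finset.sum_le_sum hcost)
  have hc0 : 0 ≤ ∑ col ∈ (Finset.Icc 1 n).image c, (led col).credit :=
    Finset.sum_nonneg (fun col hcol => (h.nonneg col hcol).1)
  have hn0 : 0 ≤ ∑ col ∈ (Finset.Icc 1 n).image c, (led col).n5 :=
    Finset.sum_nonneg (fun col hcol => (h.nonneg col hcol).2)
  have hstart := h.start.resolve_left (by omega)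
  have hdual := h.dual
  rw [Finset.sum_add_distrib, Finset.sum_add_distrib, ← Finset.mul_sum, ← Finset.mul_sum,
    ← Finset.mul_sum, Finset.sum_boole] at hsum
  rw [Finset.sum_add_distrib, ← Finset.mul_sum, ← Finset.mul_sum] at hstart
  rw [Finset.sum_add_distrib] at hdual
  change _ ≤ _ + 3613 * ((S.heavyColors k n c).card : ℝ) at hsum
  rw [primalCost_eq]
  -- The constant 3613 · 300 is multiplied by `hstart`, giving about 3.92 · 10⁹ times the credit;
  -- the factor 2 of `hdual` keeps the total below 10¹⁰.
  linarith

end State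

/-- k' ≥ 1 forces 2k / ln k < k, that is ln k > 2. The floor in k' makes k - k' at least 2K and
costs at most 1. -/
theorem large_of_one_le {k : ℕ} (hk2 : 2 ≤ k) (h : 1 ≤ smallBuffer k) :
    ∃ K, Large k K ∧ smallBuffer k ≤ k ∧ 2 * K ≤ k - smallBuffer k ∧
      (k : ℝ) - smallBuffer k ≤ 2 * K + 1 := by
  have hk0 : (0 : ℝ) < k := by positivity
  have hlog : 0 < Real.log k := Real.log_pos (by exact_mod_cast hk2)
  have h1 : (1 : ℝ) ≤ k - 2 * k / Real.log k := by
    have := Nat.floor_pos.1 h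
    exact this
  have h2 : 2 * (k : ℝ) / Real.log k = 2 * (k / Real.log k) := by ring
  have h3 : (smallBuffer k : ℝ) ≤ k - 2 * k / Real.log k := Nat.floor_le (by linarith)
  have h4 : (k : ℝ) - 2 * k / Real.log k < smallBuffer k + 1 := Nat.lt_floor_add_one _
  have h5 : 0 < (k : ℝ) / Real.log k := by positivity
  refine ⟨k / Real.log k, ⟨rfl, ?_⟩, ?_, by linarith, by linarith⟩
  · have : 2 * (k : ℝ) / Real.log k < k := by linarith
    rw [div_lt_iff₀ hlog] at this
    nlinarith
  · have : (smallBuffer k : ℝ) ≤ k := by linarith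
    exact_mod_cast this

end

end RBM

theorem mainTheorem5 :
    ∃ C : ℝ, 0 < C ∧
      ∀ (k n : ℕ) (c : ℕ → ℕ), 2 ≤ k → 1 ≤ RBM.smallBuffer k →
        ∀ S : RBM.State, RBM.Final k n c S →
          S.primalCost ≤ C * S.dualCost k n := by
  refine ⟨10 ^ 10, by norm_num, fun k n c hk2 hk1 S hS => ?_⟩
  obtain ⟨K, hk, hκ, h1, h2⟩ := RBM.large_of_one_le hk2 hk1
  rcases RBM.State.final_cases hk hκ h1 hS with rfl | ⟨ht, htk⟩
  -- In the initial state nothing is scheduled and all dual variables vanish, so both sides are 0.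
  · rw [RBM.State.primalCost_eq]
    simp [RBM.State.placed, RBM.State.dualCost, RBM.State.init, RBM.State.blockPieces, RBM.wt]
  · obtain ⟨led, hled⟩ := RBM.State.good_of_reaches hk hκ h1 hS.1
    exact hled.primalCost_le hk h2 ht htk
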